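/- Let $\alpha\in(0,2]$. Let $\theta$ be a random variable with values in $\{0,1,2,\dots\}$ and $E\theta^3<\infty$, let $\theta_j$, $j\in\mathbb Z$, be copies of $\theta$, and for each $j\in\mathbb Z$ and $k\ge 1$ let $\rho^j_k=(\rho^j_{k,1},\dots,\rho^j_{k,k})$ be a random vector with values in $[j,j+1)^k$, such that the families $(\theta_j,(\rho^j_k)_{k\ge1})$, $j\in\mathbb Z$, are independent. Let $\vartheta^{j,n}$, $j\in\mathbb Z$, $n\ge1$, be independent standard symmetric $\alpha$-stable Lévy processes ($\vartheta^{j,n}_0=0$, $E e^{iu\vartheta^{j,n}_t}=e^{-t|u|^\alpha}$), independent of $(\theta_j,(\rho^j_k)_{k\ge 1})_{j\in\mathbb Z}$. For $T>0$ let $$N^T_t=\sum_{j\in\mathbb Z}\sum_{n=1}^{\theta_j}\delta_{\frac1T\rho^j_{\theta_j,n}+\vartheta^{j,n}_t},\qquad X_T(t)=\frac{N^T_t-EN^T_t}{\sqrt T},\qquad t\ge0,$$ so that the initial configuration $\nu_T=N^T_0$ has $\theta_j$ points in $[\frac jT,\frac{j+1}T)$. Let $\mathcal S$ be the Schwartz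 space on $\mathbb R$, and let $\mathcal S'$ be the space of tempered distributions with the strong dual topology. Let $\mathcal T_0\varphi=\varphi$ and $\mathcal T_t\varphi=p_t*\varphi$ for $t>0$, where $p_t(x)=\frac1{2\pi}\int_{\mathbb R}e^{-iux}e^{-t|u|^\alpha}\,du$. Then, for all $T>0$ and $t\ge 0$, the measures $EN^T_t$ and (almost surely) $N^T_t$ are tempered, so that $X_T$ is $\mathcal S'$-valued, and there is a centered Gaussian $\mathcal S'$-valued process $X=(X(t))_{t\ge0}$ with covariance functional $$E\langle X(s),\varphi\rangle\langle X(t),\psi\rangle=E\theta\int_{\mathbb R}\varphi(x)\,\mathcal T_{|t-s|}\psi(x)\,dx+(\operatorname{Var}\theta-E\theta)\int_{\mathbb R}\mathcal T_s\varphi(x)\,\mathcal T_t\psi(x)\,dx,\qquad s,t\ge0,\ \varphi,\psi\in\mathcal S,$$ such that $X_T$ converges to $X$ in finite-dimensional distributions in $\mathcal S'$ as $T\to\infty$; that is, for all $m$ and all $t_1,\dots,t_m\ge0$ the law of $(X_T(t_1),\dots,X_T(t_m))$ on $(\mathcal S')^m$ converges weakly to the law of $(X(t_1),\dots,X(t_m))$.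 -/

import Mathlib

open MeasureTheory ProbabilityTheory Filter
open scoped NNReal Topology SchwartzMap

namespace DensityProcess

/-- The space `S'` of (real) tempered distributions on the line: the topological dual of the
Schwartz space. As a space of continuous linear maps it carries the topology of uniform
convergence on bounded subsets of the Schwartz space, i.e. the strong dual topology. -/
abbrev TemperedDual : Type := 𝓢(ℝ, ℝ) →L[ℝ] ℝ

/-- `L` is a standard symmetric `α`-stable Lévy process: it starts from `0`, has independent
increments, its increments satisfy `E exp(iu(L_t - L_s)) = exp(-(t - s)|u|^α)`, and its paths are
almost surely right-continuous with left limits. -/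
structure IsSymmetricStableLevy {Ω : Type*} [MeasurableSpace Ω] (α : ℝ) (L : ℝ≥0 → Ω → ℝ)
    (P : Measure Ω) : Prop where
  measurable : ∀ t, Measurable (L t)
  start_zero : ∀ᵐ ω ∂P, L 0 ω = 0
  indep_increments : HasIndepIncrements L P
  charFun_increment : ∀ s t : ℝ≥0, s ≤ t → ∀ u : ℝ,
    charFun (P.map (fun ω ↦ L t ω - L s ω)) u
      = Complex.exp (-((((t : ℝ) - s) * |u| ^ α : ℝ) : ℂ))
  cadlag : ∀ᵐ ω ∂P, ∀ t : ℝ≥0,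
    ContinuousWithinAt (fun r ↦ L r ω) (Set.Ici t) t ∧
      ∃ l : ℝ, Tendsto (fun r ↦ L r ω) (𝓝[<] t) (𝓝 l)

/-- The transition density `p_t` (for `t > 0`) of the standard symmetric `α`-stable Lévy process,
`p_t(x) = (2π)⁻¹ ∫ exp(-iux) exp(-t|u|^α) du`; by symmetry only the cosine part remains. -/
noncomputable def stableDensity (α t x : ℝ) : ℝ :=
  (2 * Real.pi)⁻¹ * ∫ u : ℝ, Real.cos (u * x) * Real.exp (-(t * |u| ^ α))

/-- The stable semigroup: `𝒯_t φ = p_t * φ` for `t > 0`, and `𝒯_0 φ = φ`. -/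
noncomputable def stableSemigroup (α t : ℝ) (φ : ℝ → ℝ) (x : ℝ) : ℝ :=
  if t = 0 then φ x else ∫ y : ℝ, stableDensity α t (x - y) * φ y

/-- The random data of the particle system. `θ j` is the number of particles in the `j`-th cell,
`ρ j k` is the vector of (unscaled) initial positions of these particles when `θ j = k`, and
`ξ j n` is the displacement process of the `n`-th particle of the `j`-th cell (numbered from `0`).
The pairs `(θ j, (ρ j k)_k)` are independent for different `j`; within one cell no
independence is required. -/
structure ParticleSystem {Ω : Type*} [MeasurableSpace Ω] (α : ℝ) (P : Measure Ω) where
  θ : ℤ → Ω → ℕ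
  ρ : ℤ → (k : ℕ) → Fin k → Ω → ℝ
  ξ : ℤ → ℕ → ℝ≥0 → Ω → ℝ
  measurable_θ : ∀ j, Measurable (θ j)
  identDistrib_θ : ∀ j, IdentDistrib (θ j) (θ 0) P P
  integrable_θ_cube : Integrable (fun ω ↦ (θ 0 ω : ℝ) ^ 3) P
  measurable_ρ : ∀ j k n, Measurable (ρ j k n)
  ρ_mem : ∀ (j : ℤ) k n ω, ρ j k n ω ∈ Set.Ico (j : ℝ) (j + 1)
  indep_cells : iIndepFun (fun (j : ℤ) ω ↦ (θ j ω, fun (k : ℕ) (n : Fin k) ↦ ρ j k n ω)) P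
  stable_ξ : ∀ j n, IsSymmetricStableLevy α (ξ j n) P
  indep_ξ : iIndepFun (fun (p : ℤ × ℕ) ω (t : ℝ≥0) ↦ ξ p.1 p.2 t ω) P
  indep_initial_ξ : IndepFun
    (fun ω (j : ℤ) ↦ (θ j ω, fun (k : ℕ) (n : Fin k) ↦ ρ j k n ω))
    (fun ω (p : ℤ × ℕ) (t : ℝ≥0) ↦ ξ p.1 p.2 t ω) P

namespace ParticleSystem

variable {Ω : Type*} [MeasurableSpace Ω] {α : ℝ} {P : Measure Ω}

/-- The empirical measure `N_t^T = ∑_j ∑_{n < θ_j} δ_{ρ^j_{θ_j,n} / T + ξ^{j,n}_t}`; at time `0`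
it is (almost surely) the initial configuration `ν_T`. -/
noncomputable def empirical (S : ParticleSystem α P) (T : ℝ) (t : ℝ≥0) (ω : Ω) : Measure ℝ :=
  Measure.sum fun j : ℤ ↦ ∑ n : Fin (S.θ j ω),
    Measure.dirac (S.ρ j (S.θ j ω) n ω / T + S.ξ j n t ω)

/-- The intensity measure `E N_t^T`, i.e. `A ↦ E (N_t^T(A))`. -/
noncomputable def intensity (S : ParticleSystem α P) (T : ℝ) (t : ℝ≥0) : Measure ℝ :=
  P.bind (S.empirical T t)

end ParticleSystem

open Classical in
/-- The tempered distribution `φ ↦ ∫ φ dμ` given by a measure `μ` of temperate growth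
(and `0` if `μ` is not of temperate growth). -/
noncomputable def toTempered (μ : Measure ℝ) : TemperedDual :=
  if h : μ.HasTemperateGrowth then
    haveI := h
    SchwartzMap.integralCLM ℝ μ
  else 0

/-- The normalized fluctuation `X_T(t) = (N_t^T - E N_t^T) / √T` as an element of `S'`. -/
noncomputable def ParticleSystem.fluctuation {Ω : Type*} [MeasurableSpace Ω] {α : ℝ}
    {P : Measure Ω} (S : ParticleSystem α P) (T : ℝ) (t : ℝ≥0) (ω : Ω) : TemperedDual :=
  (√T)⁻¹ • (toTempered (S.empirical T t ω) - toTempered (S.intensity T t))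

/-- Convergence of finite-dimensional distributions, as `T → ∞`, of a family `(X T)_{T > 0}` of
`S'`-valued processes to an `S'`-valued process `Y`: for all times `t 0, …, t (m - 1)` the law of
`(X T (t 0), …, X T (t (m - 1)))` on the Borel sets of `(S')^m` converges weakly to the law of
`(Y (t 0), …, Y (t (m - 1)))`. -/
def TendstoInFDD {Ω Ω' : Type*} [MeasurableSpace Ω] [MeasurableSpace Ω']
    (X : ℝ → ℝ≥0 → Ω → TemperedDual) (P : Measure Ω) [IsProbabilityMeasure P]
    (Y : ℝ≥0 → Ω' → TemperedDual) (P' : Measure Ω') [IsProbabilityMeasure P'] : Prop :=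
  ∀ (m : ℕ) (t : Fin m → ℝ≥0),
    letI : MeasurableSpace (Fin m → TemperedDual) := borel _
    haveI : BorelSpace (Fin m → TemperedDual) := ⟨rfl⟩
    TendstoInDistribution (fun (T : Set.Ioi (0 : ℝ)) ω i ↦ X T (t i) ω) atTop
      (fun ω i ↦ Y (t i) ω) (fun _ ↦ P) P'

/-- `Y` is a centered Gaussian `S'`-valued process with covariance functional `K`, i.e. the real
random variables `⟨Y t, φ⟩` are jointly Gaussian with mean `0` and
`E ⟨Y s, φ⟩ ⟨Y t, ψ⟩ = K s φ t ψ`. -/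
structure IsCenteredGaussian {Ω' : Type*} [MeasurableSpace Ω']
    (Y : ℝ≥0 → Ω' → TemperedDual) (P' : Measure Ω')
    (K : ℝ≥0 → 𝓢(ℝ, ℝ) → ℝ≥0 → 𝓢(ℝ, ℝ) → ℝ) : Prop where
  gaussian : IsGaussianProcess (fun (p : ℝ≥0 × 𝓢(ℝ, ℝ)) ω ↦ Y p.1 ω p.2) P'
  centered : ∀ t φ, ∫ ω, Y t ω φ ∂P' = 0
  covariance : ∀ s φ t ψ, ∫ ω, Y s ω φ * Y t ω ψ ∂P' = K s φ t ψ

end DensityProcess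

/-!
The fluctuation field is treated as an honest random vector of a Hilbert space. In the feature
space `L²((1 + y²)⁻¹ dy)` every point `x` has a feature vector, of norm at most a constant times
`(1 + x²)⁻¹`, and every Schwartz function `φ` an analysis vector, such that `φ x` is the inner
product of the two (`inner_analysisMap_feature`). Hence `X_T(t)` is the image, under a fixed
continuous linear map `toDual` into `S'`, of the centred and normalized sum over all particles of
the features of their positions at time `t` (`ParticleSystem.fluctuation_ae_eq`), and for several
times at once one gets a sum over the cells `[j, j+1)` of independent random vectors. The decay of
the features makes all these series converge, so that it suffices to prove convergence in law in a
finite power of the feature space and to apply the continuous mapping theorem.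

Convergence in law in a Hilbert space follows from convergence of characteristic functions
together with uniformly small second moments of the tails with respect to a Hilbert basis
(`tendsto_of_tendsto_charFun_of_tail`); no compactness theorem is needed.

* Characteristic functions: the third moment of `θ` gives a Lyapunov bound
  (`norm_integral_cexp_hasSum_sub_gaussian_le`), by which the characteristic function at a vector
  is close to the Gaussian one with the same variance. As the cell around `x` shrinks, the variance
  of the sum of `f` over its particles tends to `E θ · E f² + (Var θ - E θ) (E f)²`, where `f` is
  evaluated at a particle started from `x`; summing over the cells of width `1/T` gives a Riemann
  sum, which converges by dominated convergence (`ParticleSystem.tendsto_tsum_variance_cellSum`).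
* Tails: by Dini's theorem the tails of the feature vectors are small uniformly, relative to the
  weight `(1 + x²)⁻¹` (`exists_basisProj_uniform`), and the second moments of the tails of the
  normalized sums inherit this uniformly in `T ≥ 1` (`ParticleSystem.exists_tail_centeredSum_le`).

The limit comes from the isonormal Gaussian process of a Hilbert space `ParticleSystem.LimitSpace`
(`exists_isonormal`), composed with Hilbert-Schmidt operators `ParticleSystem.limitOp`; the
Hilbert-Schmidt property turns a Gaussian process indexed by the feature space into an actual
random vector in it (`exists_vector_of_isonormal`). Its covariance is computed from the translation
invariance of Lebesgue measure and the laws of the increments of the motions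
(`ParticleSystem.inner_limitOp_analysisMap`).
-/

namespace DensityProcess

open scoped RealInnerProductSpace

/-! ### A Hilbert space through which point evaluations of Schwartz functions factor -/

/-- The weight `(1 + x²)⁻¹`, by which all functions of a particle position are dominated. -/
noncomputable def decay (x : ℝ) : ℝ := (1 + x ^ 2)⁻¹

lemma decay_pos (x : ℝ) : 0 < decay x := by unfold decay; positivity

lemma decay_le_one (x : ℝ) : decay x ≤ 1 := by
  unfold decay
  exact inv_le_one_of_one_le₀ (by nlinarith [sq_nonneg x])

@[fun_prop]
lemma continuous_decay : Continuous decay := by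
  unfold decay
  exact Continuous.inv₀ (by fun_prop) (fun x ↦ by positivity)

@[fun_prop]
lemma measurable_decay : Measurable decay := continuous_decay.measurable

lemma integrable_decay : Integrable decay := integrable_inv_one_add_sq

/-- The weight changes by at most a constant factor under bounded shifts. -/
lemma decay_le_mul_decay {x y L : ℝ} (h : |x - y| ≤ L) :
    decay x ≤ (2 + 2 * L ^ 2) * decay y := by
  unfold decay
  have h2 : (x - y) ^ 2 ≤ L ^ 2 := by
    rw [← sq_abs]; exact pow_le_pow_left₀ (abs_nonneg _) h 2
  rw [← div_eq_mul_inv, inv_eq_one_div, div_le_div_iff₀ (by positivity) (by positivity)]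
  nlinarith [sq_nonneg (x + (x - y)), sq_nonneg (L * x), sq_nonneg L, sq_nonneg x,
    sq_nonneg (2 * x - y)]

lemma tendsto_decay_cocompact : Tendsto decay (cocompact ℝ) (𝓝 0) := by
  unfold decay
  refine Tendsto.inv_tendsto_atTop ?_
  refine tendsto_atTop_add_const_left _ _ ?_
  have : Tendsto (fun x : ℝ ↦ ‖x‖ ^ 2) (cocompact ℝ) atTop :=
    (tendsto_pow_atTop two_ne_zero).comp tendsto_norm_cocompact_atTop
  simpa using this

/-- The finite measure `(1 + y²)⁻¹ dy`. -/
noncomputable def decayMeasure : Measure ℝ := volume.withDensity fun y ↦ ENNReal.ofReal (decay y)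

instance : IsFiniteMeasure decayMeasure :=
  isFiniteMeasure_withDensity_ofReal integrable_decay.2

lemma decayMeasure_ac : decayMeasure ≪ volume := withDensity_absolutelyContinuous _ _

instance : NullSingletonClass decayMeasure := ⟨fun x ↦ decayMeasure_ac (by simp)⟩

/-- The Hilbert space `L²((1 + y²)⁻¹ dy)`. -/
abbrev FeatureSpace : Type := Lp ℝ 2 decayMeasure

noncomputable instance : MeasurableSpace FeatureSpace := borel _

instance : BorelSpace FeatureSpace := ⟨rfl⟩

instance : SecondCountableTopology FeatureSpace :=
  have : Fact ((2 : ENNReal) ≠ ⊤) := ⟨by norm_num⟩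
  inferInstance

/-- The vector `k x = (1 + x²)⁻¹ 1_{(-∞, x]}` representing evaluation at `x`. -/
noncomputable def feature (x : ℝ) : FeatureSpace :=
  decay x • indicatorConstLp 2 (measurableSet_Iic (a := x)) (measure_ne_top decayMeasure _) (1 : ℝ)

lemma norm_feature_le : ∃ C : ℝ, 0 ≤ C ∧ ∀ x, ‖feature x‖ ≤ C * decay x := by
  refine ⟨decayMeasure.real Set.univ ^ (1 / (2 : ENNReal).toReal), by positivity, fun x ↦ ?_⟩
  rw [feature, norm_smul, mul_comm, Real.norm_of_nonneg (decay_pos x).le]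
  gcongr
  · exact (decay_pos x).le
  · refine (norm_indicatorConstLp_le).trans ?_
    rw [norm_one, one_mul]
    exact Real.rpow_le_rpow measureReal_nonneg (measureReal_mono (Set.subset_univ _)) (by simp)

lemma continuous_feature : Continuous feature := by
  refine continuous_decay.smul ?_
  rw [continuous_iff_continuousAt]
  intro x
  rw [ContinuousAt]
  -- the indicators converge pointwise off the single point `x`, a null set
  have hlim : ∀ᵐ y ∂decayMeasure, Tendsto (fun z ↦ (Set.Iic z).indicator (fun _ ↦ (1 : ℝ)) y)
      (𝓝 x) (𝓝 ((Set.Iic x).indicator (fun _ ↦ (1 : ℝ)) y)) := by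
    have : ∀ᵐ y ∂decayMeasure, y ≠ x := by
      rw [ae_iff]; simp
    filter_upwards [this] with y hy
    refine tendsto_const_nhds.congr' ?_
    rcases lt_or_gt_of_ne hy with h | h
    · filter_upwards [lt_mem_nhds h] with z hz
      simp [hz.le, h.le]
    · filter_upwards [gt_mem_nhds h] with z hz
      simp [not_le.2 hz, not_le.2 h]
  refine Lp.tendsto_Lp_iff_tendsto_eLpNorm'' _ (fun z ↦ memLp_indicator_const 2
    (measurableSet_Iic (a := z)) (1 : ℝ) (Or.inr (measure_ne_top _ _))) _
    (memLp_indicator_const 2 (measurableSet_Iic (a := x)) (1 : ℝ) (Or.inr (measure_ne_top _ _)))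
    |>.2 ?_
  have key : Tendsto (fun z ↦ ∫⁻ y, ‖(Set.Iic z).indicator (fun _ ↦ (1 : ℝ)) y
      - (Set.Iic x).indicator (fun _ ↦ (1 : ℝ)) y‖ₑ ^ (2 : ℝ) ∂decayMeasure) (𝓝 x)
      (𝓝 (∫⁻ _, 0 ∂decayMeasure)) := by
    refine tendsto_lintegral_filter_of_dominated_convergence (fun _ ↦ 1) ?_ ?_ (by simp) ?_
    · refine Eventually.of_forall fun z ↦ ?_
      have h1 : Measurable ((Set.Iic z).indicator (fun _ : ℝ ↦ (1 : ℝ))) :=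
        measurable_const.indicator measurableSet_Iic
      have h2 : Measurable ((Set.Iic x).indicator (fun _ : ℝ ↦ (1 : ℝ))) :=
        measurable_const.indicator measurableSet_Iic
      exact ((h1.sub h2).enorm).pow_const _
    · refine Eventually.of_forall fun z ↦ Eventually.of_forall fun y ↦ ?_
      by_cases h1 : y ≤ z <;> by_cases h2 : y ≤ x <;> simp [Set.indicator, h1, h2]
    · filter_upwards [hlim] with y hy
      have h3 := (hy.sub_const ((Set.Iic x).indicator (fun _ ↦ (1 : ℝ)) y)).enorm
      have h4 := h3.ennrpow_const (2 : ℝ)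
      simpa using h4
  simp only [lintegral_const, zero_mul] at key
  have h5 := key.ennrpow_const (1 / 2 : ℝ)
  rw [ENNReal.zero_rpow_of_pos (by norm_num)] at h5
  refine h5.congr fun z ↦ ?_
  rw [eLpNorm_eq_lintegral_rpow_enorm_toReal (by norm_num) (by norm_num)]
  simp

lemma hasTemperateGrowth_one_add_sq : (fun x : ℝ ↦ 1 + x ^ 2).HasTemperateGrowth := by
  fun_prop

/-- The continuous linear map `A φ (y) = (1 + y²) ((1 + y²) φ)'(y)`. -/
noncomputable def analysisMap : 𝓢(ℝ, ℝ) →L[ℝ] FeatureSpace :=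
  (SchwartzMap.toLpCLM ℝ ℝ 2 decayMeasure).comp
    ((SchwartzMap.smulLeftCLM ℝ fun x : ℝ ↦ 1 + x ^ 2).comp
      ((SchwartzMap.derivCLM ℝ ℝ).comp (SchwartzMap.smulLeftCLM ℝ fun x : ℝ ↦ 1 + x ^ 2)))

lemma inner_analysisMap_feature (φ : 𝓢(ℝ, ℝ)) (x : ℝ) :
    ⟪analysisMap φ, feature x⟫ = φ x := by
  set ψ : 𝓢(ℝ, ℝ) := SchwartzMap.smulLeftCLM ℝ (fun x : ℝ ↦ 1 + x ^ 2) φ with hψ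
  have hψx : ∀ y, ψ y = (1 + y ^ 2) * φ y := fun y ↦ by
    rw [hψ, SchwartzMap.smulLeftCLM_apply_apply hasTemperateGrowth_one_add_sq, smul_eq_mul]
  rw [real_inner_comm, feature, real_inner_smul_left, L2.inner_indicatorConstLp_one]
  have h1 : ∫ y in Set.Iic x, (analysisMap φ) y ∂decayMeasure
      = ∫ y in Set.Iic x, (1 + y ^ 2) * deriv ψ y ∂decayMeasure := by
    refine setIntegral_congr_ae measurableSet_Iic ?_
    have := SchwartzMap.coeFn_toLp (SchwartzMap.smulLeftCLM ℝ (fun x : ℝ ↦ 1 + x ^ 2)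
      (SchwartzMap.derivCLM ℝ ℝ ψ)) 2 decayMeasure
    filter_upwards [this] with y hy _
    change (SchwartzMap.toLp (SchwartzMap.smulLeftCLM ℝ (fun x : ℝ ↦ 1 + x ^ 2)
      (SchwartzMap.derivCLM ℝ ℝ ψ)) 2 decayMeasure) y = _
    rw [hy, SchwartzMap.smulLeftCLM_apply_apply hasTemperateGrowth_one_add_sq, smul_eq_mul]
    rfl
  have h2 : ∫ y in Set.Iic x, (1 + y ^ 2) * deriv ψ y ∂decayMeasure
      = ∫ y in Set.Iic x, deriv ψ y := by
    rw [decayMeasure, setIntegral_withDensity_eq_setIntegral_toReal_smul (by fun_prop)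
      (by simp) _ measurableSet_Iic]
    refine setIntegral_congr_fun measurableSet_Iic fun y _ ↦ ?_
    simp only [smul_eq_mul]
    rw [ENNReal.toReal_ofReal (decay_pos y).le, decay]
    have : (1 + y ^ 2) ≠ 0 := by positivity
    field_simp
  have h3 : ∫ y in Set.Iic x, deriv ψ y = ψ x := by
    rw [integral_Iic_of_hasDerivAt_of_tendsto' (f := ψ) (m := 0)
      (fun y _ ↦ ψ.differentiableAt.hasDerivAt)]
    · simp
    · exact ((SchwartzMap.derivCLM ℝ ℝ ψ).integrable (μ := volume)).integrableOn
    · exact ψ.tendsto_cocompact.mono_left atBot_le_cocompact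
  rw [h1, h2, h3, hψx, decay]
  have : (1 + x ^ 2) ≠ 0 := by positivity
  field_simp

/-! ### Tails of Hilbert basis expansions -/

section HilbertBasis

variable {H ι : Type*} [NormedAddCommGroup H] [InnerProductSpace ℝ H]

lemma _root_.HilbertBasis.countable_index [TopologicalSpace.SeparableSpace H]
    (b : HilbertBasis ι ℝ H) : Countable ι := by
  -- the balls of radius `1 / 2` around the basis vectors are disjoint, as `√2 ≥ 1`
  have hsep : Pairwise fun i j ↦
      Disjoint (Metric.ball (b i) (1 / 2)) (Metric.ball (b j) (1 / 2)) := by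
    intro i j hij
    refine Metric.ball_disjoint_ball ?_
    have h1 : ‖b i - b j‖ ^ 2 = 2 := by
      rw [@norm_sub_sq_real, b.orthonormal.1 i, b.orthonormal.1 j, b.orthonormal.2 hij]
      norm_num
    rw [dist_eq_norm]
    nlinarith [norm_nonneg (b i - b j)]
  exact Pairwise.countable_of_isOpen_disjoint hsep (fun _ ↦ Metric.isOpen_ball)
    (fun i ↦ ⟨b i, Metric.mem_ball_self (by norm_num)⟩)

/-- The projection `∑_{i ∈ s} ⟪b i, z⟫ b i` onto the span of finitely many basis vectors. -/
noncomputable def basisProj (b : HilbertBasis ι ℝ H) (s : Finset ι) (z : H) : H :=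
  ∑ i ∈ s, ⟪b i, z⟫ • b i

lemma norm_sub_basisProj_sq (b : HilbertBasis ι ℝ H) (s : Finset ι) (z : H) :
    ‖z - basisProj b s z‖ ^ 2 = ‖z‖ ^ 2 - ∑ i ∈ s, ⟪b i, z⟫ ^ 2 := by
  have h1 : ⟪z, basisProj b s z⟫ = ∑ i ∈ s, ⟪b i, z⟫ ^ 2 := by
    rw [basisProj, inner_sum]
    refine Finset.sum_congr rfl fun i _ ↦ ?_
    rw [real_inner_smul_right, real_inner_comm, sq]
  have h2 : ‖basisProj b s z‖ ^ 2 = ∑ i ∈ s, ⟪b i, z⟫ ^ 2 := by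
    rw [← real_inner_self_eq_norm_sq, basisProj, b.orthonormal.inner_sum]
    simp [sq]
  rw [norm_sub_sq_real, h1, h2]
  ring

lemma hasSum_inner_sq (b : HilbertBasis ι ℝ H) (z : H) :
    HasSum (fun i ↦ ⟪b i, z⟫ ^ 2) (‖z‖ ^ 2) := by
  have := b.hasSum_inner_mul_inner z z
  rw [real_inner_self_eq_norm_sq] at this
  refine this.congr_fun ?_
  intro i
  simp only [real_inner_comm, sq]

/-- If a continuous curve in a Hilbert space is dominated by `(1 + x²)⁻¹`, then the tails of its
basis expansion are small uniformly along the curve, relative to the weight. -/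
lemma exists_basisProj_uniform (b : HilbertBasis ι ℝ H) {k : ℝ → H} (hk : Continuous k) {C : ℝ}
    (hkC : ∀ x, ‖k x‖ ≤ C * decay x) {ε : ℝ} (hε : 0 < ε) :
    ∃ s₀ : Finset ι, ∀ s, s₀ ⊆ s → ∀ x, ‖k x - basisProj b s (k x)‖ ^ 2 ≤ ε * decay x := by
  -- off a compact set, `‖k x‖²` itself is below `ε * decay x`
  obtain ⟨K, hK, hKε⟩ : ∃ K : Set ℝ, IsCompact K ∧ ∀ x ∉ K, C ^ 2 * decay x ≤ ε := by
    have h1 : ∀ᶠ x in cocompact ℝ, C ^ 2 * decay x < ε := by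
      have := tendsto_decay_cocompact.const_mul (C ^ 2)
      rw [mul_zero] at this
      exact this.eventually (gt_mem_nhds hε)
    obtain ⟨K, hK, hKs⟩ := mem_cocompact.1 h1
    exact ⟨K, hK, fun x hx ↦ (hKs hx).le⟩
  obtain ⟨δ, hδ, hδK⟩ : ∃ δ > 0, ∀ x ∈ K, δ ≤ ε * decay x := by
    rcases K.eq_empty_or_nonempty with rfl | hne
    · exact ⟨1, one_pos, by simp⟩
    · obtain ⟨x₀, -, h⟩ := hK.exists_isMinOn hne
        (f := fun x ↦ ε * decay x) (by fun_prop)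
      exact ⟨ε * decay x₀, mul_pos hε (decay_pos _), fun x hx ↦ h hx⟩
  -- on the compact set, the partial sums increase to a continuous limit: Dini's theorem
  have hD : TendstoUniformlyOn (fun (s : Finset ι) x ↦ ∑ i ∈ s, ⟪b i, k x⟫ ^ 2)
      (fun x ↦ ‖k x‖ ^ 2) atTop K := by
    refine Monotone.tendstoUniformlyOn_of_forall_tendsto hK (fun s ↦ ?_) ?_ ?_ ?_
    · exact Continuous.continuousOn (by fun_prop)
    · intro x _ s t hst
      exact Finset.sum_le_sum_of_subset_of_nonneg hst fun _ _ _ ↦ sq_nonneg _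
    · exact Continuous.continuousOn (by fun_prop)
    · exact fun x _ ↦ hasSum_inner_sq b (k x)
  obtain ⟨s₀, hs₀⟩ := eventually_atTop.1 (Metric.tendstoUniformlyOn_iff.1 hD δ hδ)
  refine ⟨s₀, fun s hs x ↦ ?_⟩
  rw [norm_sub_basisProj_sq]
  by_cases hx : x ∈ K
  · have h1 := hs₀ s hs x hx
    rw [Real.dist_eq] at h1
    exact ((le_abs_self _).trans h1.le).trans (hδK x hx)
  · have h1 : ‖k x‖ ^ 2 ≤ (C * decay x) ^ 2 := by gcongr; exact hkC x
    have h2 : 0 ≤ ∑ i ∈ s, ⟪b i, k x⟫ ^ 2 := Finset.sum_nonneg fun _ _ ↦ sq_nonneg _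
    have h3 := mul_le_mul_of_nonneg_right (hKε x hx) (decay_pos x).le
    nlinarith

end HilbertBasis

/-! ### A quantitative central limit theorem for infinite sums -/

section CLT

lemma norm_prod_sub_prod_le {ι : Type*} (s : Finset ι) (a b : ι → ℂ)
    (ha : ∀ i, ‖a i‖ ≤ 1) (hb : ∀ i, ‖b i‖ ≤ 1) :
    ‖∏ i ∈ s, a i - ∏ i ∈ s, b i‖ ≤ ∑ i ∈ s, ‖a i - b i‖ := by
  classical
  induction s using Finset.induction_on with
  | empty => simp
  | insert i s hi ih =>
    rw [Finset.prod_insert hi, Finset.prod_insert hi, Finset.sum_insert hi]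
    have h1 : ‖∏ j ∈ s, b j‖ ≤ 1 := by
      rw [norm_prod]
      exact Finset.prod_le_one (fun _ _ ↦ norm_nonneg _) (fun j _ ↦ hb j)
    calc ‖a i * ∏ j ∈ s, a j - b i * ∏ j ∈ s, b j‖
        = ‖a i * (∏ j ∈ s, a j - ∏ j ∈ s, b j) + (a i - b i) * ∏ j ∈ s, b j‖ := by
          congr 1; ring
      _ ≤ ‖a i‖ * ‖∏ j ∈ s, a j - ∏ j ∈ s, b j‖ + ‖a i - b i‖ * ‖∏ j ∈ s, b j‖ := by
          refine (norm_add_le _ _).trans ?_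
          rw [norm_mul, norm_mul]
      _ ≤ 1 * ‖∏ j ∈ s, a j - ∏ j ∈ s, b j‖ + ‖a i - b i‖ * 1 := by
          gcongr
          exact ha i
      _ ≤ ‖a i - b i‖ + ∑ j ∈ s, ‖a j - b j‖ := by linarith

lemma norm_cexp_mul_I_sub_le (x : ℝ) :
    ‖Complex.exp (x * Complex.I) - (1 + x * Complex.I - (x : ℂ) ^ 2 / 2)‖ ≤ 4 * |x| ^ 3 := by
  rcases le_total |x| 1 with h | h
  · have h1 : ‖(x : ℂ) * Complex.I‖ = |x| := by simp
    have h2 := Complex.exp_bound (x := (x : ℂ) * Complex.I) (h1 ▸ h) (n := 3) (by norm_num)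
    rw [h1] at h2
    have h3 : ∑ m ∈ Finset.range 3, ((x : ℂ) * Complex.I) ^ m / m.factorial
        = 1 + x * Complex.I - (x : ℂ) ^ 2 / 2 := by
      simp [Finset.sum_range_succ, mul_pow]
      ring
    rw [h3] at h2
    refine h2.trans ?_
    have : 0 ≤ |x| ^ 3 := by positivity
    norm_num [Nat.factorial]
    nlinarith
  · have h1 : ‖Complex.exp (x * Complex.I)‖ = 1 := Complex.norm_exp_ofReal_mul_I x
    have h2 : ‖(1 + x * Complex.I - (x : ℂ) ^ 2 / 2)‖ ≤ 1 + |x| + |x| ^ 2 / 2 := by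
      refine (norm_sub_le _ _).trans ?_
      refine add_le_add ((norm_add_le _ _).trans ?_) ?_ <;> simp
    refine (norm_sub_le _ _).trans ?_
    rw [h1]
    nlinarith [sq_nonneg |x|, mul_le_mul h h (by norm_num) (by positivity)]

variable {Ω : Type*} [MeasurableSpace Ω] {P : Measure Ω} [IsProbabilityMeasure P]

lemma integrable_cexp_mul_I {f : Ω → ℝ} (hf : AEMeasurable f P) :
    Integrable (fun ω ↦ Complex.exp (f ω * Complex.I)) P := by
  refine Integrable.of_bound (C := 1) ?_ ?_
  · exact (Complex.measurable_exp.comp_aemeasurable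
      ((Complex.measurable_ofReal.comp_aemeasurable hf).mul_const _)).aestronglyMeasurable
  · exact Eventually.of_forall fun ω ↦ (Complex.norm_exp_ofReal_mul_I _).le

lemma norm_integral_cexp_le_one (f : Ω → ℝ) :
    ‖∫ ω, Complex.exp (f ω * Complex.I) ∂P‖ ≤ 1 := by
  refine (norm_integral_le_integral_norm _).trans ?_
  simp [Complex.norm_exp_ofReal_mul_I]

/-- A centered variable with small third moment has nearly Gaussian characteristic function. -/
lemma norm_integral_cexp_sub_gaussian_le {U : Ω → ℝ} (hU : Measurable U)
    (h3 : Integrable (fun ω ↦ |U ω| ^ 3) P) (h0 : ∫ ω, U ω ∂P = 0) :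
    ‖∫ ω, Complex.exp (U ω * Complex.I) ∂P - Complex.exp (-((∫ ω, U ω ^ 2 ∂P) / 2 : ℝ))‖
      ≤ 4 * ∫ ω, |U ω| ^ 3 ∂P + (∫ ω, U ω ^ 2 ∂P) ^ 2 := by
  have hm3 : MemLp U 3 P := by
    refine (integrable_norm_rpow_iff hU.aestronglyMeasurable (by norm_num) (by norm_num)).1 ?_
    simpa using h3
  have hi1 : Integrable U P := hm3.integrable (by norm_num)
  have hi2 : Integrable (fun ω ↦ U ω ^ 2) P :=
    (hm3.mono_exponent (p := 2) (by norm_num)).integrable_sq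
  set v := ∫ ω, U ω ^ 2 ∂P with hv
  have hv0 : 0 ≤ v := integral_nonneg fun _ ↦ sq_nonneg _
  have hi1C : Integrable (fun ω ↦ (U ω : ℂ) * Complex.I) P := hi1.ofReal.mul_const _
  have hi2C : Integrable (fun ω ↦ (U ω : ℂ) ^ 2 / 2) P := by
    have := (hi2.ofReal (𝕜 := ℂ)).div_const 2
    simpa using this
  have hi3 : Integrable (fun ω ↦ 1 + (U ω : ℂ) * Complex.I) P := (integrable_const _).add hi1C
  have hi4 : Integrable (fun ω ↦ 1 + (U ω : ℂ) * Complex.I - (U ω : ℂ) ^ 2 / 2) P :=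
    hi3.sub hi2C
  have hpoly : ∫ ω, (1 + U ω * Complex.I - (U ω : ℂ) ^ 2 / 2) ∂P = ((1 - v / 2 : ℝ) : ℂ) := by
    rw [integral_sub hi3 hi2C,
      integral_add (integrable_const _) hi1C, integral_mul_const, integral_div]
    have e1 : ∫ ω, (U ω : ℂ) ∂P = 0 := by rw [integral_complex_ofReal, h0]; simp
    have e2 : ∫ ω, (U ω : ℂ) ^ 2 ∂P = (v : ℂ) := by
      rw [hv, ← integral_complex_ofReal]; simp
    rw [e1, e2]
    simp
  have hA : ‖∫ ω, Complex.exp (U ω * Complex.I) ∂P - ((1 - v / 2 : ℝ) : ℂ)‖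
      ≤ 4 * ∫ ω, |U ω| ^ 3 ∂P := by
    rw [← hpoly, ← integral_sub (integrable_cexp_mul_I hU.aemeasurable)
      hi4, ← integral_const_mul]
    refine (norm_integral_le_integral_norm _).trans ?_
    refine integral_mono_of_nonneg (Eventually.of_forall fun _ ↦ norm_nonneg _)
      (h3.const_mul 4) (Eventually.of_forall fun ω ↦ norm_cexp_mul_I_sub_le _)
  have hB : ‖((1 - v / 2 : ℝ) : ℂ) - Complex.exp (-(v / 2 : ℝ))‖ ≤ v ^ 2 := by
    rw [← Complex.ofReal_neg, ← Complex.ofReal_exp, ← Complex.ofReal_sub, Complex.norm_real,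
      Real.norm_eq_abs, abs_sub_comm, abs_of_nonneg]
    · have h1 : Real.exp (-(v / 2)) ≤ 1 / (1 + v / 2) := by
        rw [Real.exp_neg, ← one_div]
        exact one_div_le_one_div_of_le (by positivity) (by linarith [Real.add_one_le_exp (v / 2)])
      have h2 : 1 / (1 + v / 2) ≤ 1 - v / 2 + v ^ 2 := by
        rw [div_le_iff₀ (by positivity)]
        nlinarith [pow_nonneg hv0 3]
      linarith
    · linarith [Real.add_one_le_exp (-(v / 2))]
  calc _ = ‖(∫ ω, Complex.exp (U ω * Complex.I) ∂P - ((1 - v / 2 : ℝ) : ℂ))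
        + (((1 - v / 2 : ℝ) : ℂ) - Complex.exp (-(v / 2 : ℝ)))‖ := by congr 1; ring
    _ ≤ _ := (norm_add_le _ _).trans (add_le_add hA hB)

/-- **Lyapunov's theorem for series**: the characteristic function at `1` of an almost surely
convergent series of independent centered variables is close to the Gaussian one. -/
theorem norm_integral_cexp_hasSum_sub_gaussian_le {ι : Type*} [Countable ι] {U : ι → Ω → ℝ}
    (hU : ∀ j, Measurable (U j)) (hind : iIndepFun U P) (h0 : ∀ j, ∫ ω, U j ω ∂P = 0)
    (h3 : ∀ j, Integrable (fun ω ↦ |U j ω| ^ 3) P)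
    (hs3 : Summable fun j ↦ ∫ ω, |U j ω| ^ 3 ∂P) (hs2 : Summable fun j ↦ ∫ ω, U j ω ^ 2 ∂P)
    {δ : ℝ} (hδ : ∀ j, ∫ ω, U j ω ^ 2 ∂P ≤ δ) {S : Ω → ℝ}
    (hS : ∀ᵐ ω ∂P, HasSum (fun j ↦ U j ω) (S ω)) :
    ‖∫ ω, Complex.exp (S ω * Complex.I) ∂P
        - Complex.exp (-((∑' j, ∫ ω, U j ω ^ 2 ∂P) / 2 : ℝ))‖
      ≤ 4 * ∑' j, ∫ ω, |U j ω| ^ 3 ∂P + δ * ∑' j, ∫ ω, U j ω ^ 2 ∂P := by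
  set v : ι → ℝ := fun j ↦ ∫ ω, U j ω ^ 2 ∂P with hv
  have hv0 : ∀ j, 0 ≤ v j := fun j ↦ integral_nonneg fun _ ↦ sq_nonneg _
  have hu0 : ∀ j, 0 ≤ ∫ ω, |U j ω| ^ 3 ∂P := fun j ↦ integral_nonneg fun _ ↦ by positivity
  -- for finite partial sums, compare the two products factor by factor
  have hfin : ∀ s : Finset ι, ‖∫ ω, Complex.exp ((∑ j ∈ s, U j ω : ℝ) * Complex.I) ∂P
      - Complex.exp (-((∑ j ∈ s, v j) / 2 : ℝ))‖
      ≤ 4 * ∑' j, ∫ ω, |U j ω| ^ 3 ∂P + δ * ∑' j, v j := by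
    intro s
    have hprod : ∫ ω, Complex.exp ((∑ j ∈ s, U j ω : ℝ) * Complex.I) ∂P
        = ∏ j ∈ s, ∫ ω, Complex.exp (U j ω * Complex.I) ∂P := by
      have h := congrFun ((hind.restrict s).charFun_map_fun_finsetSum_eq_prod
        (fun j _ ↦ (hU j).aemeasurable)) 1
      have hm : Measurable fun ω ↦ ∑ j ∈ s, U j ω := by fun_prop
      rw [Finset.prod_apply] at h
      simp only [charFun_apply_real] at h
      rw [integral_map hm.aemeasurable (by fun_prop)] at h
      simp only [Complex.ofReal_one, one_mul] at h
      rw [h]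
      refine Finset.prod_congr rfl fun j _ ↦ ?_
      rw [integral_map (hU j).aemeasurable (by fun_prop)]
    have hexp : Complex.exp (-((∑ j ∈ s, v j) / 2 : ℝ))
        = ∏ j ∈ s, Complex.exp (-(v j / 2 : ℝ)) := by
      rw [← Complex.exp_sum]
      congr 1
      push_cast
      rw [Finset.sum_neg_distrib, Finset.sum_div]
    rw [hprod, hexp]
    refine (norm_prod_sub_prod_le s _ _ (fun j ↦ norm_integral_cexp_le_one _) fun j ↦ ?_).trans ?_
    · rw [← Complex.ofReal_neg, ← Complex.ofReal_exp, Complex.norm_real,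
        Real.norm_of_nonneg (Real.exp_pos _).le]
      exact Real.exp_le_one_iff.2 (by linarith [hv0 j])
    · calc ∑ j ∈ s, ‖∫ ω, Complex.exp (U j ω * Complex.I) ∂P - Complex.exp (-(v j / 2 : ℝ))‖
          ≤ ∑ j ∈ s, (4 * ∫ ω, |U j ω| ^ 3 ∂P + δ * v j) := by
            refine Finset.sum_le_sum fun j _ ↦ ?_
            refine (norm_integral_cexp_sub_gaussian_le (hU j) (h3 j) (h0 j)).trans ?_
            have := mul_le_mul_of_nonneg_right (hδ j) (hv0 j)
            simp only [hv] at this ⊢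
            nlinarith
        _ = 4 * ∑ j ∈ s, ∫ ω, |U j ω| ^ 3 ∂P + δ * ∑ j ∈ s, v j := by
            rw [Finset.sum_add_distrib, Finset.mul_sum, Finset.mul_sum]
        _ ≤ _ := by
            rcases isEmpty_or_nonempty ι with hι | ⟨⟨j⟩⟩
            · simp [Finset.eq_empty_of_isEmpty s]
            have hδ0 : 0 ≤ δ := (hv0 j).trans (hδ j)
            gcongr
            · exact hs3.sum_le_tsum _ fun j _ ↦ hu0 j
            · exact hs2.sum_le_tsum _ fun j _ ↦ hv0 j
  -- both sides pass to the limit along finite subsets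
  have hlim1 : Tendsto (fun s : Finset ι ↦
      ∫ ω, Complex.exp ((∑ j ∈ s, U j ω : ℝ) * Complex.I) ∂P) atTop
      (𝓝 (∫ ω, Complex.exp (S ω * Complex.I) ∂P)) := by
    refine tendsto_integral_filter_of_dominated_convergence (fun _ ↦ 1) ?_ ?_
      (integrable_const _) ?_
    · exact Eventually.of_forall fun s ↦
        (integrable_cexp_mul_I (Finset.measurable_fun_sum s fun j _ ↦ hU j).aemeasurable).1
    · exact Eventually.of_forall fun s ↦ Eventually.of_forall fun ω ↦
        (Complex.norm_exp_ofReal_mul_I _).le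
    · filter_upwards [hS] with ω hω
      have hc : Continuous fun x : ℝ ↦ Complex.exp (x * Complex.I) := by fun_prop
      exact (hc.tendsto _).comp hω
  have hlim2 : Tendsto (fun s : Finset ι ↦ Complex.exp (-((∑ j ∈ s, v j) / 2 : ℝ))) atTop
      (𝓝 (Complex.exp (-((∑' j, v j) / 2 : ℝ)))) := by
    have hc : Continuous fun x : ℝ ↦ Complex.exp (-(x / 2 : ℝ)) := by fun_prop
    exact (hc.tendsto _).comp hs2.hasSum
  exact le_of_tendsto (hlim1.sub hlim2).norm (Eventually.of_forall hfin)

end CLT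

/-! ### The isonormal Gaussian process of a Hilbert space -/

section Isonormal

lemma norm_cexp_mul_I_sub_cexp_mul_I_le (x y : ℝ) :
    ‖Complex.exp (x * Complex.I) - Complex.exp (y * Complex.I)‖ ≤ |x - y| := by
  have h : Complex.exp (x * Complex.I) - Complex.exp (y * Complex.I)
      = Complex.exp (y * Complex.I) * (Complex.exp (Complex.I * (x - y : ℝ)) - 1) := by
    rw [mul_sub, ← Complex.exp_add, mul_one]
    congr 2
    push_cast
    ring
  rw [h, norm_mul, Complex.norm_exp_ofReal_mul_I, one_mul]
  exact Real.norm_exp_I_mul_ofReal_sub_one_le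

variable {Ω : Type*} [MeasurableSpace Ω] {P : Measure Ω}

/-- A linear isometry `W` into `L²` is an isonormal process if all `W h` are centered Gaussian
(with variance `‖h‖²`, as `W` is an isometry). -/
def IsIsonormal {E : Type*} [NormedAddCommGroup E] [InnerProductSpace ℝ E]
    (W : E →ₗᵢ[ℝ] Lp ℝ 2 P) : Prop :=
  ∀ h : E, ∫ ω, Complex.exp (W h ω * Complex.I) ∂P = Complex.exp (-(‖h‖ ^ 2 / 2 : ℝ))

variable [IsProbabilityMeasure P]

lemma integral_abs_le_norm_Lp_two (f : Lp ℝ 2 P) : ∫ ω, |f ω| ∂P ≤ ‖f‖ := by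
  have h2 := Lp.memLp f
  have h1 : eLpNorm f 1 P ≤ eLpNorm f 2 P :=
    eLpNorm_le_eLpNorm_of_exponent_le (by norm_num) h2.1
  have h3 : ∫ ω, |f ω| ∂P = (eLpNorm f 1 P).toReal := by
    rw [eLpNorm_one_eq_lintegral_enorm, ← integral_norm_eq_lintegral_enorm h2.1]
    rfl
  rw [h3, Lp.norm_def]
  exact ENNReal.toReal_mono h2.2.ne h1

/-- The value at `1` of the characteristic function depends continuously on the variable in `L²`. -/
lemma continuous_integral_cexp_Lp_two :
    Continuous fun f : Lp ℝ 2 P ↦ ∫ ω, Complex.exp (f ω * Complex.I) ∂P := by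
  refine LipschitzWith.continuous (K := 1) (LipschitzWith.of_dist_le_mul fun f g ↦ ?_)
  rw [dist_eq_norm, dist_eq_norm, NNReal.coe_one, one_mul]
  have hf : AEMeasurable f P := (Lp.aestronglyMeasurable f).aemeasurable
  have hg : AEMeasurable g P := (Lp.aestronglyMeasurable g).aemeasurable
  rw [← integral_sub (integrable_cexp_mul_I hf) (integrable_cexp_mul_I hg)]
  refine (norm_integral_le_integral_norm _).trans ?_
  refine le_trans ?_ (integral_abs_le_norm_Lp_two (f - g))
  refine integral_mono_of_nonneg (Eventually.of_forall fun _ ↦ norm_nonneg _)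
    ((Lp.memLp (f - g)).integrable (by norm_num)).abs ?_
  filter_upwards [Lp.coeFn_sub f g] with ω hω
  rw [hω]
  exact norm_cexp_mul_I_sub_cexp_mul_I_le _ _

/-- A linear isometry `W` from a Hilbert space to the centered Gaussian variables in `L²`. It is
built from independent standard Gaussian coordinates along a Hilbert basis. -/
theorem exists_isonormal (E : Type) [NormedAddCommGroup E] [InnerProductSpace ℝ E]
    [CompleteSpace E] :
    ∃ (Ω' : Type) (_ : MeasurableSpace Ω') (P' : Measure Ω') (_ : IsProbabilityMeasure P')
      (W : E →ₗᵢ[ℝ] Lp ℝ 2 P'), IsIsonormal W := by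
  classical
  obtain ⟨w, b, -⟩ := exists_hilbertBasis ℝ E
  let P' : Measure (w → ℝ) := Measure.infinitePi fun _ ↦ gaussianReal 0 1
  have hlaw : ∀ i : w, P'.map (fun ω ↦ ω i) = gaussianReal 0 1 := fun i ↦
    Measure.infinitePi_map_eval (fun _ ↦ gaussianReal 0 1) i
  have hmeas : ∀ i : w, Measurable (fun ω : w → ℝ ↦ ω i) := fun i ↦ measurable_pi_apply i
  have hmem : ∀ i : w, MemLp (fun ω : w → ℝ ↦ ω i) 2 P' := fun i ↦ by
    have h := memLp_id_gaussianReal (μ := 0) (v := 1) 2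
    rw [← hlaw i] at h
    exact (memLp_map_measure_iff (by fun_prop) (hmeas i).aemeasurable).1 h
  have hind : iIndepFun (fun (i : w) (ω : w → ℝ) ↦ ω i) P' :=
    iIndepFun_infinitePi (P := fun _ ↦ gaussianReal 0 1) (X := fun _ x ↦ x) (by fun_prop)
  have hmean : ∀ i : w, ∫ ω, ω i ∂P' = 0 := fun i ↦ by
    have := integral_map (μ := P') (hmeas i).aemeasurable
      (f := fun x : ℝ ↦ x) (by fun_prop)
    rw [hlaw i, integral_id_gaussianReal] at this
    exact this.symm
  have hsq : ∀ i : w, ∫ ω, ω i * ω i ∂P' = 1 := fun i ↦ by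
    have := integral_map (μ := P') (hmeas i).aemeasurable
      (f := fun x : ℝ ↦ x * x) (by fun_prop)
    have hv := variance_id_gaussianReal (μ := 0) (v := 1)
    rw [variance_of_integral_eq_zero (by fun_prop) (by simp)] at hv
    rw [hlaw i] at this
    rw [← this]
    simpa [sq] using hv
  let e : w → Lp ℝ 2 P' := fun i ↦ (hmem i).toLp
  have he : Orthonormal ℝ e := by
    rw [orthonormal_iff_ite]
    intro i j
    have h1 : ⟪e i, e j⟫ = ∫ ω, ω i * ω j ∂P' := by
      rw [L2.inner_def]
      refine integral_congr_ae ?_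
      filter_upwards [(hmem i).coeFn_toLp, (hmem j).coeFn_toLp] with ω h1 h2
      rw [h1, h2]
      simp [mul_comm]
    rw [h1]
    split_ifs with hij
    · subst hij; exact hsq i
    · have := (hind.indepFun hij).integral_fun_mul_eq_mul_integral
        (hmem i).1 (hmem j).1
      rw [this, hmean i, zero_mul]
  let W : E →ₗᵢ[ℝ] Lp ℝ 2 P' := he.orthogonalFamily.linearIsometry.comp b.repr.toLinearIsometry
  refine ⟨w → ℝ, inferInstance, P', inferInstance, W, fun h ↦ ?_⟩
  have hW : HasSum (fun i ↦ ⟪b i, h⟫ • e i) (W h) := by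
    have := he.orthogonalFamily.hasSum_linearIsometry (b.repr h)
    refine this.congr_fun fun i ↦ ?_
    simp [LinearIsometry.toSpanSingleton_apply, b.repr_apply_apply]
  -- finite linear combinations of the coordinates are Gaussian
  have hfin : ∀ s : Finset w, ∫ ω, Complex.exp ((∑ i ∈ s, ⟪b i, h⟫ • e i : Lp ℝ 2 P') ω
      * Complex.I) ∂P' = Complex.exp (-((∑ i ∈ s, ⟪b i, h⟫ ^ 2) / 2 : ℝ)) := by
    intro s
    have h1 : ∀ᵐ ω ∂P', (∑ i ∈ s, ⟪b i, h⟫ • e i : Lp ℝ 2 P') ω = ∑ i ∈ s, ⟪b i, h⟫ * ω i := by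
      have h2 : ∀ᵐ ω ∂P', ∀ i ∈ s, (⟪b i, h⟫ • e i : Lp ℝ 2 P') ω = ⟪b i, h⟫ * ω i := by
        rw [Finset.eventually_all]
        intro i _
        filter_upwards [Lp.coeFn_smul (⟪b i, h⟫) (e i), (hmem i).coeFn_toLp] with ω h3 h4
        rw [h3, Pi.smul_apply, h4, smul_eq_mul]
      filter_upwards [h2, Lp.coeFn_finsetSum s (fun i ↦ ⟪b i, h⟫ • e i)] with ω h2 h5
      rw [h5, Finset.sum_apply]
      exact Finset.sum_congr rfl fun i hi ↦ h2 i hi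
    have h3 : ∫ ω, Complex.exp ((∑ i ∈ s, ⟪b i, h⟫ • e i : Lp ℝ 2 P') ω * Complex.I) ∂P'
        = ∫ ω, Complex.exp ((∑ i ∈ s, ⟪b i, h⟫ * ω i : ℝ) * Complex.I) ∂P' := by
      refine integral_congr_ae ?_
      filter_upwards [h1] with ω hω
      rw [hω]
    have hind' : iIndepFun (fun (i : w) (ω : w → ℝ) ↦ ⟪b i, h⟫ * ω i) P' :=
      hind.comp (fun i x ↦ ⟪b i, h⟫ * x) (fun i ↦ by fun_prop)
    have h4 := congrFun ((hind'.restrict s).charFun_map_fun_finsetSum_eq_prod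
      (fun j _ ↦ ((hmeas j).const_mul _).aemeasurable)) 1
    rw [Finset.prod_apply] at h4
    rw [charFun_apply_real, integral_map (Finset.measurable_fun_sum s fun j _ ↦
      (hmeas j).const_mul _).aemeasurable (by fun_prop)] at h4
    simp only [Complex.ofReal_one, one_mul] at h4
    rw [h3, h4, ← Complex.ofReal_neg, Finset.sum_div, ← Finset.sum_neg_distrib,
      Complex.ofReal_sum, Complex.exp_sum]
    refine Finset.prod_congr rfl fun i _ ↦ ?_
    have h5 : P'.map (fun ω ↦ ⟪b i, h⟫ * ω i) = (P'.map (fun ω ↦ ω i)).map (⟪b i, h⟫ * ·) := by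
      rw [Measure.map_map (by fun_prop) (by fun_prop)]
      rfl
    rw [h5, hlaw i, charFun_map_mul, charFun_gaussianReal]
    congr 1
    push_cast
    simp
  have hl1 := (continuous_integral_cexp_Lp_two.tendsto (W h)).comp hW
  have hl2 : Tendsto (fun s : Finset w ↦ Complex.exp (-((∑ i ∈ s, ⟪b i, h⟫ ^ 2) / 2 : ℝ))) atTop
      (𝓝 (Complex.exp (-(‖h‖ ^ 2 / 2 : ℝ)))) := by
    have hc : Continuous fun x : ℝ ↦ Complex.exp (-(x / 2 : ℝ)) := by fun_prop
    exact (hc.tendsto _).comp (hasSum_inner_sq b h)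
  refine tendsto_nhds_unique hl1 (hl2.congr fun s ↦ ?_)
  rw [← hfin s]
  rfl

end Isonormal

section IsonormalLemmas

variable {Ω : Type*} [MeasurableSpace Ω] {P : Measure Ω}
variable {E : Type*} [NormedAddCommGroup E] [InnerProductSpace ℝ E] {W : E →ₗᵢ[ℝ] Lp ℝ 2 P}

/-- Finite sums commute with `W`, almost surely. -/
lemma sum_smul_isonormal_ae {T : Type*} (s : Finset T) (c : T → ℝ) (v : T → E) {X : T → Ω → ℝ}
    (hX : ∀ p, X p =ᵐ[P] W (v p)) :
    (fun ω ↦ ∑ p ∈ s, c p * X p ω) =ᵐ[P] W (∑ p ∈ s, c p • v p) := by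
  have h2 : ∀ᵐ ω ∂P, ∀ p ∈ s, W (c p • v p) ω = c p * X p ω := by
    rw [Finset.eventually_all]
    intro p _
    filter_upwards [Lp.coeFn_smul (c p) (W (v p)), hX p] with ω h3 h4
    rw [map_smul, h3, Pi.smul_apply, h4, smul_eq_mul]
  filter_upwards [h2, Lp.coeFn_finsetSum s (fun p ↦ W (c p • v p))] with ω h2 h5
  rw [map_sum, h5, Finset.sum_apply]
  exact Finset.sum_congr rfl fun p hp ↦ (h2 p hp).symm

lemma integral_isonormal_mul {X Y : Ω → ℝ} {h g : E} (hX : X =ᵐ[P] W h) (hY : Y =ᵐ[P] W g) :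
    ∫ ω, X ω * Y ω ∂P = ⟪h, g⟫ := by
  rw [← W.inner_map_map, L2.inner_def]
  refine integral_congr_ae ?_
  filter_upwards [hX, hY] with ω h1 h2
  rw [h1, h2]
  simp [mul_comm]

variable [IsProbabilityMeasure P]

lemma map_isonormal_eq_gaussianReal (hW : IsIsonormal W) {X : Ω → ℝ} {h : E} (hX : X =ᵐ[P] W h) :
    P.map X = gaussianReal 0 (‖h‖₊ ^ 2) := by
  have hXm : AEMeasurable X P := (Lp.aestronglyMeasurable (W h)).aemeasurable.congr hX.symm
  have := Measure.isProbabilityMeasure_map hXm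
  refine Measure.ext_of_charFun (funext fun t ↦ ?_)
  rw [charFun_gaussianReal, charFun_apply_real, integral_map hXm (by fun_prop)]
  have h1 : ∫ ω, Complex.exp (t * X ω * Complex.I) ∂P
      = ∫ ω, Complex.exp (W (t • h) ω * Complex.I) ∂P := by
    refine integral_congr_ae ?_
    filter_upwards [Lp.coeFn_smul t (W h), hX] with ω h3 h4
    rw [map_smul, h3, Pi.smul_apply, h4, smul_eq_mul]
    push_cast
    rfl
  rw [h1, hW, norm_smul]
  congr 1
  push_cast
  simp only [mul_pow, Real.norm_eq_abs]
  rw [← Complex.ofReal_pow, sq_abs]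
  push_cast
  ring

lemma isGaussianProcess_of_ae_eq_isonormal (hW : IsIsonormal W) {T : Type*} (v : T → E)
    {X : T → Ω → ℝ}
    (hX : ∀ p, X p =ᵐ[P] W (v p)) : IsGaussianProcess X P := by
  classical
  refine ⟨fun I ↦ ⟨isGaussian_of_map_eq_gaussianReal fun L ↦ ?_⟩⟩
  have hXm : ∀ p, AEMeasurable (X p) P := fun p ↦
    (Lp.aestronglyMeasurable (W (v p))).aemeasurable.congr (hX p).symm
  have hm : AEMeasurable (fun ω ↦ I.restrict (X · ω)) P :=
    aemeasurable_pi_lambda _ fun p ↦ hXm p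
  rw [AEMeasurable.map_map_of_aemeasurable L.continuous.measurable.aemeasurable hm]
  refine ⟨0, _, map_isonormal_eq_gaussianReal hW (h := ∑ p : I, L (Pi.single p 1) • v p) ?_⟩
  refine EventuallyEq.trans ?_
    (sum_smul_isonormal_ae (W := W) (Finset.univ : Finset I) (fun p ↦ L (Pi.single p 1))
      (fun p ↦ v p) (X := fun p ↦ X p) fun p ↦ hX p)
  refine Eventually.of_forall fun ω ↦ ?_
  have h1 : I.restrict (X · ω) = ∑ p : I, X p ω • (Pi.single p (1 : ℝ) : I → ℝ) := by
    ext q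
    simp [Finset.sum_apply, Pi.single_apply]
  simp only [Function.comp_apply]
  rw [h1, map_sum]
  refine Finset.sum_congr rfl fun p _ ↦ ?_
  rw [map_smul, smul_eq_mul, mul_comm]

lemma integral_isonormal (hW : IsIsonormal W) {X : Ω → ℝ} {h : E} (hX : X =ᵐ[P] W h) :
    ∫ ω, X ω ∂P = 0 := by
  have hXm : AEMeasurable X P := (Lp.aestronglyMeasurable (W h)).aemeasurable.congr hX.symm
  have h1 := integral_map hXm (f := fun x : ℝ ↦ x) (by fun_prop)
  rw [map_isonormal_eq_gaussianReal hW hX, integral_id_gaussianReal] at h1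
  exact h1.symm

end IsonormalLemmas

/-! ### The stable semigroup as an expectation -/

section Stable

open FourierTransform

lemma integrable_exp_neg_mul_abs_rpow {α τ : ℝ} (hα : 0 < α) (hτ : 0 < τ) :
    Integrable fun u : ℝ ↦ Real.exp (-(τ * |u| ^ α)) := by
  have h1 : IntegrableOn (fun u : ℝ ↦ Real.exp (-(τ * u ^ α))) (Set.Ioi 0) := by
    refine (integrableOn_rpow_mul_exp_neg_mul_rpow (s := 0) (by norm_num) hα hτ).congr_fun ?_
      measurableSet_Ioi
    intro u _
    simp
  have h2 : IntegrableOn (fun u : ℝ ↦ Real.exp (-(τ * |u| ^ α))) (Set.Ioi 0) :=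
    h1.congr_fun (fun u hu ↦ by simp only [abs_of_pos (Set.mem_Ioi.1 hu)]) measurableSet_Ioi
  have h3 : IntegrableOn (fun u : ℝ ↦ Real.exp (-(τ * |u| ^ α))) (Set.Iic 0) := by
    rw [← integrableOn_Ici_iff_integrableOn_Ioi] at h2
    have h4 : IntegrableOn ((fun u : ℝ ↦ Real.exp (-(τ * |u| ^ α))) ∘ fun u ↦ -u) (Set.Iic 0) := by
      rw [(Measure.measurePreserving_neg (volume : Measure ℝ)).integrableOn_comp_preimage
        (Homeomorph.neg ℝ).measurableEmbedding (s := Set.Ici 0) |>.symm] at h2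
      simpa using h2
    simpa [Function.comp_def] using h4
  rw [← integrableOn_univ, ← Set.Iic_union_Ioi (a := (0 : ℝ))]
  exact h3.union h2

/-- The symmetry of the weight makes the sine part of the Fourier integral vanish. -/
lemma integral_cexp_mul_exp_neg_eq_stableDensity {α τ : ℝ} (hα : 0 < α) (hτ : 0 < τ) (z : ℝ) :
    ∫ u : ℝ, Complex.exp ((u * z : ℝ) * Complex.I) * (Real.exp (-(τ * |u| ^ α)) : ℂ)
      = ((2 * Real.pi * stableDensity α τ z : ℝ) : ℂ) := by
  have hint : Integrable fun u : ℝ ↦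
      Complex.exp ((u * z : ℝ) * Complex.I) * (Real.exp (-(τ * |u| ^ α)) : ℂ) := by
    refine Integrable.bdd_mul (c := 1) (integrable_exp_neg_mul_abs_rpow hα hτ).ofReal
      (by fun_prop) (Eventually.of_forall fun u ↦ (Complex.norm_exp_ofReal_mul_I _).le)
  have hneg : ∫ u : ℝ, Complex.exp ((u * z : ℝ) * Complex.I) * (Real.exp (-(τ * |u| ^ α)) : ℂ)
      = ∫ u : ℝ, Complex.exp ((-(u * z) : ℝ) * Complex.I) * (Real.exp (-(τ * |u| ^ α)) : ℂ) := by
    rw [← integral_neg_eq_self]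
    refine integral_congr_ae (Eventually.of_forall fun u ↦ ?_)
    simp only [abs_neg, neg_mul]
  have hsum : ∫ u : ℝ, Complex.exp ((u * z : ℝ) * Complex.I) * (Real.exp (-(τ * |u| ^ α)) : ℂ)
      = ∫ u : ℝ, ((Real.cos (u * z) * Real.exp (-(τ * |u| ^ α)) : ℝ) : ℂ) := by
    have hint' : Integrable fun u : ℝ ↦
        Complex.exp ((-(u * z) : ℝ) * Complex.I) * (Real.exp (-(τ * |u| ^ α)) : ℂ) := by
      refine Integrable.bdd_mul (c := 1) (integrable_exp_neg_mul_abs_rpow hα hτ).ofReal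
        (by fun_prop) (Eventually.of_forall fun u ↦ (Complex.norm_exp_ofReal_mul_I _).le)
    have h2 := integral_add hint hint'
    rw [← hneg, ← two_mul] at h2
    have h3 : ∀ u : ℝ, Complex.exp ((u * z : ℝ) * Complex.I) * (Real.exp (-(τ * |u| ^ α)) : ℂ)
        + Complex.exp ((-(u * z) : ℝ) * Complex.I) * (Real.exp (-(τ * |u| ^ α)) : ℂ)
        = 2 * ((Real.cos (u * z) * Real.exp (-(τ * |u| ^ α)) : ℝ) : ℂ) := by
      intro u
      rw [Complex.ofReal_mul (Real.cos _), Complex.ofReal_cos, Complex.cos, Complex.ofReal_neg]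
      ring
    simp_rw [h3] at h2
    rw [integral_const_mul] at h2
    exact (mul_left_cancel₀ two_ne_zero h2).symm
  rw [hsum, integral_complex_ofReal, stableDensity]
  have : (2 * Real.pi) ≠ 0 := by positivity
  rw [mul_inv_cancel_left₀ this]

/-- `𝒯_τ ψ (x) = E ψ(x + L)` if `L` has characteristic function `exp(-τ|u|^α)`. -/
theorem integral_comp_add_eq_stableSemigroup {α τ : ℝ} (hα : 0 < α) (hτ : 0 ≤ τ) {ν : Measure ℝ}
    [IsProbabilityMeasure ν]
    (hν : ∀ u, charFun ν u = Complex.exp (-((τ * |u| ^ α : ℝ) : ℂ))) (ψ : 𝓢(ℝ, ℝ)) (x : ℝ) :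
    ∫ y, ψ (x + y) ∂ν = stableSemigroup α τ ψ x := by
  rcases hτ.eq_or_lt with rfl | hτ
  · have h1 : ν = Measure.dirac 0 := by
      refine Measure.ext_of_charFun (funext fun u ↦ ?_)
      rw [hν u, charFun_dirac]
      simp
    rw [h1, integral_dirac, stableSemigroup]
    simp
  rw [stableSemigroup, if_neg hτ.ne']
  -- expand `ψ` by Fourier inversion, integrate over `ν`, and move the transform to the multiplier
  let f : 𝓢(ℝ, ℂ) := ψ.postcompCLM Complex.ofRealCLM
  have hf : ∀ y, f y = (ψ y : ℂ) := fun y ↦ rfl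
  have hfi : Integrable (f : ℝ → ℂ) := f.integrable
  have hFi : Integrable (𝓕 (f : ℝ → ℂ)) := by
    rw [← SchwartzMap.fourier_coe]
    exact (𝓕 f).integrable
  have hinv : ∀ z, (f z : ℂ) = ∫ v : ℝ, Complex.exp ((2 * Real.pi * v * z : ℝ) * Complex.I)
      * 𝓕 (f : ℝ → ℂ) v := by
    intro z
    rw [← hfi.fourierInv_fourier_eq hFi f.continuous.continuousAt, Real.fourierInv_eq']
    refine integral_congr_ae (Eventually.of_forall fun v ↦ ?_)
    simp only [smul_eq_mul]
    congr 3
    simp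
    ring
  let m : ℝ → ℂ := fun v ↦ Complex.exp ((2 * Real.pi * v * x : ℝ) * Complex.I)
    * (Real.exp (-(τ * |2 * Real.pi * v| ^ α)) : ℂ)
  have hmi : Integrable m := by
    have h1 : Integrable fun v : ℝ ↦ Real.exp (-(τ * |2 * Real.pi * v| ^ α)) :=
      (integrable_exp_neg_mul_abs_rpow hα hτ).comp_mul_left' (R := 2 * Real.pi) (by positivity)
    exact Integrable.bdd_mul (c := 1) h1.ofReal
      (by fun_prop) (Eventually.of_forall fun u ↦ (Complex.norm_exp_ofReal_mul_I _).le)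
  have h1 : ((∫ y, ψ (x + y) ∂ν : ℝ) : ℂ) = ∫ v, 𝓕 (f : ℝ → ℂ) v • m v := by
    rw [← integral_complex_ofReal]
    simp_rw [← hf, hinv]
    rw [integral_integral_swap]
    · refine integral_congr_ae (Eventually.of_forall fun v ↦ ?_)
      have h2 : ∀ y : ℝ, Complex.exp ((2 * Real.pi * v * (x + y) : ℝ) * Complex.I)
          * 𝓕 (f : ℝ → ℂ) v = 𝓕 (f : ℝ → ℂ) v * Complex.exp ((2 * Real.pi * v * x : ℝ) * Complex.I)
          * Complex.exp ((2 * Real.pi * v : ℝ) * y * Complex.I) := by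
        intro y
        rw [mul_assoc (𝓕 (f : ℝ → ℂ) v), ← Complex.exp_add, mul_comm]
        congr 2
        push_cast
        ring
      simp only [h2]
      rw [integral_const_mul, ← charFun_apply_real, hν]
      simp only [m, smul_eq_mul]
      push_cast
      ring
    · have h3 : Integrable (fun p : ℝ × ℝ ↦ 𝓕 (f : ℝ → ℂ) p.2) (ν.prod volume) :=
        hFi.comp_snd ν
      refine Integrable.bdd_mul (c := 1) h3 ?_ ?_
      · exact Continuous.aestronglyMeasurable (by fun_prop)
      · exact Eventually.of_forall fun u ↦ (Complex.norm_exp_ofReal_mul_I _).le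
  have h2 : ∫ v, 𝓕 (f : ℝ → ℂ) v • m v = ∫ y, f y • 𝓕 m y := by
    have h := VectorFourier.integral_fourierIntegral_smul_eq_flip (L := innerₗ ℝ)
      Real.continuous_fourierChar continuous_inner hfi hmi
    rwa [flip_innerₗ] at h
  have h3 : ∀ y, 𝓕 m y = (stableDensity α τ (x - y) : ℂ) := by
    intro y
    rw [Real.fourier_eq']
    have h4 : ∀ v : ℝ, Complex.exp ((-2 * Real.pi * ⟪v, y⟫ : ℝ) * Complex.I) • m v
        = (fun u : ℝ ↦ Complex.exp ((u * (x - y) : ℝ) * Complex.I)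
          * (Real.exp (-(τ * |u| ^ α)) : ℂ)) (2 * Real.pi * v) := by
      intro v
      simp only [m, smul_eq_mul]
      rw [← mul_assoc, ← Complex.exp_add]
      congr 2
      simp
      ring
    simp_rw [h4]
    rw [Measure.integral_comp_mul_left (fun u : ℝ ↦ Complex.exp ((u * (x - y) : ℝ) * Complex.I)
      * (Real.exp (-(τ * |u| ^ α)) : ℂ)), integral_cexp_mul_exp_neg_eq_stableDensity hα hτ,
      abs_of_pos (by positivity), Complex.real_smul, ← Complex.ofReal_mul]
    congr 1
    field_simp
  have h5 : ((∫ y, ψ (x + y) ∂ν : ℝ) : ℂ) = ((∫ y, stableDensity α τ (x - y) * ψ y : ℝ) : ℂ) := by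
    rw [h1, h2, ← integral_complex_ofReal]
    refine integral_congr_ae (Eventually.of_forall fun y ↦ ?_)
    simp only [h3, hf, smul_eq_mul]
    push_cast
    ring
  exact_mod_cast h5

end Stable

/-! ### Laws and independence of the cells -/

section Independence

variable {Ω : Type*} [MeasurableSpace Ω] {P : Measure Ω}

/-- Two independent sequences of independent variables form a sequence of independent pairs. -/
lemma iIndepFun_prodMk {ι : Type*} {𝓧 𝓨 : ι → Type*} [∀ i, MeasurableSpace (𝓧 i)]
    [∀ i, MeasurableSpace (𝓨 i)] {X : ∀ i, Ω → 𝓧 i} {Y : ∀ i, Ω → 𝓨 i}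
    (hX : iIndepFun X P) (hY : iIndepFun Y P) (mX : ∀ i, Measurable (X i))
    (mY : ∀ i, Measurable (Y i)) (hXY : IndepFun (fun ω i ↦ X i ω) (fun ω i ↦ Y i ω) P) :
    iIndepFun (fun i ω ↦ (X i ω, Y i ω)) P := by
  refine iIndepSets.iIndep
    (m := fun i ↦ MeasurableSpace.comap (fun ω ↦ (X i ω, Y i ω)) inferInstance)
    (fun i ↦ ((mX i).prodMk (mY i)).comap_le)
    (fun i ↦ (fun u ↦ (fun ω ↦ (X i ω, Y i ω)) ⁻¹' u) ''
      Set.image2 (· ×ˢ ·) {s | MeasurableSet s} {t | MeasurableSet t}) ?_ ?_ ?_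
  · intro i
    have := (isPiSystem_prod (α := 𝓧 i) (β := 𝓨 i)).comap (fun ω ↦ (X i ω, Y i ω))
    exact this
  · intro i
    rw [← generateFrom_prod, MeasurableSpace.comap_generateFrom]
  · rw [iIndepSets_iff]
    intro S f hf
    have hf' : ∀ i, ∃ s t, i ∈ S → MeasurableSet s ∧ MeasurableSet t ∧
        f i = X i ⁻¹' s ∩ Y i ⁻¹' t := by
      intro i
      by_cases hi : i ∈ S
      · obtain ⟨_, ⟨s, hs, t, ht, rfl⟩, hfi⟩ := hf i hi
        exact ⟨s, t, fun _ ↦ ⟨hs, ht, by rw [← hfi]; rfl⟩⟩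
      · exact ⟨∅, ∅, fun h ↦ absurd h hi⟩
    choose s t hst using hf'
    have e1 : ⋂ i ∈ S, f i = (⋂ i ∈ S, X i ⁻¹' s i) ∩ (⋂ i ∈ S, Y i ⁻¹' t i) := by
      ext ω
      simp only [Set.mem_iInter, Set.mem_inter_iff, ← forall_and]
      exact forall₂_congr fun i hi ↦ by rw [(hst i hi).2.2]; rfl
    have e2 : P ((⋂ i ∈ S, X i ⁻¹' s i) ∩ (⋂ i ∈ S, Y i ⁻¹' t i))
        = P (⋂ i ∈ S, X i ⁻¹' s i) * P (⋂ i ∈ S, Y i ⁻¹' t i) := by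
      have h1 : (⋂ i ∈ S, X i ⁻¹' s i) = (fun ω i ↦ X i ω) ⁻¹' (Set.pi S s) := by
        ext ω; simp
      have h2 : (⋂ i ∈ S, Y i ⁻¹' t i) = (fun ω i ↦ Y i ω) ⁻¹' (Set.pi S t) := by
        ext ω; simp
      rw [h1, h2]
      exact hXY.measure_inter_preimage_eq_mul _ _
        (MeasurableSet.pi S.countable_toSet fun i hi ↦ (hst i hi).1)
        (MeasurableSet.pi S.countable_toSet fun i hi ↦ (hst i hi).2.1)
    rw [e1, e2, hX.measure_inter_preimage_eq_mul S (fun i hi ↦ (hst i hi).1),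
      hY.measure_inter_preimage_eq_mul S (fun i hi ↦ (hst i hi).2.1), ← Finset.prod_mul_distrib]
    refine Finset.prod_congr rfl fun i hi ↦ ?_
    rw [(hst i hi).2.2]
    have hi' : IndepFun (X i) (Y i) P :=
      hXY.comp (measurable_pi_apply i) (measurable_pi_apply i)
    exact (hi'.measure_inter_preimage_eq_mul _ _ (hst i hi).1 (hst i hi).2.1).symm

/-- The joint law of a symmetric stable Lévy process at finitely many ordered times is determined
by its index: the values are sums of independent increments with prescribed laws. -/
lemma IsSymmetricStableLevy.map_monotone_times_eq [IsProbabilityMeasure P] {α : ℝ}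
    {L L' : ℝ≥0 → Ω → ℝ} (h : IsSymmetricStableLevy α L P) (h' : IsSymmetricStableLevy α L' P)
    {n : ℕ} {t : Fin (n + 1) → ℝ≥0} (ht : Monotone t) (ht0 : t 0 = 0) :
    P.map (fun ω i ↦ L (t i) ω) = P.map (fun ω i ↦ L' (t i) ω) := by
  let g : (Fin n → ℝ) → Fin (n + 1) → ℝ := fun v i ↦
    ∑ k ∈ Finset.range i, if hk : k < n then v ⟨k, hk⟩ else 0
  have hg : Measurable g := by
    refine measurable_pi_lambda _ fun p ↦ Finset.measurable_fun_sum _ fun k _ ↦ ?_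
    by_cases hk : k < n
    · simp only [hk, dite_true]; exact measurable_pi_apply _
    · simp only [hk, dite_false]; exact measurable_const
  -- `g` forms the partial sums of the increments; the sum telescopes, as `M 0 = 0`
  have key : ∀ M : ℝ≥0 → Ω → ℝ, IsSymmetricStableLevy α M P →
      P.map (fun ω i ↦ M (t i) ω)
        = P.map (g ∘ fun ω i ↦ M (t i.succ) ω - M (t i.castSucc) ω) := by
    intro M hM
    refine Measure.map_congr ?_
    filter_upwards [hM.start_zero] with ω hω
    ext i
    have htel : ∀ m : ℕ, (hmn : m ≤ n) → ∑ k ∈ Finset.range m, (if hk : k < n then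
        M (t (Fin.succ ⟨k, hk⟩)) ω - M (t (Fin.castSucc ⟨k, hk⟩)) ω else 0)
        = M (t ⟨m, Nat.lt_succ_of_le hmn⟩) ω := by
      intro m
      induction m with
      | zero => intro _; simp [ht0, hω]
      | succ m ih =>
        intro hmn
        rw [Finset.sum_range_succ, ih (by omega), dif_pos (by omega)]
        simp only [Fin.succ_mk, Fin.castSucc_mk]
        ring
    exact (htel i (Nat.le_of_lt_succ i.2)).symm
  have hmi : ∀ (M : ℝ≥0 → Ω → ℝ), IsSymmetricStableLevy α M P → ∀ i : Fin n,
      Measurable fun ω ↦ M (t i.succ) ω - M (t i.castSucc) ω :=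
    fun M hM i ↦ (hM.measurable _).sub (hM.measurable _)
  have hind : iIndepFun (fun (i : Fin n) ω ↦ L (t i.succ) ω - L (t i.castSucc) ω) P :=
    h.indep_increments n t ht
  have hind' : iIndepFun (fun (i : Fin n) ω ↦ L' (t i.succ) ω - L' (t i.castSucc) ω) P :=
    h'.indep_increments n t ht
  have hid : ∀ i : Fin n, IdentDistrib (fun ω ↦ L (t i.succ) ω - L (t i.castSucc) ω)
      (fun ω ↦ L' (t i.succ) ω - L' (t i.castSucc) ω) P P := by
    intro i
    refine ⟨(hmi L h i).aemeasurable, (hmi L' h' i).aemeasurable, ?_⟩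
    have := Measure.isProbabilityMeasure_map (μ := P) (hmi L h i).aemeasurable
    have := Measure.isProbabilityMeasure_map (μ := P) (hmi L' h' i).aemeasurable
    refine Measure.ext_of_charFun (funext fun u ↦ ?_)
    have hle : t i.castSucc ≤ t i.succ := ht (Fin.castSucc_lt_succ).le
    rw [h.charFun_increment _ _ hle, h'.charFun_increment _ _ hle]
  rw [key L h, key L' h']
  exact ((IdentDistrib.pi hid hind hind').comp hg).map_eq

/-- The law of the whole path of a symmetric stable Lévy process is determined by its index. -/
theorem IsSymmetricStableLevy.map_path_eq [IsProbabilityMeasure P] {α : ℝ} {L L' : ℝ≥0 → Ω → ℝ}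
    (h : IsSymmetricStableLevy α L P) (h' : IsSymmetricStableLevy α L' P) :
    P.map (fun ω t ↦ L t ω) = P.map (fun ω t ↦ L' t ω) := by
  classical
  have hm : Measurable (fun ω t ↦ L t ω) := measurable_pi_lambda _ h.measurable
  have hm' : Measurable (fun ω t ↦ L' t ω) := measurable_pi_lambda _ h'.measurable
  refine (map_eq_iff_forall_finset_map_restrict_eq hm.aemeasurable hm'.aemeasurable).2 fun I ↦ ?_
  -- the times of `I`, preceded by time `0`
  obtain ⟨t, ht, ht0, q, hq⟩ : ∃ t : Fin (I.card + 1) → ℝ≥0, Monotone t ∧ t 0 = 0 ∧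
      ∃ q : I → Fin (I.card + 1), ∀ p, t (q p) = p := by
    let e := I.orderIsoOfFin rfl
    refine ⟨Fin.cons 0 fun i ↦ (e i : ℝ≥0), ?_, rfl, fun p ↦ (e.symm p).succ, fun p ↦ ?_⟩
    · intro i j hij
      induction i using Fin.cases with
      | zero => exact zero_le
      | succ i =>
        induction j using Fin.cases with
        | zero => exact absurd hij (by simp)
        | succ j =>
          rw [Fin.cons_succ, Fin.cons_succ]
          exact e.monotone (Fin.succ_le_succ_iff.1 hij)
    · rw [Fin.cons_succ, OrderIso.apply_symm_apply]
  have hr : Measurable fun (v : Fin (I.card + 1) → ℝ) (p : I) ↦ v (q p) :=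
    measurable_pi_lambda _ fun p ↦ measurable_pi_apply _
  have key : ∀ M : ℝ≥0 → Ω → ℝ, (∀ t, Measurable (M t)) → P.map (fun ω ↦ I.restrict (M · ω))
      = (P.map (fun ω i ↦ M (t i) ω)).map fun (v : Fin (I.card + 1) → ℝ) (p : I) ↦ v (q p) := by
    intro M hM
    rw [Measure.map_map hr (measurable_pi_lambda _ fun i ↦ hM _)]
    congr 1
    ext ω p
    simp [hq]
  rw [key L h.measurable, key L' h'.measurable, h.map_monotone_times_eq h' ht ht0]

end Independence

/-- The path space of a real process indexed by `[0, ∞)`. -/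
abbrev Path : Type := ℝ≥0 → ℝ

/-- The values of the data `(θ, (ρ_k)_k)` of one cell. -/
abbrev CellData : Type := ℕ × ((k : ℕ) → Fin k → ℝ)

namespace ParticleSystem

variable {Ω : Type*} [MeasurableSpace Ω] {α : ℝ} {P : Measure Ω} (S : ParticleSystem α P)

/-- The initial data of the `j`-th cell. -/
def cell (j : ℤ) (ω : Ω) : CellData := (S.θ j ω, fun k n ↦ S.ρ j k n ω)

/-- The displacement path of the `n`-th particle of the `j`-th cell. -/
def path (j : ℤ) (n : ℕ) (ω : Ω) : Path := fun t ↦ S.ξ j n t ω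

/-- The common law of all displacement paths. -/
noncomputable def pathLaw : Measure Path := P.map (S.path 0 0)

@[fun_prop]
lemma measurable_cell (j : ℤ) : Measurable (S.cell j) :=
  (S.measurable_θ j).prodMk
    (measurable_pi_lambda _ fun k ↦ measurable_pi_lambda _ fun n ↦ S.measurable_ρ j k n)

@[fun_prop]
lemma measurable_path (j : ℤ) (n : ℕ) : Measurable (S.path j n) :=
  measurable_pi_lambda _ fun t ↦ (S.stable_ξ j n).measurable t

lemma indepFun_cells_paths : IndepFun (fun ω j ↦ S.cell j ω) (fun ω j n ↦ S.path j n ω) P :=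
  S.indep_initial_ξ.comp (φ := id) (ψ := MeasurableEquiv.curry ℤ ℕ Path) measurable_id
    (by fun_prop)

instance [IsProbabilityMeasure P] : IsProbabilityMeasure S.pathLaw :=
  Measure.isProbabilityMeasure_map (S.measurable_path 0 0).aemeasurable

variable [IsProbabilityMeasure P]

lemma map_path (j : ℤ) (n : ℕ) : P.map (S.path j n) = S.pathLaw :=
  (S.stable_ξ j n).map_path_eq (S.stable_ξ 0 0)

lemma map_paths : P.map (fun ω j n ↦ S.path j n ω)
    = Measure.infinitePi fun _ : ℤ ↦ Measure.infinitePi fun _ : ℕ ↦ S.pathLaw := by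
  have h1 := iIndepFun.map_fun_eq_infinitePi_map
    (X := fun (p : ℤ × ℕ) ω (t : ℝ≥0) ↦ S.ξ p.1 p.2 t ω)
    (fun p ↦ S.measurable_path p.1 p.2) S.indep_ξ
  have h2 : ∀ p : ℤ × ℕ, P.map (fun ω t ↦ S.ξ p.1 p.2 t ω) = S.pathLaw :=
    fun p ↦ S.map_path p.1 p.2
  simp_rw [h2] at h1
  have hB : Measurable fun ω (p : ℤ × ℕ) (t : ℝ≥0) ↦ S.ξ p.1 p.2 t ω :=
    measurable_pi_lambda _ fun p ↦ S.measurable_path p.1 p.2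
  rw [← Measure.infinitePi_map_curry (fun (_ : ℤ) (_ : ℕ) ↦ S.pathLaw), ← h1,
    Measure.map_map (by fun_prop) hB]
  rfl

lemma map_cellPaths (j : ℤ) :
    P.map (fun ω n ↦ S.path j n ω) = Measure.infinitePi fun _ : ℕ ↦ S.pathLaw := by
  have h := Measure.infinitePi_map_eval (fun _ : ℤ ↦ Measure.infinitePi fun _ : ℕ ↦ S.pathLaw) j
  rw [← S.map_paths, Measure.map_map (measurable_pi_apply j) (by fun_prop)] at h
  exact h

lemma iIndepFun_cellPaths : iIndepFun (fun j ω n ↦ S.path j n ω) P := by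
  rw [iIndepFun_iff_map_fun_eq_infinitePi_map (fun j ↦ by fun_prop)]
  simp_rw [S.map_cellPaths]
  exact S.map_paths

/-- The cells, together with the displacements of their particles, are independent. -/
lemma iIndepFun_blocks : iIndepFun (fun j ω ↦ (S.cell j ω, fun n ↦ S.path j n ω)) P :=
  iIndepFun_prodMk S.indep_cells S.iIndepFun_cellPaths (fun j ↦ by fun_prop)
    (fun j ↦ by fun_prop) S.indepFun_cells_paths

/-- The law of a cell together with the displacements of its particles. -/
lemma map_block (j : ℤ) : P.map (fun ω ↦ (S.cell j ω, fun n ↦ S.path j n ω))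
    = (P.map (S.cell j)).prod (Measure.infinitePi fun _ : ℕ ↦ S.pathLaw) := by
  have h : IndepFun (S.cell j) (fun ω n ↦ S.path j n ω) P :=
    S.indepFun_cells_paths.comp (measurable_pi_apply j) (measurable_pi_apply j)
  rw [← S.map_cellPaths j]
  exact h.map_prod_eq_prod_map_map (by fun_prop)
    (measurable_pi_lambda _ fun n ↦ S.measurable_path j n).aemeasurable

end ParticleSystem

/-! ### Sums over the particles of a cell -/

section ParticleSum

variable {E : Type*} [AddCommMonoid E]

/-- The sum of `f (position) (displacement path)` over the particles of a cell. -/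
def particleSum (f : ℝ → Path → E) (c : CellData) (w : ℕ → Path) : E :=
  ∑ n : Fin c.1, f (c.2 c.1 n) (w n)

lemma measurable_particleSum [MeasurableSpace E] [MeasurableAdd₂ E] {f : ℝ → Path → E}
    (hf : Measurable (Function.uncurry f)) :
    Measurable fun p : CellData × (ℕ → Path) ↦ particleSum f p.1 p.2 := by
  have h1 : Measurable fun q : ℕ × (CellData × (ℕ → Path)) ↦
      ∑ n : Fin q.1, f (q.2.1.2 q.1 n) (q.2.2 n) := by
    refine measurable_from_prod_countable_right fun k ↦ ?_
    have h2 : ∀ n : Fin k, Measurable fun p : CellData × (ℕ → Path) ↦ f (p.1.2 k n) (p.2 n) := by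
      intro n
      refine hf.comp (Measurable.prodMk (f := fun p : CellData × (ℕ → Path) ↦ p.1.2 k n)
        (g := fun p : CellData × (ℕ → Path) ↦ p.2 n) ?_ ?_)
      · exact (measurable_pi_apply n).comp ((measurable_pi_apply k).comp
          (measurable_snd.comp measurable_fst))
      · exact (measurable_pi_apply (n : ℕ)).comp measurable_snd
    exact Finset.measurable_fun_sum Finset.univ fun n _ ↦ h2 n
  exact h1.comp ((measurable_fst.comp measurable_fst).prodMk measurable_id)

end ParticleSum

section FloorSum

lemma map_floor_mul_volume {T : ℝ} (hT : 0 < T) :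
    (volume : Measure ℝ).map (fun x ↦ ⌊T * x⌋) = ENNReal.ofReal T⁻¹ • Measure.count := by
  have hm : Measurable fun x : ℝ ↦ ⌊T * x⌋ := Int.measurable_floor.comp (measurable_const_mul T)
  refine Measure.ext_of_singleton fun j ↦ ?_
  rw [Measure.map_apply hm (measurableSet_singleton j), Measure.smul_apply, Measure.count_singleton]
  have h1 : (fun x : ℝ ↦ ⌊T * x⌋) ⁻¹' {j} = (T * ·) ⁻¹' Set.Ico (j : ℝ) (j + 1) := by
    rw [← Int.preimage_floor_singleton]; rfl
  rw [h1, Real.volume_preimage_mul_left hT.ne', Real.volume_Ico, abs_of_pos (inv_pos.2 hT)]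
  simp

/-- A sum over cells as an integral over space. -/
lemma tsum_eq_mul_lintegral_floor {T : ℝ} (hT : 0 < T) (a : ℤ → ENNReal) :
    ∑' j, a j = ENNReal.ofReal T * ∫⁻ x : ℝ, a ⌊T * x⌋ := by
  have hm : Measurable fun x : ℝ ↦ ⌊T * x⌋ := Int.measurable_floor.comp (measurable_const_mul T)
  rw [← lintegral_map (f := a) (measurable_of_countable _) hm, map_floor_mul_volume hT,
    lintegral_smul_measure, lintegral_count, smul_eq_mul, ← mul_assoc, ← ENNReal.ofReal_mul hT.le,
    mul_inv_cancel₀ hT.ne']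
  simp

lemma inv_mul_tsum_eq_integral_floor {T : ℝ} (hT : 0 < T) {a : ℤ → ℝ} (ha : Summable a) :
    T⁻¹ * ∑' j, a j = ∫ x : ℝ, a ⌊T * x⌋ := by
  have hm : Measurable fun x : ℝ ↦ ⌊T * x⌋ := Int.measurable_floor.comp (measurable_const_mul T)
  have hc : Integrable a Measure.count := by
    rw [integrable_count_iff]; exact ha.norm
  rw [← integral_map (f := a) hm.aemeasurable (by fun_prop), map_floor_mul_volume hT,
    integral_smul_measure, integral_countable hc, ENNReal.toReal_ofReal (by positivity)]
  simp

lemma abs_sub_le_of_mem_cell {T x y : ℝ} (hT : 0 < T)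
    (hy : y ∈ Set.Ico (⌊T * x⌋ : ℝ) (⌊T * x⌋ + 1)) : |y / T - x| ≤ T⁻¹ := by
  have h1 := Int.floor_le (T * x)
  have h2 := Int.lt_floor_add_one (T * x)
  have h3 : y / T - x = (y - T * x) / T := by field_simp
  rw [h3, abs_div, abs_of_pos hT, div_eq_mul_inv]
  have : |y - T * x| ≤ 1 := abs_le.2 ⟨by linarith [hy.1], by linarith [hy.2]⟩
  have := mul_le_mul_of_nonneg_right this (inv_pos.2 hT).le
  linarith

end FloorSum

section DecaySum

variable {ι : Type*} [Fintype ι]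

/-- The weight `∑ i, (1 + (x + w (τ i))²)⁻¹` of a particle started from `x` with displacement path
`w`, observed at the times `τ i`. -/
noncomputable def decaySum (τ : ι → ℝ≥0) (x : ℝ) (w : Path) : ℝ := ∑ i, decay (x + w (τ i))

lemma decaySum_nonneg (τ : ι → ℝ≥0) (x : ℝ) (w : Path) : 0 ≤ decaySum τ x w :=
  Finset.sum_nonneg fun _ _ ↦ (decay_pos _).le

lemma decaySum_le_card (τ : ι → ℝ≥0) (x : ℝ) (w : Path) : decaySum τ x w ≤ Fintype.card ι := by
  refine (Finset.sum_le_sum fun i _ ↦ decay_le_one _).trans ?_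
  simp

lemma measurable_decaySum (τ : ι → ℝ≥0) : Measurable (Function.uncurry (decaySum τ)) := by
  refine Finset.measurable_fun_sum _ fun i _ ↦ measurable_decay.comp ?_
  exact measurable_fst.add ((measurable_pi_apply _).comp measurable_snd)

lemma decaySum_le_mul_decaySum (τ : ι → ℝ≥0) (w : Path) {x y L : ℝ} (h : |y - x| ≤ L) :
    decaySum τ y w ≤ (2 + 2 * L ^ 2) * decaySum τ x w := by
  rw [decaySum, decaySum, Finset.mul_sum]
  refine Finset.sum_le_sum fun i _ ↦ decay_le_mul_decay ?_
  rwa [add_sub_add_right_eq_sub]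

lemma lintegral_decaySum (τ : ι → ℝ≥0) (μ : Measure Path) [IsProbabilityMeasure μ] :
    ∫⁻ x : ℝ, ∫⁻ w, ENNReal.ofReal (decaySum τ x w) ∂μ
      = Fintype.card ι * ENNReal.ofReal Real.pi := by
  have hm : Measurable (Function.uncurry fun x w ↦ ENNReal.ofReal (decaySum τ x w)) :=
    (measurable_decaySum τ).ennreal_ofReal
  rw [lintegral_lintegral_swap hm.aemeasurable]
  have h1 : ∀ w : Path, ∫⁻ x : ℝ, ENNReal.ofReal (decaySum τ x w)
      = Fintype.card ι * ENNReal.ofReal Real.pi := by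
    intro w
    have h2 : ∀ x, ENNReal.ofReal (decaySum τ x w)
        = ∑ i, ENNReal.ofReal (decay (x + w (τ i))) := fun x ↦
      ENNReal.ofReal_sum_of_nonneg fun _ _ ↦ (decay_pos _).le
    simp_rw [h2]
    rw [lintegral_finsetSum _ fun i _ ↦ by fun_prop]
    have h3 : ∀ i, ∫⁻ x : ℝ, ENNReal.ofReal (decay (x + w (τ i))) = ENNReal.ofReal Real.pi := by
      intro i
      rw [lintegral_add_right_eq_self (fun x ↦ ENNReal.ofReal (decay x)),
        ← ofReal_integral_eq_lintegral_ofReal integrable_decay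
          (Eventually.of_forall fun x ↦ (decay_pos x).le)]
      congr 1
      exact integral_univ_inv_one_add_sq
    simp [h3]
  simp [h1]

lemma integrable_uncurry_decaySum (μ : Measure Path) [IsProbabilityMeasure μ]
    (τ : ι → ℝ≥0) :
    Integrable (Function.uncurry (decaySum τ)) ((volume : Measure ℝ).prod μ) := by
  refine ⟨(measurable_decaySum τ).aestronglyMeasurable, ?_⟩
  rw [hasFiniteIntegral_iff_ofReal (f := Function.uncurry (decaySum τ))
      (Eventually.of_forall fun p ↦ decaySum_nonneg τ _ _),
    lintegral_prod _ (measurable_decaySum τ).ennreal_ofReal.aemeasurable]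
  have := lintegral_decaySum τ μ
  simp only [Function.uncurry_apply_pair]
  rw [this]
  exact ENNReal.mul_lt_top (by simp) (by simp)

end DecaySum

namespace ParticleSystem

variable {Ω : Type*} [MeasurableSpace Ω] {α : ℝ} {P : Measure Ω} (S : ParticleSystem α P)

section Defs

lemma measurable_uncurry_comp_div {E : Type*} [MeasurableSpace E] {f : ℝ → Path → E}
    (hf : Measurable (Function.uncurry f)) (T : ℝ) :
    Measurable (Function.uncurry fun x ↦ f (x / T)) :=
  hf.comp ((measurable_fst.div_const T).prodMk measurable_snd)

variable {E : Type*} [AddCommMonoid E]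

/-- The sum over the particles of the `j`-th cell of the scaled system. -/
noncomputable def cellSum (T : ℝ) (f : ℝ → Path → E) (j : ℤ) (ω : Ω) : E :=
  particleSum (fun x ↦ f (x / T)) (S.cell j ω) fun n ↦ S.path j n ω

lemma cellSum_eq (T : ℝ) (f : ℝ → Path → E) (j : ℤ) (ω : Ω) :
    S.cellSum T f j ω
      = ∑ n : Fin (S.θ j ω), f (S.ρ j (S.θ j ω) n ω / T) (S.path j n ω) := rfl

lemma measurable_cellSum [MeasurableSpace E] [MeasurableAdd₂ E] {f : ℝ → Path → E}
    (hf : Measurable (Function.uncurry f)) (T : ℝ) (j : ℤ) : Measurable (S.cellSum T f j) :=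
  (measurable_particleSum (measurable_uncurry_comp_div hf T)).comp
    ((S.measurable_cell j).prodMk (measurable_pi_lambda _ fun n ↦ S.measurable_path j n))

end Defs

lemma cell_div_mem {T x : ℝ} (hT : 0 < T) (k : ℕ) (n : Fin k) (ω : Ω) :
    |S.ρ ⌊T * x⌋ k n ω / T - x| ≤ T⁻¹ :=
  abs_sub_le_of_mem_cell hT (S.ρ_mem _ k n ω)

section Bounds

variable {ι : Type*} [Fintype ι] (τ : ι → ℝ≥0) (T : ℝ) (j : ℤ)

lemma cellSum_decaySum_nonneg (ω : Ω) : 0 ≤ S.cellSum T (decaySum τ) j ω := by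
  rw [cellSum_eq]
  exact Finset.sum_nonneg fun _ _ ↦ decaySum_nonneg τ _ _

lemma cellSum_decaySum_le (ω : Ω) :
    S.cellSum T (decaySum τ) j ω ≤ Fintype.card ι * S.θ j ω := by
  rw [cellSum_eq]
  refine (Finset.sum_le_sum fun n _ ↦ decaySum_le_card τ _ _).trans ?_
  simp [mul_comm]

/-- The third-order majorant `θ_j² ∑_n decaySum` of all moments up to order three of the cell sums
of functions dominated by `decaySum`. -/
noncomputable def majorant (ω : Ω) : ℝ := (S.θ j ω : ℝ) ^ 2 * S.cellSum T (decaySum τ) j ω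

lemma majorant_nonneg (ω : Ω) : 0 ≤ S.majorant τ T j ω :=
  mul_nonneg (sq_nonneg _) (S.cellSum_decaySum_nonneg τ T j ω)

lemma measurable_majorant : Measurable (S.majorant τ T j) :=
  ((measurable_from_nat.comp (S.measurable_θ j)).pow_const 2).mul
    (S.measurable_cellSum (measurable_decaySum τ) T j)

lemma majorant_le (ω : Ω) : S.majorant τ T j ω ≤ Fintype.card ι * (S.θ j ω : ℝ) ^ 3 := by
  have h := S.cellSum_decaySum_le τ T j ω
  have h2 : (0 : ℝ) ≤ (S.θ j ω : ℝ) ^ 2 := sq_nonneg _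
  rw [majorant]
  nlinarith [mul_le_mul_of_nonneg_left h h2]

lemma cellSum_decaySum_pow_le (p : ℕ) (hp : p ≤ 2) (ω : Ω) :
    S.cellSum T (decaySum τ) j ω ^ (p + 1) ≤ (Fintype.card ι : ℝ) ^ p * S.majorant τ T j ω := by
  set L := S.cellSum T (decaySum τ) j ω with hL
  have h0 : 0 ≤ L := S.cellSum_decaySum_nonneg τ T j ω
  have h1 : L ≤ Fintype.card ι * S.θ j ω := S.cellSum_decaySum_le τ T j ω
  rcases Nat.eq_zero_or_pos (S.θ j ω) with h | h
  · have h2 : L = 0 := le_antisymm (by simpa [h] using h1) h0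
    rw [h2, zero_pow (by omega)]
    exact mul_nonneg (by positivity) (S.majorant_nonneg τ T j ω)
  · have h3 : (1 : ℝ) ≤ S.θ j ω := by exact_mod_cast h
    calc L ^ (p + 1) = L ^ p * L := pow_succ _ _
      _ ≤ (Fintype.card ι * S.θ j ω : ℝ) ^ p * L := by gcongr
      _ = (Fintype.card ι : ℝ) ^ p * ((S.θ j ω : ℝ) ^ p * L) := by rw [mul_pow]; ring
      _ ≤ (Fintype.card ι : ℝ) ^ p * ((S.θ j ω : ℝ) ^ 2 * L) := by gcongr

lemma norm_cellSum_le {E : Type*} [SeminormedAddCommGroup E] {G : ℝ → Path → E} {C : ℝ}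
    (hG : ∀ x w, ‖G x w‖ ≤ C * decaySum τ x w) (ω : Ω) :
    ‖S.cellSum T G j ω‖ ≤ C * S.cellSum T (decaySum τ) j ω := by
  rw [cellSum_eq, cellSum_eq, Finset.mul_sum]
  exact (norm_sum_le _ _).trans (Finset.sum_le_sum fun n _ ↦ hG _ _)

lemma norm_cellSum_pow_le {E : Type*} [SeminormedAddCommGroup E] {G : ℝ → Path → E} {C : ℝ}
    (hG : ∀ x w, ‖G x w‖ ≤ C * decaySum τ x w) (hC : 0 ≤ C) (p : ℕ) (hp : p ≤ 2) (ω : Ω) :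
    ‖S.cellSum T G j ω‖ ^ (p + 1)
      ≤ C ^ (p + 1) * (Fintype.card ι : ℝ) ^ p * S.majorant τ T j ω := by
  calc ‖S.cellSum T G j ω‖ ^ (p + 1) ≤ (C * S.cellSum T (decaySum τ) j ω) ^ (p + 1) := by
        gcongr; exact S.norm_cellSum_le τ T j hG ω
    _ = C ^ (p + 1) * S.cellSum T (decaySum τ) j ω ^ (p + 1) := mul_pow _ _ _
    _ ≤ C ^ (p + 1) * ((Fintype.card ι : ℝ) ^ p * S.majorant τ T j ω) := by
        gcongr; exact S.cellSum_decaySum_pow_le τ T j p hp ω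
    _ = _ := by ring

end Bounds

lemma identDistrib_natCast_θ (j : ℤ) :
    IdentDistrib (fun ω ↦ (S.θ j ω : ℝ)) (fun ω ↦ (S.θ 0 ω : ℝ)) P P :=
  (S.identDistrib_θ j).comp (u := fun n : ℕ ↦ (n : ℝ)) measurable_from_nat

lemma integrable_θ_cube' (j : ℤ) : Integrable (fun ω ↦ (S.θ j ω : ℝ) ^ 3) P :=
  ((S.identDistrib_natCast_θ j).comp (u := fun x : ℝ ↦ x ^ 3) (by fun_prop)).integrable_iff.2
    S.integrable_θ_cube

lemma measurable_natCast_θ (j : ℤ) : Measurable fun ω ↦ (S.θ j ω : ℝ) :=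
  measurable_from_nat.comp (S.measurable_θ j)

lemma natCast_le_cube (n : ℕ) : (n : ℝ) ≤ (n : ℝ) ^ 3 ∧ (n : ℝ) ^ 2 ≤ (n : ℝ) ^ 3 := by
  rcases Nat.eq_zero_or_pos n with rfl | h
  · simp
  · have h3 : (1 : ℝ) ≤ n := by exact_mod_cast h
    exact ⟨le_self_pow₀ h3 (by norm_num), pow_le_pow_right₀ h3 (by norm_num)⟩

lemma integrable_θ_sq (j : ℤ) : Integrable (fun ω ↦ (S.θ j ω : ℝ) ^ 2) P :=
  (S.integrable_θ_cube' j).mono' ((S.measurable_natCast_θ j).pow_const 2).aestronglyMeasurable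
    (Eventually.of_forall fun ω ↦ by
      rw [Real.norm_of_nonneg (sq_nonneg _)]; exact (natCast_le_cube _).2)

lemma integrable_θ (j : ℤ) : Integrable (fun ω ↦ (S.θ j ω : ℝ)) P :=
  (S.integrable_θ_cube' j).mono' (S.measurable_natCast_θ j).aestronglyMeasurable
    (Eventually.of_forall fun ω ↦ by
      rw [Real.norm_of_nonneg (Nat.cast_nonneg _)]; exact (natCast_le_cube _).1)

lemma integral_θ_eq (j : ℤ) : ∫ ω, (S.θ j ω : ℝ) ∂P = ∫ ω, (S.θ 0 ω : ℝ) ∂P :=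
  (S.identDistrib_natCast_θ j).integral_eq

lemma integral_θ_pow_eq (j : ℤ) (p : ℕ) :
    ∫ ω, (S.θ j ω : ℝ) ^ p ∂P = ∫ ω, (S.θ 0 ω : ℝ) ^ p ∂P :=
  ((S.identDistrib_natCast_θ j).comp (u := fun x : ℝ ↦ x ^ p) (by fun_prop)).integral_eq

section Moments

section

variable {ι : Type*} [Fintype ι] (τ : ι → ℝ≥0)

lemma integrable_majorant (T : ℝ) (j : ℤ) : Integrable (S.majorant τ T j) P :=
  ((S.integrable_θ_cube' j).const_mul (Fintype.card ι : ℝ)).mono'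
    (S.measurable_majorant τ T j).aestronglyMeasurable
    (Eventually.of_forall fun ω ↦ by
      rw [Real.norm_of_nonneg (S.majorant_nonneg τ T j ω)]; exact S.majorant_le τ T j ω)

lemma integral_majorant_le (T : ℝ) (j : ℤ) :
    ∫ ω, S.majorant τ T j ω ∂P ≤ Fintype.card ι * ∫ ω, (S.θ 0 ω : ℝ) ^ 3 ∂P := by
  rw [← S.integral_θ_pow_eq j 3, ← integral_const_mul]
  exact integral_mono (S.integrable_majorant τ T j) ((S.integrable_θ_cube' j).const_mul _)
    (S.majorant_le τ T j)

lemma ofReal_integral_majorant (T : ℝ) (j : ℤ) : ENNReal.ofReal (∫ ω, S.majorant τ T j ω ∂P)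
    = ∫⁻ ω, ENNReal.ofReal (S.majorant τ T j ω) ∂P :=
  ofReal_integral_eq_lintegral_ofReal (S.integrable_majorant τ T j)
    (Eventually.of_forall (S.majorant_nonneg τ T j))

lemma integral_majorant_nonneg (T : ℝ) (j : ℤ) : 0 ≤ ∫ ω, S.majorant τ T j ω ∂P :=
  integral_nonneg (S.majorant_nonneg τ T j)

/-- The constant in the bounds, uniform in `T ≥ 1`. -/
noncomputable def majorantConst (ι : Type*) [Fintype ι] : ℝ :=
  4 * (∫ ω, (S.θ 0 ω : ℝ) ^ 3 ∂P) * (Fintype.card ι * Real.pi)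

lemma majorantConst_nonneg (ι : Type*) [Fintype ι] : 0 ≤ S.majorantConst ι := by
  have hm3 : 0 ≤ ∫ ω, (S.θ 0 ω : ℝ) ^ 3 ∂P := integral_nonneg fun _ ↦ by positivity
  unfold majorantConst
  have := Real.pi_pos
  positivity

end

variable [IsProbabilityMeasure P]

lemma lintegral_block (j : ℤ) {Φ : CellData × (ℕ → Path) → ENNReal} (hΦ : Measurable Φ) :
    ∫⁻ ω, Φ (S.cell j ω, fun n ↦ S.path j n ω) ∂P
      = ∫⁻ ω, ∫⁻ w, Φ (S.cell j ω, w) ∂(Measure.infinitePi fun _ : ℕ ↦ S.pathLaw) ∂P := by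
  have hm : Measurable fun ω ↦ (S.cell j ω, fun n ↦ S.path j n ω) :=
    (S.measurable_cell j).prodMk (measurable_pi_lambda _ fun n ↦ S.measurable_path j n)
  rw [← lintegral_map hΦ hm, S.map_block, lintegral_prod _ hΦ.aemeasurable,
    lintegral_map hΦ.lintegral_prod_right' (S.measurable_cell j)]

lemma integral_block (j : ℤ) {Φ : CellData × (ℕ → Path) → ℝ} (hΦ : Measurable Φ)
    (hi : Integrable (fun ω ↦ Φ (S.cell j ω, fun n ↦ S.path j n ω)) P) :
    ∫ ω, Φ (S.cell j ω, fun n ↦ S.path j n ω) ∂P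
      = ∫ ω, ∫ w, Φ (S.cell j ω, w) ∂(Measure.infinitePi fun _ : ℕ ↦ S.pathLaw) ∂P := by
  have hm : Measurable fun ω ↦ (S.cell j ω, fun n ↦ S.path j n ω) :=
    (S.measurable_cell j).prodMk (measurable_pi_lambda _ fun n ↦ S.measurable_path j n)
  have h1 : Integrable Φ (P.map fun ω ↦ (S.cell j ω, fun n ↦ S.path j n ω)) :=
    (integrable_map_measure hΦ.aestronglyMeasurable hm.aemeasurable).2 hi
  rw [← integral_map hm.aemeasurable hΦ.aestronglyMeasurable, S.map_block]
  rw [S.map_block] at h1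
  rw [integral_prod _ h1, integral_map (S.measurable_cell j).aemeasurable]
  exact hΦ.stronglyMeasurable.integral_prod_right'.aestronglyMeasurable

variable {ι : Type*} [Fintype ι] (τ : ι → ℝ≥0)

/-- Spatial bound for the expected majorant of the cell containing `x`. -/
lemma lintegral_majorant_floor_le {T : ℝ} (hT : 0 < T) (x : ℝ) :
    ∫⁻ ω, ENNReal.ofReal (S.majorant τ T ⌊T * x⌋ ω) ∂P
      ≤ ENNReal.ofReal ((2 + 2 * T⁻¹ ^ 2) * ∫ ω, (S.θ 0 ω : ℝ) ^ 3 ∂P)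
        * ∫⁻ w, ENNReal.ofReal (decaySum τ x w) ∂S.pathLaw := by
  set j := ⌊T * x⌋
  set D : ℝ := 2 + 2 * T⁻¹ ^ 2
  have hD : 0 ≤ D := by positivity
  -- replace every initial position by `x`
  let Φ : CellData × (ℕ → Path) → ENNReal := fun p ↦
    ENNReal.ofReal (D * (p.1.1 : ℝ) ^ 2)
      * particleSum (fun _ w ↦ ENNReal.ofReal (decaySum τ x w)) p.1 p.2
  have hmx : Measurable fun w ↦ decaySum τ x w :=
    (measurable_decaySum τ).comp (measurable_const.prodMk measurable_id)
  have hΦ : Measurable Φ := by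
    refine Measurable.mul ?_ (measurable_particleSum ?_)
    · have : Measurable fun p : CellData × (ℕ → Path) ↦ (p.1.1 : ℝ) :=
        measurable_from_nat.comp (measurable_fst.comp measurable_fst)
      fun_prop
    · exact (hmx.comp measurable_snd).ennreal_ofReal
  have h1 : ∀ ω, ENNReal.ofReal (S.majorant τ T j ω)
      ≤ Φ (S.cell j ω, fun n ↦ S.path j n ω) := by
    intro ω
    have h2 : S.majorant τ T j ω ≤ (D * (S.θ j ω : ℝ) ^ 2)
        * ∑ n : Fin (S.θ j ω), decaySum τ x (S.path j n ω) := by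
      rw [majorant, cellSum_eq, mul_comm D, mul_assoc, Finset.mul_sum (a := D)]
      gcongr with n _
      exact decaySum_le_mul_decaySum τ _ (S.cell_div_mem hT _ n ω)
    refine (ENNReal.ofReal_le_ofReal h2).trans ?_
    rw [ENNReal.ofReal_mul (by positivity),
      ENNReal.ofReal_sum_of_nonneg fun _ _ ↦ decaySum_nonneg τ _ _]
    exact le_rfl
  refine (lintegral_mono h1).trans ?_
  rw [S.lintegral_block j hΦ]
  have h3 : ∀ c : CellData, ∫⁻ w, Φ (c, w) ∂(Measure.infinitePi fun _ : ℕ ↦ S.pathLaw)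
      = ENNReal.ofReal (D * (c.1 : ℝ) ^ 3)
        * ∫⁻ w, ENNReal.ofReal (decaySum τ x w) ∂S.pathLaw := by
    intro c
    simp only [Φ, particleSum]
    have hmn : ∀ n : ℕ, Measurable fun w : ℕ → Path ↦ ENNReal.ofReal (decaySum τ x (w n)) :=
      fun n ↦ (hmx.comp (measurable_pi_apply n)).ennreal_ofReal
    rw [lintegral_const_mul _ (Finset.measurable_fun_sum Finset.univ fun (n : Fin c.1) _ ↦ hmn n),
      lintegral_finsetSum Finset.univ fun (n : Fin c.1) _ ↦ hmn n]
    have h4 : ∀ n : ℕ, ∫⁻ w, ENNReal.ofReal (decaySum τ x (w n))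
        ∂(Measure.infinitePi fun _ : ℕ ↦ S.pathLaw)
        = ∫⁻ w, ENNReal.ofReal (decaySum τ x w) ∂S.pathLaw := by
      intro n
      have := Measure.infinitePi_map_eval (fun _ : ℕ ↦ S.pathLaw) n
      rw [← lintegral_map (f := fun w ↦ ENNReal.ofReal (decaySum τ x w)) hmx.ennreal_ofReal
        (measurable_pi_apply n), this]
    simp only [h4]
    rw [Finset.sum_const, Finset.card_univ, Fintype.card_fin, nsmul_eq_mul, ← mul_assoc]
    congr 1
    rw [← ENNReal.ofReal_natCast, ← ENNReal.ofReal_mul (by positivity)]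
    congr 1
    ring
  simp only [h3]
  have hmθ : Measurable fun ω ↦ ENNReal.ofReal (D * ((S.cell j ω).1 : ℝ) ^ 3) :=
    (((S.measurable_natCast_θ j).pow_const 3).const_mul D).ennreal_ofReal
  rw [lintegral_mul_const _ hmθ]
  gcongr
  have h5 : ∫⁻ ω, ENNReal.ofReal (D * (S.θ j ω : ℝ) ^ 3) ∂P
      = ENNReal.ofReal (D * ∫ ω, (S.θ 0 ω : ℝ) ^ 3 ∂P) := by
    rw [← S.integral_θ_pow_eq j 3, ← integral_const_mul, ofReal_integral_eq_lintegral_ofReal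
      ((S.integrable_θ_cube' j).const_mul D)]
    exact Eventually.of_forall fun ω ↦ by positivity
  exact h5.le

lemma lintegral_tsum_majorant_le {T : ℝ} (hT : 0 < T) :
    ∑' j, ∫⁻ ω, ENNReal.ofReal (S.majorant τ T j ω) ∂P
      ≤ ENNReal.ofReal (T * ((2 + 2 * T⁻¹ ^ 2) * (∫ ω, (S.θ 0 ω : ℝ) ^ 3 ∂P)
        * (Fintype.card ι * Real.pi))) := by
  have hm3 : 0 ≤ ∫ ω, (S.θ 0 ω : ℝ) ^ 3 ∂P := integral_nonneg fun _ ↦ by positivity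
  rw [tsum_eq_mul_lintegral_floor hT, ENNReal.ofReal_mul hT.le]
  gcongr
  refine (lintegral_mono fun x ↦ S.lintegral_majorant_floor_le τ hT x).trans ?_
  have hm : Measurable fun x ↦ ∫⁻ w, ENNReal.ofReal (decaySum τ x w) ∂S.pathLaw :=
    (measurable_decaySum τ).ennreal_ofReal.lintegral_prod_right'
  rw [lintegral_const_mul _ hm, lintegral_decaySum,
    ENNReal.ofReal_mul (p := (2 + 2 * T⁻¹ ^ 2) * ∫ ω, (S.θ 0 ω : ℝ) ^ 3 ∂P) (by positivity),
    ENNReal.ofReal_mul (p := (Fintype.card ι : ℝ)) (by positivity), ENNReal.ofReal_natCast]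

lemma summable_integral_majorant {T : ℝ} (hT : 0 < T) :
    Summable fun j ↦ ∫ ω, S.majorant τ T j ω ∂P := by
  have h := S.lintegral_tsum_majorant_le τ hT
  have h1 : ∑' j, ENNReal.ofReal (∫ ω, S.majorant τ T j ω ∂P) ≠ ⊤ := by
    simp_rw [S.ofReal_integral_majorant]
    exact ne_top_of_le_ne_top ENNReal.ofReal_ne_top h
  have := ENNReal.summable_toReal h1
  exact this.congr fun j ↦ ENNReal.toReal_ofReal (S.integral_majorant_nonneg τ T j)

lemma tsum_integral_majorant_le {T : ℝ} (hT : 1 ≤ T) :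
    ∑' j, ∫ ω, S.majorant τ T j ω ∂P ≤ T * S.majorantConst ι := by
  have hT0 : 0 < T := by linarith
  have hm3 : 0 ≤ ∫ ω, (S.θ 0 ω : ℝ) ^ 3 ∂P := integral_nonneg fun _ ↦ by positivity
  have h := S.lintegral_tsum_majorant_le τ hT0
  simp_rw [← S.ofReal_integral_majorant] at h
  rw [← ENNReal.ofReal_tsum_of_nonneg (S.integral_majorant_nonneg τ T)
    (S.summable_integral_majorant τ hT0)] at h
  have hpi := Real.pi_pos
  refine ((ENNReal.ofReal_le_ofReal_iff (by positivity)).1 h).trans ?_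
  unfold majorantConst
  have h1 : T⁻¹ ^ 2 ≤ 1 := pow_le_one₀ (by positivity) (inv_le_one_of_one_le₀ hT)
  gcongr
  linarith

lemma integral_majorant_floor_le {T : ℝ} (hT : 1 ≤ T) (x : ℝ) :
    ∫ ω, S.majorant τ T ⌊T * x⌋ ω ∂P
      ≤ 4 * (∫ ω, (S.θ 0 ω : ℝ) ^ 3 ∂P) * ∫ w, decaySum τ x w ∂S.pathLaw := by
  have hT0 : 0 < T := by linarith
  have hm3 : 0 ≤ ∫ ω, (S.θ 0 ω : ℝ) ^ 3 ∂P := integral_nonneg fun _ ↦ by positivity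
  have hmx : Measurable fun w ↦ decaySum τ x w :=
    (measurable_decaySum τ).comp (measurable_const.prodMk measurable_id)
  have hint : Integrable (fun w ↦ decaySum τ x w) S.pathLaw :=
    Integrable.of_bound hmx.aestronglyMeasurable (Fintype.card ι : ℝ)
      (Eventually.of_forall fun w ↦ by
        rw [Real.norm_of_nonneg (decaySum_nonneg τ x w)]; exact decaySum_le_card τ x w)
  have h0 : 0 ≤ ∫ w, decaySum τ x w ∂S.pathLaw := integral_nonneg fun w ↦ decaySum_nonneg τ x w
  have h := S.lintegral_majorant_floor_le τ hT0 x
  rw [← S.ofReal_integral_majorant, ← ofReal_integral_eq_lintegral_ofReal hint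
    (Eventually.of_forall fun w ↦ decaySum_nonneg τ x w), ← ENNReal.ofReal_mul (by positivity)] at h
  refine ((ENNReal.ofReal_le_ofReal_iff (by positivity)).1 h).trans ?_
  have h1 : T⁻¹ ^ 2 ≤ 1 := pow_le_one₀ (by positivity) (inv_le_one_of_one_le₀ hT)
  gcongr
  linarith

end Moments

end ParticleSystem

/-! ### Moments of the cell sums and their high-density limits -/

lemma ae_summable_norm_of_summable_integral_norm {Ω E ι : Type*} [MeasurableSpace Ω]
    {P : Measure Ω} [NormedAddCommGroup E] [Countable ι] {F : ι → Ω → E}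
    (hF : ∀ i, Integrable (F i) P) (hs : Summable fun i ↦ ∫ ω, ‖F i ω‖ ∂P) :
    ∀ᵐ ω ∂P, Summable fun i ↦ ‖F i ω‖ := by
  have h1 : ∫⁻ ω, ∑' i, ‖F i ω‖ₑ ∂P ≠ ⊤ := by
    rw [lintegral_tsum fun i ↦ (hF i).aestronglyMeasurable.enorm]
    have h2 : ∀ i, ∫⁻ ω, ‖F i ω‖ₑ ∂P = ENNReal.ofReal (∫ ω, ‖F i ω‖ ∂P) := fun i ↦
      (ofReal_integral_norm_eq_lintegral_enorm (hF i)).symm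
    simp_rw [h2]
    rw [← ENNReal.ofReal_tsum_of_nonneg (fun i ↦ integral_nonneg fun _ ↦ norm_nonneg _) hs]
    exact ENNReal.ofReal_ne_top
  have h3 := ae_lt_top' (AEMeasurable.tsum fun i ↦ (hF i).aestronglyMeasurable.enorm) h1
  filter_upwards [h3] with ω hω
  exact (ENNReal.summable_toReal hω.ne).congr fun i ↦ toReal_enorm _

/-- A continuous function of the position of a particle (started from `x`, with displacement path
`w`), dominated by a multiple of `decaySum τ`. -/
structure IsDominated {E ι : Type*} [NormedAddCommGroup E] [MeasurableSpace E] [Fintype ι]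
    (τ : ι → ℝ≥0) (C : ℝ) (G : ℝ → Path → E) : Prop where
  nonneg : 0 ≤ C
  measurable : Measurable (Function.uncurry G)
  norm_le : ∀ x w, ‖G x w‖ ≤ C * decaySum τ x w
  continuous : ∀ w, Continuous fun x ↦ G x w

section Path

variable {E ι : Type*} [NormedAddCommGroup E] [MeasurableSpace E] [Fintype ι]
  {τ : ι → ℝ≥0} {C : ℝ} {G : ℝ → Path → E} (hG : IsDominated τ C G)

lemma IsDominated.norm_le_const (hG : IsDominated τ C G) (x : ℝ) (w : Path) :
    ‖G x w‖ ≤ C * Fintype.card ι :=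
  (hG.norm_le x w).trans (mul_le_mul_of_nonneg_left (decaySum_le_card τ x w) hG.nonneg)

lemma IsDominated.measurable_right (hG : IsDominated τ C G) (x : ℝ) : Measurable (G x) :=
  hG.measurable.comp (measurable_const.prodMk measurable_id)

variable [BorelSpace E] [SecondCountableTopology E]

lemma IsDominated.memLp (hG : IsDominated τ C G) (μ : Measure Path) [IsFiniteMeasure μ]
    (p : ENNReal) (x : ℝ) : MemLp (G x) p μ :=
  MemLp.of_bound (hG.measurable_right x).aestronglyMeasurable _
    (Eventually.of_forall (hG.norm_le_const x))

lemma IsDominated.integrable (hG : IsDominated τ C G) (μ : Measure Path) [IsFiniteMeasure μ]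
    (x : ℝ) : Integrable (G x) μ := memLp_one_iff_integrable.1 (hG.memLp μ 1 x)

variable [NormedSpace ℝ E]

lemma IsDominated.continuous_integral (hG : IsDominated τ C G) (μ : Measure Path)
    [IsFiniteMeasure μ] : Continuous fun x ↦ ∫ w, G x w ∂μ :=
  continuous_of_dominated (fun x ↦ (hG.measurable_right x).aestronglyMeasurable)
    (fun x ↦ Eventually.of_forall (hG.norm_le_const x)) (integrable_const _)
    (Eventually.of_forall hG.continuous)

end Path

section RealPath

variable {ι : Type*} [Fintype ι] {τ : ι → ℝ≥0} {C : ℝ} {G : ℝ → Path → ℝ}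
  (μ : Measure Path) [IsProbabilityMeasure μ]

lemma IsDominated.abs_integral_le (hG : IsDominated τ C G) (x : ℝ) :
    |∫ w, G x w ∂μ| ≤ C * Fintype.card ι := by
  have := norm_integral_le_of_norm_le_const (μ := μ) (Eventually.of_forall (hG.norm_le_const x))
  simpa using this

lemma IsDominated.variance_eq (hG : IsDominated τ C G) (x : ℝ) :
    Var[G x; μ] = ∫ w, G x w ^ 2 ∂μ - (∫ w, G x w ∂μ) ^ 2 :=
  variance_eq_sub (hG.memLp μ 2 x)

lemma IsDominated.variance_le (hG : IsDominated τ C G) (x : ℝ) :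
    Var[G x; μ] ≤ (C * Fintype.card ι) ^ 2 := by
  refine (variance_le_expectation_sq (hG.measurable_right x).aestronglyMeasurable).trans ?_
  have h1 : ∀ w, (G x ^ 2) w ≤ (C * Fintype.card ι) ^ 2 := fun w ↦ by
    rw [Pi.pow_apply, ← sq_abs]
    exact pow_le_pow_left₀ (abs_nonneg _) (hG.norm_le_const x w) 2
  refine (integral_mono_of_nonneg (Eventually.of_forall fun w ↦ sq_nonneg _)
    (integrable_const _) (Eventually.of_forall h1)).trans ?_
  simp

lemma IsDominated.continuous_variance (hG : IsDominated τ C G) :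
    Continuous fun x ↦ Var[G x; μ] := by
  simp_rw [hG.variance_eq μ]
  refine Continuous.sub ?_ ((hG.continuous_integral μ).pow 2)
  refine continuous_of_dominated (bound := fun _ ↦ (C * Fintype.card ι) ^ 2)
    (fun x ↦ ((hG.measurable_right x).pow_const 2).aestronglyMeasurable) (fun x ↦ ?_)
    (integrable_const _) (Eventually.of_forall fun w ↦ (hG.continuous w).pow 2)
  refine Eventually.of_forall fun w ↦ ?_
  rw [norm_pow]
  exact pow_le_pow_left₀ (norm_nonneg _) (hG.norm_le_const x w) 2

lemma integral_infinitePi_eval {g : Path → ℝ} (hg : Measurable g) (n : ℕ) :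
    ∫ w, g (w n) ∂(Measure.infinitePi fun _ : ℕ ↦ μ) = ∫ w, g w ∂μ := by
  have := (measurePreserving_eval_infinitePi (fun _ : ℕ ↦ μ) n).map_eq
  rw [← integral_map (φ := fun w : ℕ → Path ↦ w n) (measurable_pi_apply n).aemeasurable
    hg.aestronglyMeasurable]
  exact congrArg (fun ν ↦ ∫ w, g w ∂ν) this

lemma IsDominated.memLp_eval (hG : IsDominated τ C G) (p : ENNReal) (x : ℝ) (n : ℕ) :
    MemLp (fun w : ℕ → Path ↦ G x (w n)) p (Measure.infinitePi fun _ : ℕ ↦ μ) :=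
  (hG.memLp μ p x).comp_measurePreserving (measurePreserving_eval_infinitePi (fun _ : ℕ ↦ μ) n)

/-- Mean of the cell sum over the displacements, given the initial data of the cell. -/
lemma IsDominated.integral_particleSum (hG : IsDominated τ C G) (T : ℝ) (c : CellData) :
    ∫ w, particleSum (fun x ↦ G (x / T)) c w ∂(Measure.infinitePi fun _ : ℕ ↦ μ)
      = ∑ n : Fin c.1, ∫ w, G (c.2 c.1 n / T) w ∂μ := by
  simp only [particleSum]
  rw [integral_finsetSum Finset.univ fun (n : Fin c.1) _ ↦
    memLp_one_iff_integrable.1 (hG.memLp_eval μ 1 _ n)]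
  exact Finset.sum_congr rfl fun n _ ↦ integral_infinitePi_eval μ (hG.measurable_right _) n

/-- Second moment of the cell sum over the independent displacements, given the initial data of
the cell. -/
lemma IsDominated.integral_particleSum_sq (hG : IsDominated τ C G) (T : ℝ) (c : CellData) :
    ∫ w, particleSum (fun x ↦ G (x / T)) c w ^ 2 ∂(Measure.infinitePi fun _ : ℕ ↦ μ)
      = (∑ n : Fin c.1, ∫ w, G (c.2 c.1 n / T) w ∂μ) ^ 2
        + ∑ n : Fin c.1, Var[G (c.2 c.1 n / T); μ] := by
  let X : Fin c.1 → (ℕ → Path) → ℝ := fun n w ↦ G (c.2 c.1 n / T) (w n)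
  have hX : ∀ n, MemLp (X n) 2 (Measure.infinitePi fun _ : ℕ ↦ μ) := fun n ↦
    hG.memLp_eval μ 2 _ n
  have hS : particleSum (fun x ↦ G (x / T)) c = ∑ n, X n := by
    ext w
    simp [particleSum, X]
  have hind : iIndepFun X (Measure.infinitePi fun _ : ℕ ↦ μ) := by
    have h := iIndepFun_infinitePi (P := fun _ : ℕ ↦ μ)
      (X := fun (i : ℕ) (w : Path) ↦ if h : i < c.1 then G (c.2 c.1 ⟨i, h⟩ / T) w else 0)
      (fun i ↦ by
        by_cases h : i < c.1
        · simp only [h, dite_true]; exact hG.measurable_right _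
        · simp only [h, dite_false]; exact measurable_const)
    have h2 := h.precomp (g := fun n : Fin c.1 ↦ (n : ℕ)) Fin.val_injective
    refine h2.congr fun n ↦ Eventually.of_forall fun w ↦ ?_
    simp [X]
  have hv := IndepFun.variance_sum (X := X) (s := Finset.univ) (fun n _ ↦ hX n)
    fun i _ j _ hij ↦ hind.indepFun hij
  have hv2 := variance_eq_sub (μ := Measure.infinitePi fun _ : ℕ ↦ μ)
    (memLp_finsetSum' Finset.univ fun n _ ↦ hX n)
  have hvn : ∀ n, Var[X n; Measure.infinitePi fun _ : ℕ ↦ μ] = Var[G (c.2 c.1 n / T); μ] := by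
    intro n
    rw [variance_eq_sub (hX n), hG.variance_eq μ]
    congr 1
    · exact integral_infinitePi_eval μ ((hG.measurable_right _).pow_const 2) n
    · exact congrArg (· ^ 2) (integral_infinitePi_eval μ (hG.measurable_right _) n)
  rw [← hG.integral_particleSum μ T c, hS, ← Finset.sum_congr rfl fun n _ ↦ hvn n, ← hv, hv2]
  simp

end RealPath

namespace ParticleSystem

variable {Ω : Type*} [MeasurableSpace Ω] {α : ℝ} {P : Measure Ω} (S : ParticleSystem α P)

section Vector

variable {E ι : Type*} [NormedAddCommGroup E] [MeasurableSpace E] [BorelSpace E]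
  [SecondCountableTopology E] [Fintype ι] {τ : ι → ℝ≥0} {C : ℝ} {G : ℝ → Path → E}

lemma integrable_norm_cellSum_pow (hG : IsDominated τ C G) (T : ℝ) (j : ℤ) (p : ℕ) (hp : p ≤ 2) :
    Integrable (fun ω ↦ ‖S.cellSum T G j ω‖ ^ (p + 1)) P :=
  ((S.integrable_majorant τ T j).const_mul _).mono'
    ((S.measurable_cellSum hG.measurable T j).norm.pow_const _).aestronglyMeasurable
    (Eventually.of_forall fun ω ↦ by
      rw [Real.norm_of_nonneg (by positivity)]
      exact S.norm_cellSum_pow_le τ T j hG.norm_le hG.nonneg p hp ω)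

lemma integral_norm_cellSum_pow_le (hG : IsDominated τ C G) (T : ℝ) (j : ℤ) (p : ℕ)
    (hp : p ≤ 2) : ∫ ω, ‖S.cellSum T G j ω‖ ^ (p + 1) ∂P
      ≤ C ^ (p + 1) * (Fintype.card ι : ℝ) ^ p * ∫ ω, S.majorant τ T j ω ∂P := by
  rw [← integral_const_mul]
  exact integral_mono (S.integrable_norm_cellSum_pow hG T j p hp)
    ((S.integrable_majorant τ T j).const_mul _)
    (S.norm_cellSum_pow_le τ T j hG.norm_le hG.nonneg p hp)

lemma integrable_cellSum (hG : IsDominated τ C G) (T : ℝ) (j : ℤ) :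
    Integrable (S.cellSum T G j) P := by
  have := S.integrable_norm_cellSum_pow hG T j 0 (by norm_num)
  simp only [zero_add, pow_one] at this
  exact (integrable_norm_iff (S.measurable_cellSum hG.measurable T j).aestronglyMeasurable).1 this

lemma memLp_cellSum (hG : IsDominated τ C G) (T : ℝ) (j : ℤ) :
    MemLp (S.cellSum T G j) 2 P := by
  refine (memLp_two_iff_integrable_sq_norm
    (S.measurable_cellSum hG.measurable T j).aestronglyMeasurable).2 ?_
  exact S.integrable_norm_cellSum_pow hG T j 1 (by norm_num)

lemma integral_norm_cellSum_le (hG : IsDominated τ C G) (T : ℝ) (j : ℤ) :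
    ∫ ω, ‖S.cellSum T G j ω‖ ∂P ≤ C * ∫ ω, S.majorant τ T j ω ∂P := by
  simpa using S.integral_norm_cellSum_pow_le hG T j 0 (by norm_num)

variable [IsProbabilityMeasure P]

lemma summable_integral_norm_cellSum (hG : IsDominated τ C G) {T : ℝ} (hT : 0 < T) :
    Summable fun j ↦ ∫ ω, ‖S.cellSum T G j ω‖ ∂P :=
  Summable.of_nonneg_of_le (fun _ ↦ integral_nonneg fun _ ↦ norm_nonneg _)
    (S.integral_norm_cellSum_le hG T) ((S.summable_integral_majorant τ hT).mul_left C)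

lemma ae_summable_norm_cellSum (hG : IsDominated τ C G) {T : ℝ} (hT : 0 < T) :
    ∀ᵐ ω ∂P, Summable fun j ↦ ‖S.cellSum T G j ω‖ :=
  ae_summable_norm_of_summable_integral_norm (S.integrable_cellSum hG T)
    (S.summable_integral_norm_cellSum hG hT)

end Vector

section Limit

lemma eventually_abs_cellSum_sub_le {g : ℝ → ℝ} (hg : Continuous g) (x : ℝ) {ε : ℝ}
    (hε : 0 < ε) : ∀ᶠ T : ℝ in atTop, ∀ ω,
      |S.cellSum T (fun x _ ↦ g x) ⌊T * x⌋ ω - S.θ ⌊T * x⌋ ω * g x| ≤ ε * S.θ ⌊T * x⌋ ω := by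
  obtain ⟨δ, hδ, hgδ⟩ := Metric.continuous_iff.1 hg x ε hε
  filter_upwards [eventually_gt_atTop 0, (tendsto_inv_atTop_zero (𝕜 := ℝ)).eventually_lt_const hδ]
    with T hT hTδ ω
  have h1 : S.cellSum T (fun x _ ↦ g x) ⌊T * x⌋ ω - S.θ ⌊T * x⌋ ω * g x
      = ∑ n : Fin (S.θ ⌊T * x⌋ ω), (g (S.ρ ⌊T * x⌋ _ n ω / T) - g x) := by
    rw [cellSum_eq, Finset.sum_sub_distrib]
    simp
  rw [h1]
  refine (Finset.abs_sum_le_sum_abs _ _).trans ?_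
  refine (Finset.sum_le_sum (g := fun _ ↦ ε) fun n _ ↦ ?_).trans (by simp [mul_comm])
  exact (hgδ _ ((S.cell_div_mem hT _ n ω).trans_lt hTδ)).le

lemma measurable_cellSum_const {g : ℝ → ℝ} (hg : Continuous g) (T : ℝ) (j : ℤ) :
    Measurable (S.cellSum T (fun x _ ↦ g x) j) :=
  S.measurable_cellSum (f := fun x _ ↦ g x) (hg.measurable.comp measurable_fst) T j

lemma abs_cellSum_const_le {g : ℝ → ℝ} {M : ℝ} (hM : ∀ x, |g x| ≤ M) (T : ℝ) (j : ℤ) (ω : Ω) :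
    |S.cellSum T (fun x _ ↦ g x) j ω| ≤ M * S.θ j ω := by
  rw [cellSum_eq]
  refine (Finset.abs_sum_le_sum_abs _ _).trans ?_
  refine (Finset.sum_le_sum (g := fun _ ↦ M) fun n _ ↦ hM _).trans (by simp [mul_comm])

lemma integrable_cellSum_const {g : ℝ → ℝ} (hg : Continuous g) {M : ℝ} (hM : ∀ x, |g x| ≤ M)
    (T : ℝ) (j : ℤ) : Integrable (S.cellSum T (fun x _ ↦ g x) j) P :=
  ((S.integrable_θ j).const_mul M).mono' (S.measurable_cellSum_const hg T j).aestronglyMeasurable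
    (Eventually.of_forall (S.abs_cellSum_const_le hM T j))

lemma integrable_cellSum_const_sq {g : ℝ → ℝ} (hg : Continuous g) {M : ℝ} (hM : ∀ x, |g x| ≤ M)
    (T : ℝ) (j : ℤ) : Integrable (fun ω ↦ S.cellSum T (fun x _ ↦ g x) j ω ^ 2) P := by
  refine ((S.integrable_θ_sq j).const_mul (M ^ 2)).mono'
    ((S.measurable_cellSum_const hg T j).pow_const 2).aestronglyMeasurable
    (Eventually.of_forall fun ω ↦ ?_)
  rw [Real.norm_of_nonneg (sq_nonneg _), ← mul_pow, ← sq_abs]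
  exact pow_le_pow_left₀ (abs_nonneg _) (S.abs_cellSum_const_le hM T j ω) 2

/-- The cell around `x` shrinks to `x`: the first moment. -/
lemma tendsto_integral_cellSum_const {g : ℝ → ℝ} (hg : Continuous g) {M : ℝ}
    (hM : ∀ x, |g x| ≤ M) (x : ℝ) :
    Tendsto (fun T : ℝ ↦ ∫ ω, S.cellSum T (fun x _ ↦ g x) ⌊T * x⌋ ω ∂P) atTop
      (𝓝 ((∫ ω, (S.θ 0 ω : ℝ) ∂P) * g x)) := by
  set m := ∫ ω, (S.θ 0 ω : ℝ) ∂P with hm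
  have hm0 : 0 ≤ m := integral_nonneg fun _ ↦ Nat.cast_nonneg _
  refine Metric.tendsto_nhds.2 fun ε hε ↦ ?_
  have hε' : 0 < ε / (m + 1) := by positivity
  filter_upwards [S.eventually_abs_cellSum_sub_le hg x hε'] with T hT
  have h1 : (∫ ω, S.cellSum T (fun x _ ↦ g x) ⌊T * x⌋ ω ∂P) - m * g x
      = ∫ ω, (S.cellSum T (fun x _ ↦ g x) ⌊T * x⌋ ω - S.θ ⌊T * x⌋ ω * g x) ∂P := by
    rw [integral_sub (S.integrable_cellSum_const hg hM T _) ((S.integrable_θ _).mul_const _),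
      integral_mul_const, S.integral_θ_eq]
  rw [Real.dist_eq, h1]
  calc ‖∫ ω, (S.cellSum T (fun x _ ↦ g x) ⌊T * x⌋ ω - S.θ ⌊T * x⌋ ω * g x) ∂P‖
      ≤ ∫ ω, ε / (m + 1) * S.θ ⌊T * x⌋ ω ∂P :=
        norm_integral_le_of_norm_le ((S.integrable_θ _).const_mul _) (Eventually.of_forall hT)
    _ = ε / (m + 1) * m := by rw [integral_const_mul, S.integral_θ_eq]
    _ < ε := by
        rw [div_mul_eq_mul_div, div_lt_iff₀ (by positivity)]
        nlinarith

/-- The cell around `x` shrinks to `x`: the second moment. -/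
lemma tendsto_integral_cellSum_const_sq {g : ℝ → ℝ} (hg : Continuous g) {M : ℝ}
    (hM : ∀ x, |g x| ≤ M) (x : ℝ) :
    Tendsto (fun T : ℝ ↦ ∫ ω, S.cellSum T (fun x _ ↦ g x) ⌊T * x⌋ ω ^ 2 ∂P) atTop
      (𝓝 ((∫ ω, (S.θ 0 ω : ℝ) ^ 2 ∂P) * g x ^ 2)) := by
  set m := ∫ ω, (S.θ 0 ω : ℝ) ^ 2 ∂P with hm
  have hm0 : 0 ≤ m := integral_nonneg fun _ ↦ by positivity
  have hM0 : 0 ≤ M := (abs_nonneg _).trans (hM 0)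
  refine Metric.tendsto_nhds.2 fun ε hε ↦ ?_
  have hε' : 0 < ε / (2 * M * m + 1) := by positivity
  filter_upwards [S.eventually_abs_cellSum_sub_le hg x hε'] with T hT
  set A := S.cellSum T (fun x _ ↦ g x) ⌊T * x⌋ with hA
  have h1 : (∫ ω, A ω ^ 2 ∂P) - m * g x ^ 2
      = ∫ ω, (A ω ^ 2 - (S.θ ⌊T * x⌋ ω : ℝ) ^ 2 * g x ^ 2) ∂P := by
    rw [integral_sub (S.integrable_cellSum_const_sq hg hM T _)
      ((S.integrable_θ_sq _).mul_const _), integral_mul_const, S.integral_θ_pow_eq]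
  have h2 : ∀ ω, ‖A ω ^ 2 - (S.θ ⌊T * x⌋ ω : ℝ) ^ 2 * g x ^ 2‖
      ≤ ε / (2 * M * m + 1) * (2 * M) * (S.θ ⌊T * x⌋ ω : ℝ) ^ 2 := by
    intro ω
    set N : ℝ := (S.θ ⌊T * x⌋ ω : ℝ)
    have hN : 0 ≤ N := Nat.cast_nonneg _
    have e : A ω ^ 2 - N ^ 2 * g x ^ 2 = (A ω - N * g x) * (A ω + N * g x) := by ring
    rw [e, norm_mul]
    have h3 : |A ω + N * g x| ≤ 2 * M * N := by
      refine (abs_add_le _ _).trans ?_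
      have h4 := S.abs_cellSum_const_le hM T ⌊T * x⌋ ω
      have h5 : |N * g x| ≤ N * M := by
        rw [abs_mul, abs_of_nonneg hN]; exact mul_le_mul_of_nonneg_left (hM x) hN
      change |A ω| ≤ M * N at h4
      linarith
    calc ‖A ω - N * g x‖ * ‖A ω + N * g x‖ ≤ (ε / (2 * M * m + 1) * N) * (2 * M * N) :=
          mul_le_mul (hT ω) h3 (norm_nonneg _) (by positivity)
      _ = _ := by ring
  rw [Real.dist_eq, h1]
  calc |∫ ω, (A ω ^ 2 - (S.θ ⌊T * x⌋ ω : ℝ) ^ 2 * g x ^ 2) ∂P|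
      ≤ ∫ ω, ε / (2 * M * m + 1) * (2 * M) * (S.θ ⌊T * x⌋ ω : ℝ) ^ 2 ∂P :=
        norm_integral_le_of_norm_le ((S.integrable_θ_sq _).const_mul _) (Eventually.of_forall h2)
    _ = ε / (2 * M * m + 1) * (2 * M) * m := by rw [integral_const_mul, S.integral_θ_pow_eq]
    _ < ε := by
        rw [mul_assoc, div_mul_eq_mul_div, div_lt_iff₀ (by positivity)]
        nlinarith

variable {ι : Type*} [Fintype ι] {τ : ι → ℝ≥0} {C : ℝ} {G : ℝ → Path → ℝ}
  [IsProbabilityMeasure P]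

lemma integral_cellSum (hG : IsDominated τ C G) (T : ℝ) (j : ℤ) :
    ∫ ω, S.cellSum T G j ω ∂P
      = ∫ ω, S.cellSum T (fun x _ ↦ ∫ w, G x w ∂S.pathLaw) j ω ∂P := by
  have h := S.integral_block j
    (measurable_particleSum (measurable_uncurry_comp_div hG.measurable T))
    (S.integrable_cellSum hG T j)
  refine h.trans ?_
  simp_rw [hG.integral_particleSum S.pathLaw T]
  rfl

lemma integral_cellSum_sq (hG : IsDominated τ C G) (T : ℝ) (j : ℤ) :
    ∫ ω, S.cellSum T G j ω ^ 2 ∂P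
      = ∫ ω, (S.cellSum T (fun x _ ↦ ∫ w, G x w ∂S.pathLaw) j ω ^ 2
        + S.cellSum T (fun x _ ↦ Var[G x; S.pathLaw]) j ω) ∂P := by
  have h := S.integral_block j
    ((measurable_particleSum (measurable_uncurry_comp_div hG.measurable T)).pow_const 2)
    (S.memLp_cellSum hG T j).integrable_sq
  refine h.trans ?_
  simp_rw [hG.integral_particleSum_sq S.pathLaw T]
  rfl

/-- The limiting variance density at `x` of the sums of `G` over the particles: each particle
contributes its displacement variance, and the number of particles its own variance. -/
noncomputable def limitVariance (G : ℝ → Path → ℝ) (x : ℝ) : ℝ :=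
  (∫ ω, (S.θ 0 ω : ℝ) ∂P) * Var[G x; S.pathLaw]
    + Var[fun ω ↦ (S.θ 0 ω : ℝ); P] * (∫ w, G x w ∂S.pathLaw) ^ 2

lemma variance_θ : Var[fun ω ↦ (S.θ 0 ω : ℝ); P]
    = ∫ ω, (S.θ 0 ω : ℝ) ^ 2 ∂P - (∫ ω, (S.θ 0 ω : ℝ) ∂P) ^ 2 :=
  variance_eq_sub ((memLp_two_iff_integrable_sq
    (S.measurable_natCast_θ 0).aestronglyMeasurable).2 (S.integrable_θ_sq 0))

lemma tendsto_variance_cellSum (hG : IsDominated τ C G) (x : ℝ) :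
    Tendsto (fun T : ℝ ↦ Var[S.cellSum T G ⌊T * x⌋; P]) atTop (𝓝 (S.limitVariance G x)) := by
  have hg := hG.continuous_integral S.pathLaw
  have hgM := hG.abs_integral_le S.pathLaw
  have hv := hG.continuous_variance S.pathLaw
  have hvM : ∀ x, |Var[G x; S.pathLaw]| ≤ (C * Fintype.card ι) ^ 2 := fun x ↦ by
    rw [abs_of_nonneg (variance_nonneg _ _)]; exact hG.variance_le S.pathLaw x
  have h1 : ∀ T : ℝ, Var[S.cellSum T G ⌊T * x⌋; P]
      = ∫ ω, S.cellSum T (fun x _ ↦ ∫ w, G x w ∂S.pathLaw) ⌊T * x⌋ ω ^ 2 ∂P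
        + ∫ ω, S.cellSum T (fun x _ ↦ Var[G x; S.pathLaw]) ⌊T * x⌋ ω ∂P
        - (∫ ω, S.cellSum T (fun x _ ↦ ∫ w, G x w ∂S.pathLaw) ⌊T * x⌋ ω ∂P) ^ 2 := by
    intro T
    rw [variance_eq_sub (S.memLp_cellSum hG T _), ← S.integral_cellSum hG, ← integral_add
      (S.integrable_cellSum_const_sq hg hgM T _) (S.integrable_cellSum_const hv hvM T _),
      ← S.integral_cellSum_sq hG]
    rfl
  simp_rw [h1]
  have h2 := ((S.tendsto_integral_cellSum_const_sq hg hgM x).add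
    (S.tendsto_integral_cellSum_const hv hvM x)).sub
    ((S.tendsto_integral_cellSum_const hg hgM x).pow 2)
  convert h2 using 2
  rw [limitVariance, S.variance_θ]
  ring

lemma variance_cellSum_le (hG : IsDominated τ C G) (T : ℝ) (j : ℤ) :
    Var[S.cellSum T G j; P] ≤ C ^ 2 * Fintype.card ι * ∫ ω, S.majorant τ T j ω ∂P := by
  refine (variance_le_expectation_sq
    (S.measurable_cellSum hG.measurable T j).aestronglyMeasurable).trans ?_
  have := S.integral_norm_cellSum_pow_le hG T j 1 (by norm_num)
  simpa using this

lemma summable_variance_cellSum (hG : IsDominated τ C G) {T : ℝ} (hT : 0 < T) :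
    Summable fun j ↦ Var[S.cellSum T G j; P] :=
  Summable.of_nonneg_of_le (fun _ ↦ variance_nonneg _ _) (S.variance_cellSum_le hG T)
    ((S.summable_integral_majorant τ hT).mul_left _)

/-- Riemann sum argument: the normalized sum of the variances of the cells converges. -/
lemma tendsto_tsum_variance_cellSum (hG : IsDominated τ C G) :
    Tendsto (fun T : ℝ ↦ T⁻¹ * ∑' j, Var[S.cellSum T G j; P]) atTop
      (𝓝 (∫ x, S.limitVariance G x)) := by
  have h1 : Tendsto (fun T : ℝ ↦ ∫ x : ℝ, Var[S.cellSum T G ⌊T * x⌋; P]) atTop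
      (𝓝 (∫ x, S.limitVariance G x)) := by
    refine tendsto_integral_filter_of_dominated_convergence
      (fun x ↦ C ^ 2 * Fintype.card ι * (4 * (∫ ω, (S.θ 0 ω : ℝ) ^ 3 ∂P)
        * ∫ w, decaySum τ x w ∂S.pathLaw)) ?_ ?_ ?_ ?_
    · refine Eventually.of_forall fun T ↦ Measurable.aestronglyMeasurable ?_
      exact (measurable_of_countable fun j : ℤ ↦ Var[S.cellSum T G j; P]).comp
        (Int.measurable_floor.comp (measurable_const_mul T))
    · filter_upwards [eventually_ge_atTop 1] with T hT
      refine Eventually.of_forall fun x ↦ ?_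
      rw [Real.norm_of_nonneg (variance_nonneg _ _)]
      refine (S.variance_cellSum_le hG T _).trans ?_
      gcongr
      exact S.integral_majorant_floor_le τ hT x
    · exact ((integrable_uncurry_decaySum S.pathLaw τ).integral_prod_left.const_mul _).const_mul _
    · exact Eventually.of_forall fun x ↦ S.tendsto_variance_cellSum hG x
  refine h1.congr' ?_
  filter_upwards [eventually_gt_atTop 0] with T hT
  exact (inv_mul_tsum_eq_integral_floor hT (S.summable_variance_cellSum hG hT)).symm

/-- The normalized and centered sum of `G` over all particles. -/
noncomputable def centeredSum {E : Type*} [NormedAddCommGroup E] [NormedSpace ℝ E] (T : ℝ)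
    (G : ℝ → Path → E) (ω : Ω) : E :=
  (√T)⁻¹ • (∑' j, S.cellSum T G j ω - ∑' j, ∫ ω', S.cellSum T G j ω' ∂P)

/-- The central limit theorem for the sums of `G` over all particles, in terms of characteristic
functions. -/
theorem tendsto_integral_cexp_centeredSum (hG : IsDominated τ C G) :
    Tendsto (fun T : ℝ ↦ ∫ ω, Complex.exp (S.centeredSum T G ω * Complex.I) ∂P) atTop
      (𝓝 (Complex.exp (-((∫ x, S.limitVariance G x) / 2 : ℝ)))) := by
  have hlim : Tendsto (fun T : ℝ ↦
      Complex.exp (-((T⁻¹ * ∑' j, Var[S.cellSum T G j; P]) / 2 : ℝ))) atTop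
      (𝓝 (Complex.exp (-((∫ x, S.limitVariance G x) / 2 : ℝ)))) := by
    have hc : Continuous fun y : ℝ ↦ Complex.exp (-(y / 2 : ℝ)) := by fun_prop
    exact (hc.tendsto _).comp (S.tendsto_tsum_variance_cellSum hG)
  set m3 := ∫ ω, (S.θ 0 ω : ℝ) ^ 3 ∂P with hm3d
  have hm3 : 0 ≤ m3 := integral_nonneg fun _ ↦ by positivity
  set c : ℝ := (Fintype.card ι : ℝ) with hcd
  have hc0 : 0 ≤ c := Nat.cast_nonneg _
  have hC := hG.nonneg
  set K3 : ℝ := 4 * (C ^ 3 * c ^ 2 + (C * (c * m3)) ^ 2 * C) with hK3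
  have hK30 : 0 ≤ K3 := by positivity
  set D := S.majorantConst ι with hD
  have hD0 : 0 ≤ D := S.majorantConst_nonneg ι
  -- the Lyapunov bound for the normalized cell sums `U j`, whose error is `O(T ^ (-1 / 2))`
  have key : ∀ T : ℝ, 1 ≤ T → ‖∫ ω, Complex.exp (S.centeredSum T G ω * Complex.I) ∂P
      - Complex.exp (-((T⁻¹ * ∑' j, Var[S.cellSum T G j; P]) / 2 : ℝ))‖
      ≤ 4 * K3 * D * (√T)⁻¹ + (C ^ 2 * c * (c * m3)) * (C ^ 2 * c * D) * T⁻¹ := by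
    intro T hT
    have hT0 : 0 < T := by linarith
    have hsT : 0 < √T := Real.sqrt_pos.2 hT0
    have hsq : (√T)⁻¹ ^ 2 = T⁻¹ := by rw [inv_pow, Real.sq_sqrt hT0.le]
    have hMs := S.summable_integral_majorant τ hT0
    have hMle := S.tsum_integral_majorant_le τ hT
    have hMc := S.integral_majorant_le τ T
    let Y : ℤ → Ω → ℝ := S.cellSum T G
    let U : ℤ → Ω → ℝ := fun j ω ↦ (√T)⁻¹ * (Y j ω - ∫ ω', Y j ω' ∂P)
    have hYi : ∀ j, Integrable (Y j) P := S.integrable_cellSum hG T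
    have hYm : ∀ j, Measurable (Y j) := S.measurable_cellSum hG.measurable T
    have hU : ∀ j, Measurable (U j) := fun j ↦ ((hYm j).sub_const _).const_mul _
    have hind : iIndepFun U P := S.iIndepFun_blocks.comp
      (fun j p ↦ (√T)⁻¹ * (particleSum (fun x ↦ G (x / T)) p.1 p.2 - ∫ ω', Y j ω' ∂P))
      fun j ↦ ((measurable_particleSum
        (measurable_uncurry_comp_div hG.measurable T)).sub_const _).const_mul _
    have h0 : ∀ j, ∫ ω, U j ω ∂P = 0 := by
      intro j
      simp only [U]
      rw [integral_const_mul, integral_sub (hYi j) (integrable_const _)]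
      simp
    have hU2 : ∀ j, ∫ ω, U j ω ^ 2 ∂P = T⁻¹ * Var[Y j; P] := by
      intro j
      rw [variance_eq_integral (hYm j).aemeasurable, ← integral_const_mul]
      exact integral_congr_ae (Eventually.of_forall fun ω ↦ by simp only [U, mul_pow, hsq])
    have hEY : ∀ j, |∫ ω, Y j ω ∂P| ≤ C * ∫ ω, S.majorant τ T j ω ∂P := fun j ↦
      (norm_integral_le_integral_norm _).trans (S.integral_norm_cellSum_le hG T j)
    have hYi3 : ∀ j, Integrable (fun ω ↦ |Y j ω| ^ 3) P := fun j ↦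
      S.integrable_norm_cellSum_pow hG T j 2 le_rfl
    have hle3 : ∀ j ω, |U j ω| ^ 3
        ≤ (√T)⁻¹ ^ 3 * (4 * (|Y j ω| ^ 3 + |∫ ω', Y j ω' ∂P| ^ 3)) := by
      intro j ω
      simp only [U]
      rw [abs_mul, abs_of_pos (inv_pos.2 hsT), mul_pow]
      gcongr
      refine (pow_le_pow_left₀ (abs_nonneg _) (abs_sub _ _) 3).trans ?_
      exact (add_pow_le (abs_nonneg _) (abs_nonneg _) 3).trans (by norm_num)
    have hi3' : ∀ j, Integrable (fun ω ↦
        (√T)⁻¹ ^ 3 * (4 * (|Y j ω| ^ 3 + |∫ ω', Y j ω' ∂P| ^ 3))) P := fun j ↦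
      (((hYi3 j).add (integrable_const _)).const_mul 4).const_mul _
    have h3 : ∀ j, Integrable (fun ω ↦ |U j ω| ^ 3) P := fun j ↦
      (hi3' j).mono' ((hU j).abs.pow_const 3).aestronglyMeasurable
        (Eventually.of_forall fun ω ↦ by
          rw [Real.norm_of_nonneg (by positivity)]; exact hle3 j ω)
    -- the cube of the mean costs one factor `majorant`; the others are bounded by `C c m3`
    have hU3 : ∀ j, ∫ ω, |U j ω| ^ 3 ∂P ≤ (√T)⁻¹ ^ 3 * K3 * ∫ ω, S.majorant τ T j ω ∂P := by
      intro j
      refine (integral_mono (h3 j) (hi3' j) (hle3 j)).trans ?_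
      rw [integral_const_mul, integral_const_mul, integral_add (hYi3 j) (integrable_const _)]
      simp only [integral_const, probReal_univ, one_smul]
      have hm0 := S.integral_majorant_nonneg τ T j
      have ha : ∫ ω, |Y j ω| ^ 3 ∂P ≤ C ^ 3 * c ^ 2 * ∫ ω, S.majorant τ T j ω ∂P :=
        S.integral_norm_cellSum_pow_le hG T j 2 le_rfl
      have hb : |∫ ω, Y j ω ∂P| ^ 3 ≤ (C * (c * m3)) ^ 2 * C * ∫ ω, S.majorant τ T j ω ∂P := by
        have e : (C * (c * m3)) ^ 2 * C * ∫ ω, S.majorant τ T j ω ∂P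
          = (C * (c * m3)) ^ 2 * (C * ∫ ω, S.majorant τ T j ω ∂P) := by ring
        rw [pow_succ, e]
        gcongr
        · exact (hEY j).trans (mul_le_mul_of_nonneg_left (hMc j) hC)
        · exact hEY j
      rw [mul_assoc]
      refine mul_le_mul_of_nonneg_left ?_ (by positivity)
      rw [hK3]
      linarith
    have hs3 : Summable fun j ↦ ∫ ω, |U j ω| ^ 3 ∂P :=
      Summable.of_nonneg_of_le (fun j ↦ integral_nonneg fun _ ↦ by positivity) hU3
        (hMs.mul_left _)
    have hvs := S.summable_variance_cellSum hG hT0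
    have hs2 : Summable fun j ↦ ∫ ω, U j ω ^ 2 ∂P := by
      simp_rw [hU2]; exact hvs.mul_left _
    have hδ : ∀ j, ∫ ω, U j ω ^ 2 ∂P ≤ T⁻¹ * (C ^ 2 * c * (c * m3)) := by
      intro j
      rw [hU2]
      gcongr
      exact (S.variance_cellSum_le hG T j).trans (by gcongr; exact hMc j)
    have hS : ∀ᵐ ω ∂P, HasSum (fun j ↦ U j ω) (S.centeredSum T G ω) := by
      filter_upwards [S.ae_summable_norm_cellSum hG hT0] with ω hω
      have hE : Summable fun j ↦ ∫ ω', Y j ω' ∂P :=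
        Summable.of_norm_bounded (hMs.mul_left C) hEY
      exact (hω.of_norm.hasSum.sub hE.hasSum).mul_left _
    have hmain := norm_integral_cexp_hasSum_sub_gaussian_le hU hind h0 h3 hs3 hs2 hδ hS
    have hsum2 : ∑' j, ∫ ω, U j ω ^ 2 ∂P = T⁻¹ * ∑' j, Var[S.cellSum T G j; P] := by
      simp_rw [hU2]; exact tsum_mul_left
    rw [hsum2] at hmain
    refine hmain.trans ?_
    have hb3 : ∑' j, ∫ ω, |U j ω| ^ 3 ∂P ≤ K3 * D * (√T)⁻¹ := by
      refine (hs3.tsum_le_tsum hU3 (hMs.mul_left _)).trans ?_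
      rw [tsum_mul_left]
      calc (√T)⁻¹ ^ 3 * K3 * ∑' j, ∫ ω, S.majorant τ T j ω ∂P
          ≤ (√T)⁻¹ ^ 3 * K3 * (T * D) := by gcongr
        _ = K3 * D * (√T)⁻¹ * ((√T)⁻¹ ^ 2 * T) := by ring
        _ = K3 * D * (√T)⁻¹ := by rw [hsq, inv_mul_cancel₀ hT0.ne', mul_one]
    have hb2 : T⁻¹ * ∑' j, Var[S.cellSum T G j; P] ≤ C ^ 2 * c * D := by
      have := hvs.tsum_le_tsum (S.variance_cellSum_le hG T) (hMs.mul_left _)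
      rw [tsum_mul_left] at this
      calc T⁻¹ * ∑' j, Var[S.cellSum T G j; P]
          ≤ T⁻¹ * (C ^ 2 * c * (T * D)) := by
            gcongr
            exact this.trans (by gcongr)
        _ = C ^ 2 * c * D * (T⁻¹ * T) := by ring
        _ = _ := by rw [inv_mul_cancel₀ hT0.ne', mul_one]
    calc 4 * ∑' j, ∫ ω, |U j ω| ^ 3 ∂P
          + T⁻¹ * (C ^ 2 * c * (c * m3)) * (T⁻¹ * ∑' j, Var[S.cellSum T G j; P])
        ≤ 4 * (K3 * D * (√T)⁻¹) + T⁻¹ * (C ^ 2 * c * (c * m3)) * (C ^ 2 * c * D) := by gcongr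
      _ = _ := by ring
  have herr : Tendsto (fun T : ℝ ↦
      4 * K3 * D * (√T)⁻¹ + (C ^ 2 * c * (c * m3)) * (C ^ 2 * c * D) * T⁻¹) atTop (𝓝 0) := by
    have h1 : Tendsto (fun T : ℝ ↦ (√T)⁻¹) atTop (𝓝 0) :=
      tendsto_inv_atTop_zero.comp Real.tendsto_sqrt_atTop
    simpa using (h1.const_mul (4 * K3 * D)).add
      (tendsto_inv_atTop_zero.const_mul ((C ^ 2 * c * (c * m3)) * (C ^ 2 * c * D)))
  have hdiff := squeeze_zero_norm' ((eventually_ge_atTop 1).mono key) herr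
  simpa using hdiff.add hlim

end Limit

end ParticleSystem

/-! ### Weak convergence and Gaussian variables in a Hilbert space -/

section HilbertSquares

variable {H κ : Type*} [NormedAddCommGroup H] [InnerProductSpace ℝ H] (b : HilbertBasis κ ℝ H)

lemma enorm_sq_eq_ofReal_norm_sq {E : Type*} [SeminormedAddCommGroup E] (z : E) :
    ‖z‖ₑ ^ 2 = ENNReal.ofReal (‖z‖ ^ 2) := by
  rw [ENNReal.ofReal_pow (norm_nonneg _), ofReal_norm]

lemma enorm_sub_basisProj_sq (s : Finset κ) (z : H) :
    ‖z - basisProj b s z‖ₑ ^ 2 = ∑' i : {i // i ∉ s}, ENNReal.ofReal (⟪b i, z⟫ ^ 2) := by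
  have hs := (hasSum_inner_sq b z).summable
  rw [enorm_sq_eq_ofReal_norm_sq, norm_sub_basisProj_sq, ← (hasSum_inner_sq b z).tsum_eq,
    ← hs.sum_add_tsum_subtype_compl s, add_sub_cancel_left,
    ENNReal.ofReal_tsum_of_nonneg (fun _ ↦ sq_nonneg _) (hs.subtype _)]

lemma continuous_basisProj (s : Finset κ) : Continuous (basisProj b s) := by
  unfold basisProj; fun_prop

end HilbertSquares

section WeakConvergence

variable {H κ ι : Type*} [NormedAddCommGroup H] [InnerProductSpace ℝ H] [Fintype ι]
  [MeasurableSpace H] [BorelSpace H] [SecondCountableTopology H]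

lemma lintegral_enorm_le_of_sq {Ω E : Type*} [MeasurableSpace Ω] [NormedAddCommGroup E]
    {P : Measure Ω} [IsProbabilityMeasure P] {f : Ω → E} (hf : AEStronglyMeasurable f P) {ε : ℝ}
    (hε : 0 ≤ ε) (h : ∫⁻ ω, ‖f ω‖ₑ ^ 2 ∂P ≤ ENNReal.ofReal (ε ^ 2)) :
    ∫⁻ ω, ‖f ω‖ₑ ∂P ≤ ENNReal.ofReal ε := by
  have h1 : eLpNorm f 1 P ≤ eLpNorm f 2 P :=
    eLpNorm_le_eLpNorm_of_exponent_le (by norm_num) hf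
  rw [eLpNorm_one_eq_lintegral_enorm] at h1
  refine h1.trans ?_
  rw [eLpNorm_eq_lintegral_rpow_enorm_toReal (by norm_num) (by norm_num)]
  simp only [ENNReal.toReal_ofNat, ENNReal.rpow_ofNat]
  refine (ENNReal.rpow_le_rpow h (by norm_num)).trans ?_
  rw [ENNReal.ofReal_rpow_of_nonneg (by positivity) (by norm_num), ← Real.sqrt_eq_rpow,
    Real.sqrt_sq hε]

/-- Replacing every component by its projection to finitely many basis vectors changes the integral
of a Lipschitz function only a little, if the tails are small. -/
lemma abs_integral_sub_basisProj_le (b : HilbertBasis κ ℝ H) {μ : Measure (ι → H)}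
    [IsProbabilityMeasure μ] {F : (ι → H) → ℝ} {L : ℝ≥0} (hF : LipschitzWith L F) {M : ℝ}
    (hM : ∀ x y, dist (F x) (F y) ≤ M) {s : Finset κ} {ε : ℝ} (hε : 0 ≤ ε)
    (hs : ∀ a, ∫⁻ z, ‖z a - basisProj b s (z a)‖ₑ ^ 2 ∂μ ≤ ENNReal.ofReal (ε ^ 2)) :
    |∫ z, F z ∂μ - ∫ z, F (fun a ↦ basisProj b s (z a)) ∂μ| ≤ L * (Fintype.card ι * ε) := by
  have hQ : Continuous fun z : ι → H ↦ fun a ↦ basisProj b s (z a) :=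
    continuous_pi fun a ↦ (continuous_basisProj b s).comp (continuous_apply a)
  have hbd : ∀ z, ‖F z‖ ≤ ‖F 0‖ + M := fun z ↦ by
    have h1 := hM z 0
    rw [Real.dist_eq] at h1
    have h2 := abs_sub_abs_le_abs_sub (F z) (F 0)
    rw [Real.norm_eq_abs, Real.norm_eq_abs]
    linarith
  have hi1 : Integrable F μ :=
    Integrable.of_bound hF.continuous.measurable.aestronglyMeasurable _ (Eventually.of_forall hbd)
  have hi2 : Integrable (fun z ↦ F (fun a ↦ basisProj b s (z a))) μ :=
    Integrable.of_bound (hF.continuous.comp hQ).measurable.aestronglyMeasurable _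
      (Eventually.of_forall fun z ↦ hbd _)
  rw [← integral_sub hi1 hi2, ← Real.norm_eq_abs]
  have h0 : (0 : ℝ) ≤ L * (Fintype.card ι * ε) := by positivity
  rw [← toReal_enorm]
  refine ENNReal.toReal_le_of_le_ofReal h0 ?_
  refine (enorm_integral_le_lintegral_enorm _).trans ?_
  have hcomp : ∀ a, Measurable fun z : ι → H ↦ z a - basisProj b s (z a) := fun a ↦
    ((continuous_apply a).sub ((continuous_basisProj b s).comp (continuous_apply a))).measurable
  have hle : ∀ z : ι → H, ‖F z - F (fun a ↦ basisProj b s (z a))‖ₑ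
      ≤ L * ∑ a, ‖z a - basisProj b s (z a)‖ₑ := by
    intro z
    rw [← edist_eq_enorm_sub]
    refine (hF z _).trans ?_
    gcongr
    rw [edist_pi_def]
    refine Finset.sup_le fun a ha ↦ ?_
    rw [edist_eq_enorm_sub]
    exact Finset.single_le_sum (f := fun a ↦ ‖z a - basisProj b s (z a)‖ₑ)
      (fun _ _ ↦ zero_le) ha
  calc ∫⁻ z, ‖F z - F (fun a ↦ basisProj b s (z a))‖ₑ ∂μ
      ≤ ∫⁻ z, L * ∑ a, ‖z a - basisProj b s (z a)‖ₑ ∂μ := lintegral_mono hle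
    _ = L * ∑ a, ∫⁻ z, ‖z a - basisProj b s (z a)‖ₑ ∂μ := by
        rw [lintegral_const_mul _ (Finset.measurable_fun_sum _ fun a _ ↦ (hcomp a).enorm),
          lintegral_finsetSum _ fun a _ ↦ (hcomp a).enorm]
    _ ≤ L * ∑ a : ι, ENNReal.ofReal ε := by
        gcongr with a
        exact lintegral_enorm_le_of_sq (hcomp a).aestronglyMeasurable hε (hs a)
    _ = ENNReal.ofReal (L * (Fintype.card ι * ε)) := by
        rw [ENNReal.ofReal_mul (p := (L : ℝ)) L.2, ENNReal.ofReal_mul (Nat.cast_nonneg _)]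
        simp

/-- **Weak convergence in a Hilbert space**: convergence of the characteristic functions, together
with tails of the expansion in a fixed basis that are uniformly small in mean square. -/
theorem tendsto_of_tendsto_charFun_of_tail (b : HilbertBasis κ ℝ H)
    {μ : ℕ → ProbabilityMeasure (ι → H)} {μ₀ : ProbabilityMeasure (ι → H)}
    (hchar : ∀ h : ι → H, Tendsto (fun n ↦ ∫ z, Complex.exp ((∑ a, ⟪h a, z a⟫ : ℝ) * Complex.I)
      ∂(μ n : Measure (ι → H))) atTop
      (𝓝 (∫ z, Complex.exp ((∑ a, ⟪h a, z a⟫ : ℝ) * Complex.I) ∂(μ₀ : Measure (ι → H)))))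
    (htail : ∀ ε > 0, ∃ s : Finset κ,
      (∀ᶠ n in atTop, ∀ a, ∫⁻ z, ‖z a - basisProj b s (z a)‖ₑ ^ 2 ∂(μ n : Measure (ι → H))
        ≤ ENNReal.ofReal ε) ∧
      ∀ a, ∫⁻ z, ‖z a - basisProj b s (z a)‖ₑ ^ 2 ∂(μ₀ : Measure (ι → H)) ≤ ENNReal.ofReal ε) :
    Tendsto μ atTop (𝓝 μ₀) := by
  rw [tendsto_iff_forall_lipschitz_integral_tendsto]
  rintro F ⟨M, hM⟩ ⟨L, hF⟩
  -- convergence of the finite-dimensional projections, by Lévy's theorem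
  have hproj : ∀ s : Finset κ, Tendsto
      (fun n ↦ ∫ z, F (fun a ↦ basisProj b s (z a)) ∂(μ n : Measure (ι → H))) atTop
      (𝓝 (∫ z, F (fun a ↦ basisProj b s (z a)) ∂(μ₀ : Measure (ι → H)))) := by
    intro s
    let Ψ : (ι → H) → EuclideanSpace ℝ (ι × s) := fun z ↦
      WithLp.toLp 2 fun p ↦ ⟪b p.2, z p.1⟫
    let Φ : EuclideanSpace ℝ (ι × s) → ι → H := fun y a ↦ ∑ i : s, y (a, i) • b i
    have hΨ : Continuous Ψ := by
      refine (PiLp.continuous_toLp 2 _).comp (continuous_pi fun p ↦ ?_)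
      fun_prop
    have hΦ : Continuous Φ := by fun_prop
    have hΦΨ : ∀ z, Φ (Ψ z) = fun a ↦ basisProj b s (z a) := by
      intro z
      ext1 a
      exact Finset.sum_coe_sort s fun i ↦ ⟪b i, z a⟫ • b i
    have hlevy : Tendsto (fun n ↦ (μ n).map hΨ.aemeasurable) atTop
        (𝓝 (μ₀.map hΨ.aemeasurable)) := by
      refine ProbabilityMeasure.tendsto_iff_tendsto_charFun.2 fun y ↦ ?_
      have hy : ∀ ν : ProbabilityMeasure (ι → H),
          charFun (ν.map hΨ.aemeasurable : Measure (EuclideanSpace ℝ (ι × s))) y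
            = ∫ z, Complex.exp ((∑ a, ⟪Φ y a, z a⟫ : ℝ) * Complex.I) ∂(ν : Measure (ι → H)) := by
        intro ν
        rw [charFun_apply, ProbabilityMeasure.toMeasure_map,
          integral_map hΨ.aemeasurable (by fun_prop)]
        refine integral_congr_ae (Eventually.of_forall fun z ↦ ?_)
        simp only [Φ, Ψ, PiLp.inner_apply, sum_inner, real_inner_smul_left]
        rw [Fintype.sum_prod_type]
        simp
      simp_rw [hy]
      exact hchar _
    have h2 := ProbabilityMeasure.tendsto_map_of_tendsto_of_continuous _ _ hlevy hΦ
    rw [tendsto_iff_forall_lipschitz_integral_tendsto] at h2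
    have h3 := h2 F ⟨M, hM⟩ ⟨L, hF⟩
    have hint : ∀ ν : ProbabilityMeasure (ι → H),
        ∫ z, F z ∂((ν.map hΨ.aemeasurable).map hΦ.aemeasurable : Measure (ι → H))
          = ∫ z, F (fun a ↦ basisProj b s (z a)) ∂(ν : Measure (ι → H)) := by
      intro ν
      have hFm := hF.continuous.measurable
      rw [ProbabilityMeasure.toMeasure_map, ProbabilityMeasure.toMeasure_map,
        integral_map hΦ.aemeasurable hFm.aestronglyMeasurable,
        integral_map (f := fun y ↦ F (Φ y)) hΨ.aemeasurable
          (hF.continuous.comp hΦ).aestronglyMeasurable]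
      simp_rw [hΦΨ]
    simp_rw [hint] at h3
    exact h3
  refine Metric.tendsto_nhds.2 fun ε hε ↦ ?_
  set K : ℝ := L * Fintype.card ι + 1 with hK
  have hK0 : 0 < K := by positivity
  -- `ε / (4 K)` makes both projection errors at most `ε / 4`
  obtain ⟨s, hs, hs₀⟩ := htail ((ε / (4 * K)) ^ 2) (by positivity)
  filter_upwards [hs, Metric.tendsto_nhds.1 (hproj s) (ε / 2) (by positivity)] with n hn hn2
  have h1 := abs_integral_sub_basisProj_le b (μ := (μ n : Measure (ι → H))) hF hM
    (by positivity) hn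
  have h2 := abs_integral_sub_basisProj_le b (μ := (μ₀ : Measure (ι → H))) hF hM
    (by positivity) hs₀
  have h3 : (L : ℝ) * (Fintype.card ι * (ε / (4 * K))) < ε / 4 := by
    have : (L : ℝ) * (Fintype.card ι * (ε / (4 * K))) = (L * Fintype.card ι) * (ε / 4) / K := by
      field_simp
    rw [this, div_lt_iff₀ hK0]
    nlinarith
  rw [Real.dist_eq] at hn2 ⊢
  have h4 := abs_lt.1 hn2
  have h5 := abs_le.1 h1
  have h6 := abs_le.1 h2
  refine abs_lt.2 ⟨by linarith, by linarith⟩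

end WeakConvergence

section GaussianVector

variable {H κ : Type*} [NormedAddCommGroup H] [InnerProductSpace ℝ H]
  [MeasurableSpace H] [BorelSpace H] [SecondCountableTopology H]
  {Ω : Type*} [MeasurableSpace Ω] {P : Measure Ω}
  {E : Type*} [NormedAddCommGroup E] [InnerProductSpace ℝ E]

lemma lintegral_ofReal_sq_Lp_two (f : Lp ℝ 2 P) :
    ∫⁻ ω, ENNReal.ofReal (f ω ^ 2) ∂P = ENNReal.ofReal (‖f‖ ^ 2) := by
  rw [← ofReal_integral_eq_lintegral_ofReal (Lp.memLp f).integrable_sq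
    (Eventually.of_forall fun _ ↦ sq_nonneg _), ← real_inner_self_eq_norm_sq, L2.inner_def]
  simp [sq]

/-- A Hilbert-Schmidt operator `V` turns the isonormal process `W` into a random vector `Z` with
`⟪h, Z⟫ = W (V h)`. -/
theorem exists_vector_of_isonormal (b : HilbertBasis κ ℝ H) (W : E →ₗᵢ[ℝ] Lp ℝ 2 P)
    (V : H →L[ℝ] E) (hV : Summable fun i ↦ ‖V (b i)‖ ^ 2) :
    ∃ Z : Ω → H, AEMeasurable Z P ∧ (∀ h, (fun ω ↦ ⟪h, Z ω⟫) =ᵐ[P] W (V h)) ∧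
      ∀ s : Finset κ, ∫⁻ ω, ‖Z ω - basisProj b s (Z ω)‖ₑ ^ 2 ∂P
        = ∑' i : {i // i ∉ s}, ENNReal.ofReal (‖V (b i)‖ ^ 2) := by
  have : Countable κ := b.countable_index
  let x : κ → Ω → ℝ := fun i ↦ W (V (b i))
  have hxm : ∀ i, AEMeasurable (x i) P := fun i ↦ (Lp.aestronglyMeasurable _).aemeasurable
  have hx2 : ∀ i, ∫⁻ ω, ENNReal.ofReal (x i ω ^ 2) ∂P = ENNReal.ofReal (‖V (b i)‖ ^ 2) := by
    intro i
    rw [← W.norm_map]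
    exact lintegral_ofReal_sq_Lp_two _
  have hxm2 : ∀ i, AEMeasurable (fun ω ↦ ENNReal.ofReal (x i ω ^ 2)) P := fun i ↦
    ((hxm i).pow_const 2).ennreal_ofReal
  have hsq : ∀ᵐ ω ∂P, Summable fun i ↦ x i ω ^ 2 := by
    have h1 : ∫⁻ ω, ∑' i, ENNReal.ofReal (x i ω ^ 2) ∂P ≠ ⊤ := by
      rw [lintegral_tsum hxm2]
      simp_rw [hx2]
      rw [← ENNReal.ofReal_tsum_of_nonneg (fun _ ↦ by positivity) hV]
      exact ENNReal.ofReal_ne_top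
    filter_upwards [ae_lt_top' (AEMeasurable.tsum hxm2) h1] with ω hω
    exact (ENNReal.summable_toReal hω.ne).congr fun i ↦ ENNReal.toReal_ofReal (sq_nonneg _)
  let Z : Ω → H := fun ω ↦ ∑' i, x i ω • b i
  have hZ : ∀ᵐ ω ∂P, HasSum (fun i ↦ x i ω • b i) (Z ω) := by
    filter_upwards [hsq] with ω hω
    have hmem : Memℓp (fun i ↦ x i ω) 2 := by
      refine memℓp_gen ?_
      simpa using hω
    have h1 := b.hasSum_repr_symm ⟨fun i ↦ x i ω, hmem⟩
    exact h1.summable.hasSum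
  -- almost surely, `Z ω` is given by a convergent series and has coordinates `x i ω`
  have hZi : ∀ᵐ ω ∂P, ∀ i, ⟪b i, Z ω⟫ = x i ω := by
    classical
    filter_upwards [hZ] with ω hω i
    have h1 := hω.mapL (innerSL ℝ (b i))
    have h2 : HasSum (fun k ↦ innerSL ℝ (b i) (x k ω • b k)) (x i ω) := by
      have h3 := hasSum_ite_eq i (x i ω)
      refine h3.congr_fun ?_
      intro k
      rw [innerSL_apply_apply, real_inner_smul_right, orthonormal_iff_ite.1 b.orthonormal i k]
      by_cases h : k = i
      · subst h; simp
      · simp [h, Ne.symm h]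
    exact h1.unique h2
  refine ⟨Z, ?_, ?_, ?_⟩
  · refine aemeasurable_of_tendsto_metrizable_ae (atTop : Filter (Finset κ))
      (f := fun s ω ↦ ∑ i ∈ s, x i ω • b i) (fun s ↦ ?_) hZ
    exact Finset.aemeasurable_fun_sum s fun i _ ↦ (hxm i).smul_const (b i)
  · intro h
    -- compare the partial sums of both sides in `L²` and almost surely
    have hb := (((b.hasSum_repr h).mapL V).mapL W.toContinuousLinearMap)
    have h1 : Tendsto (fun s : Finset κ ↦ ∑ i ∈ s, W (V (b.repr h i • b i))) atTop (𝓝 (W (V h))) :=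
      hb
    obtain ⟨ns, hns⟩ := exists_seq_tendsto (atTop : Filter (Finset κ))
    have h2 : TendstoInMeasure P (fun n ↦ ((∑ i ∈ ns n, W (V (b.repr h i • b i)) : Lp ℝ 2 P) :
        Ω → ℝ)) atTop (W (V h)) := tendstoInMeasure_of_tendsto_Lp (h1.comp hns)
    obtain ⟨ms, hms, hae⟩ := h2.exists_seq_tendsto_ae
    have hsum : ∀ᵐ ω ∂P, ∀ n, (∑ i ∈ ns n, W (V (b.repr h i • b i)) : Lp ℝ 2 P) ω
        = ∑ i ∈ ns n, b.repr h i * x i ω := by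
      rw [ae_all_iff]
      intro n
      have := sum_smul_isonormal_ae (P := P) (W := W) (ns n) (fun i ↦ b.repr h i)
        (fun i ↦ V (b i)) (X := x) fun i ↦ EventuallyEq.rfl
      filter_upwards [this] with ω hω
      rw [hω]
      simp only [map_sum, map_smul]
    filter_upwards [hae, hsum, hZ] with ω h3 h4 h5
    have h6 : HasSum (fun i ↦ b.repr h i * x i ω) ⟪h, Z ω⟫ := by
      have := h5.mapL (innerSL ℝ h)
      refine this.congr_fun ?_
      intro i
      rw [innerSL_apply_apply, real_inner_smul_right, b.repr_apply_apply, real_inner_comm, mul_comm]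
    simp_rw [h4] at h3
    exact tendsto_nhds_unique ((h6.comp hns).comp hms.tendsto_atTop) h3
  · intro s
    have h1 : ∫⁻ ω, ‖Z ω - basisProj b s (Z ω)‖ₑ ^ 2 ∂P
        = ∫⁻ ω, ∑' i : {i // i ∉ s}, ENNReal.ofReal (x i ω ^ 2) ∂P := by
      refine lintegral_congr_ae ?_
      filter_upwards [hZi] with ω hω
      rw [enorm_sub_basisProj_sq]
      simp_rw [hω]
    rw [h1, lintegral_tsum fun i : {i // i ∉ s} ↦ hxm2 i]
    simp_rw [hx2]

end GaussianVector

/-! ### The particle system in the feature space -/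

section Feature

variable {ι : Type*} [Fintype ι]

lemma decay_le_decaySum (τ : ι → ℝ≥0) (a : ι) (x : ℝ) (w : Path) :
    decay (x + w (τ a)) ≤ decaySum τ x w :=
  Finset.single_le_sum (f := fun a ↦ decay (x + w (τ a))) (fun _ _ ↦ (decay_pos _).le)
    (Finset.mem_univ a)

/-- A continuous function dominated by the weight, evaluated at the position of a particle. -/
lemma isDominated_comp_position {E : Type*} [NormedAddCommGroup E] [MeasurableSpace E]
    [BorelSpace E] {k : ℝ → E} (hk : Continuous k) {C : ℝ} (hC : 0 ≤ C)
    (hkC : ∀ x, ‖k x‖ ≤ C * decay x) (τ : ι → ℝ≥0) (a : ι) :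
    IsDominated τ C fun x w ↦ k (x + w (τ a)) where
  nonneg := hC
  measurable := hk.measurable.comp
    (measurable_fst.add ((measurable_pi_apply (τ a)).comp measurable_snd))
  norm_le x w := (hkC _).trans (mul_le_mul_of_nonneg_left (decay_le_decaySum τ a x w) hC)
  continuous _ := hk.comp (continuous_add_const _)

/-- The vector of the features of a particle at the times `τ`. -/
noncomputable def featureVector (τ : ι → ℝ≥0) (x : ℝ) (w : Path) : ι → FeatureSpace :=
  fun a ↦ feature (x + w (τ a))

lemma exists_isDominated_feature (τ : ι → ℝ≥0) : ∃ C : ℝ,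
    IsDominated τ C (featureVector τ) ∧
      ∀ a, IsDominated τ C fun x w ↦ feature (x + w (τ a)) := by
  obtain ⟨C, hC, hCx⟩ := norm_feature_le
  have h := isDominated_comp_position continuous_feature hC hCx τ
  refine ⟨C, ⟨hC, ?_, fun x w ↦ ?_,
    fun w ↦ continuous_pi fun a ↦ (h a).continuous w⟩, h⟩
  · exact measurable_pi_lambda _ fun a ↦ (h a).measurable
  · exact (pi_norm_le_iff_of_nonneg (mul_nonneg hC (decaySum_nonneg τ x w))).2 fun a ↦
      (h a).norm_le x w

lemma IsDominated.clm {E F : Type*} [NormedAddCommGroup E] [NormedSpace ℝ E]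
    [NormedAddCommGroup F] [NormedSpace ℝ F] [MeasurableSpace E] [BorelSpace E]
    [MeasurableSpace F] [BorelSpace F]
    {τ : ι → ℝ≥0} {C : ℝ} {G : ℝ → Path → E} (hG : IsDominated τ C G) (L : E →L[ℝ] F) :
    IsDominated τ (‖L‖ * C) fun x w ↦ L (G x w) where
  nonneg := mul_nonneg (norm_nonneg _) hG.nonneg
  measurable := L.continuous.measurable.comp hG.measurable
  norm_le x w := (L.le_opNorm _).trans (by
    rw [mul_assoc]; exact mul_le_mul_of_nonneg_left (hG.norm_le x w) (norm_nonneg _))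
  continuous w := L.continuous.comp (hG.continuous w)

end Feature

namespace ParticleSystem

variable {Ω : Type*} [MeasurableSpace Ω] {α : ℝ} {P : Measure Ω} (S : ParticleSystem α P)

lemma clm_cellSum {E F : Type*} [NormedAddCommGroup E] [NormedSpace ℝ E] [NormedAddCommGroup F]
    [NormedSpace ℝ F] (L : E →L[ℝ] F) (T : ℝ) (G : ℝ → Path → E) (j : ℤ) (ω : Ω) :
    L (S.cellSum T G j ω) = S.cellSum T (fun x w ↦ L (G x w)) j ω := by
  rw [cellSum_eq, cellSum_eq, map_sum]

/-- Cauchy-Schwarz over the particles of a cell. -/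
lemma norm_cellSum_sq_le {E ι : Type*} [SeminormedAddCommGroup E] [Fintype ι] {τ : ι → ℝ≥0}
    {G : ℝ → Path → E} {ε : ℝ} (hε : 0 ≤ ε) (hG : ∀ x w, ‖G x w‖ ^ 2 ≤ ε * decaySum τ x w)
    (T : ℝ) (j : ℤ) (ω : Ω) : ‖S.cellSum T G j ω‖ ^ 2 ≤ ε * S.majorant τ T j ω := by
  have h0 := S.cellSum_decaySum_nonneg τ T j ω
  have h1 : ‖S.cellSum T G j ω‖ ^ 2
      ≤ S.θ j ω * ∑ n : Fin (S.θ j ω), ‖G (S.ρ j (S.θ j ω) n ω / T) (S.path j n ω)‖ ^ 2 := by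
    rw [cellSum_eq]
    refine (pow_le_pow_left₀ (norm_nonneg _) (norm_sum_le _ _) 2).trans ?_
    have := sq_sum_le_card_mul_sum_sq (s := Finset.univ)
      (f := fun n : Fin (S.θ j ω) ↦ ‖G (S.ρ j (S.θ j ω) n ω / T) (S.path j n ω)‖)
    simpa using this
  have h2 : ∑ n : Fin (S.θ j ω), ‖G (S.ρ j (S.θ j ω) n ω / T) (S.path j n ω)‖ ^ 2
      ≤ ε * S.cellSum T (decaySum τ) j ω := by
    rw [cellSum_eq, Finset.mul_sum]
    exact Finset.sum_le_sum fun n _ ↦ hG _ _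
  have h3 : (S.θ j ω : ℝ) ≤ (S.θ j ω : ℝ) ^ 2 := by
    exact_mod_cast Nat.le_self_pow (by norm_num) _
  calc ‖S.cellSum T G j ω‖ ^ 2 ≤ S.θ j ω * (ε * S.cellSum T (decaySum τ) j ω) :=
        h1.trans (mul_le_mul_of_nonneg_left h2 (Nat.cast_nonneg _))
    _ ≤ (S.θ j ω : ℝ) ^ 2 * (ε * S.cellSum T (decaySum τ) j ω) :=
        mul_le_mul_of_nonneg_right h3 (mul_nonneg hε h0)
    _ = ε * S.majorant τ T j ω := by rw [majorant]; ring

section CLM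

variable [IsProbabilityMeasure P]
  {E F ι : Type*} [NormedAddCommGroup E] [NormedSpace ℝ E] [CompleteSpace E]
  [MeasurableSpace E] [BorelSpace E] [SecondCountableTopology E]
  [NormedAddCommGroup F] [NormedSpace ℝ F] [CompleteSpace F]
  [Fintype ι] {τ : ι → ℝ≥0} {C : ℝ} {G : ℝ → Path → E}

lemma summable_integral_cellSum (hG : IsDominated τ C G) {T : ℝ} (hT : 0 < T) :
    Summable fun j ↦ ∫ ω, S.cellSum T G j ω ∂P :=
  Summable.of_norm_bounded (S.summable_integral_norm_cellSum hG hT)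
    fun _ ↦ norm_integral_le_integral_norm _

lemma clm_centeredSum (hG : IsDominated τ C G) {T : ℝ} (hT : 0 < T) (L : E →L[ℝ] F) {ω : Ω}
    (hω : Summable fun j ↦ ‖S.cellSum T G j ω‖) :
    L (S.centeredSum T G ω) = S.centeredSum T (fun x w ↦ L (G x w)) ω := by
  have h1 : L (∑' j, S.cellSum T G j ω) = ∑' j, S.cellSum T (fun x w ↦ L (G x w)) j ω := by
    rw [L.map_tsum hω.of_norm]
    simp_rw [S.clm_cellSum]
  have h2 : L (∑' j, ∫ ω', S.cellSum T G j ω' ∂P)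
      = ∑' j, ∫ ω', S.cellSum T (fun x w ↦ L (G x w)) j ω' ∂P := by
    rw [L.map_tsum (S.summable_integral_cellSum hG hT)]
    refine tsum_congr fun j ↦ ?_
    rw [← L.integral_comp_comm (S.integrable_cellSum hG T j)]
    simp_rw [S.clm_cellSum]
  rw [centeredSum, centeredSum, map_smul, map_sub, h1, h2]

lemma ae_clm_centeredSum (hG : IsDominated τ C G) {T : ℝ} (hT : 0 < T) (L : E →L[ℝ] F) :
    ∀ᵐ ω ∂P, L (S.centeredSum T G ω) = S.centeredSum T (fun x w ↦ L (G x w)) ω := by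
  filter_upwards [S.ae_summable_norm_cellSum hG hT] with ω hω using S.clm_centeredSum hG hT L hω

lemma ae_hasSum_centeredSum (hG : IsDominated τ C G) {T : ℝ} (hT : 0 < T) :
    ∀ᵐ ω ∂P, HasSum (fun j ↦ (√T)⁻¹ • (S.cellSum T G j ω - ∫ ω', S.cellSum T G j ω' ∂P))
      (S.centeredSum T G ω) := by
  filter_upwards [S.ae_summable_norm_cellSum hG hT] with ω hω
  exact (hω.of_norm.hasSum.sub (S.summable_integral_cellSum hG hT).hasSum).const_smul _

lemma aemeasurable_centeredSum (hG : IsDominated τ C G) {T : ℝ} (hT : 0 < T) :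
    AEMeasurable (S.centeredSum T G) P := by
  refine aemeasurable_of_tendsto_metrizable_ae (atTop : Filter (Finset ℤ))
    (f := fun s ω ↦ ∑ j ∈ s, (√T)⁻¹ • (S.cellSum T G j ω - ∫ ω', S.cellSum T G j ω' ∂P))
    (fun s ↦ ?_) (S.ae_hasSum_centeredSum hG hT)
  exact (Finset.measurable_fun_sum s fun j _ ↦
    ((S.measurable_cellSum hG.measurable T j).sub_const _).const_smul _).aemeasurable

end CLM

section SecondMoment

variable [IsProbabilityMeasure P] {ι : Type*} [Fintype ι] {τ : ι → ℝ≥0} {C : ℝ}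

/-- The second moment of a centered sum over independent cells is at most the normalized sum of
the second moments over the cells. -/
lemma lintegral_centeredSum_sq_le {G : ℝ → Path → ℝ} (hG : IsDominated τ C G) {T : ℝ}
    (hT : 0 < T) : ∫⁻ ω, ENNReal.ofReal (S.centeredSum T G ω ^ 2) ∂P
      ≤ ENNReal.ofReal T⁻¹ * ∑' j, ∫⁻ ω, ENNReal.ofReal (S.cellSum T G j ω ^ 2) ∂P := by
  let Y : ℤ → Ω → ℝ := S.cellSum T G
  have hYm : ∀ j, Measurable (Y j) := S.measurable_cellSum hG.measurable T
  have hY2 : ∀ j, MemLp (Y j) 2 P := S.memLp_cellSum hG T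
  have hYi : ∀ j, Integrable (Y j) P := S.integrable_cellSum hG T
  let X : Finset ℤ → Ω → ℝ := fun s ω ↦ ∑ j ∈ s, (√T)⁻¹ • (Y j ω - ∫ ω', Y j ω' ∂P)
  have hind : iIndepFun Y P := S.iIndepFun_blocks.comp
    (fun j p ↦ particleSum (fun x ↦ G (x / T)) p.1 p.2)
    fun j ↦ measurable_particleSum (measurable_uncurry_comp_div hG.measurable T)
  -- finitely many cells: the variance is additive
  have hX : ∀ s, ∫⁻ ω, ENNReal.ofReal (X s ω ^ 2) ∂P
      ≤ ENNReal.ofReal T⁻¹ * ∑' j, ∫⁻ ω, ENNReal.ofReal (Y j ω ^ 2) ∂P := by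
    intro s
    have h1 : ∀ ω, X s ω ^ 2
        = T⁻¹ * ((∑ j ∈ s, Y j) ω - ∫ ω', (∑ j ∈ s, Y j) ω' ∂P) ^ 2 := by
      intro ω
      simp only [X, smul_eq_mul, Finset.sum_apply]
      rw [← Finset.mul_sum, Finset.sum_sub_distrib, integral_finsetSum _ fun j _ ↦ hYi j,
        mul_pow, inv_pow, Real.sq_sqrt hT.le]
    have hmem : MemLp (∑ j ∈ s, Y j) 2 P := memLp_finsetSum' s fun j _ ↦ hY2 j
    have h2 : ∫ ω, X s ω ^ 2 ∂P = T⁻¹ * ∑ j ∈ s, Var[Y j; P] := by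
      rw [← IndepFun.variance_sum (fun j _ ↦ hY2 j) fun i _ j _ hij ↦ hind.indepFun hij,
        variance_eq_integral hmem.1.aemeasurable, ← integral_const_mul]
      exact integral_congr_ae (Eventually.of_forall h1)
    have h3 : Integrable (fun ω ↦ X s ω ^ 2) P := by
      simp_rw [h1]
      exact (hmem.sub (memLp_const _)).integrable_sq.const_mul _
    rw [← ofReal_integral_eq_lintegral_ofReal h3 (Eventually.of_forall fun _ ↦ sq_nonneg _), h2,
      ENNReal.ofReal_mul (by positivity),
      ENNReal.ofReal_sum_of_nonneg fun _ _ ↦ variance_nonneg _ _]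
    gcongr
    refine (Finset.sum_le_sum fun j _ ↦ ?_).trans (ENNReal.sum_le_tsum s)
    rw [← ofReal_integral_eq_lintegral_ofReal (hY2 j).integrable_sq
      (Eventually.of_forall fun _ ↦ sq_nonneg _)]
    exact ENNReal.ofReal_le_ofReal (variance_le_expectation_sq (hYm j).aestronglyMeasurable)
  obtain ⟨ns, hns⟩ := exists_seq_tendsto (atTop : Filter (Finset ℤ))
  have hXm : ∀ s, Measurable (X s) := fun s ↦ Finset.measurable_fun_sum s fun j _ ↦
    ((hYm j).sub_const _).const_mul _
  -- Fatou's lemma along a sequence of finite sets of cells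
  have h4 : ∫⁻ ω, ENNReal.ofReal (S.centeredSum T G ω ^ 2) ∂P
      ≤ ∫⁻ ω, liminf (fun n ↦ ENNReal.ofReal (X (ns n) ω ^ 2)) atTop ∂P := by
    refine lintegral_mono_ae ?_
    filter_upwards [S.ae_hasSum_centeredSum hG hT] with ω hω
    have h5 : Tendsto (fun n ↦ ENNReal.ofReal (X (ns n) ω ^ 2)) atTop
        (𝓝 (ENNReal.ofReal (S.centeredSum T G ω ^ 2))) :=
      ENNReal.tendsto_ofReal ((hω.comp hns).pow 2)
    exact h5.liminf_eq.ge
  refine h4.trans ((lintegral_liminf_le fun n ↦ ((hXm _).pow_const 2).ennreal_ofReal).trans ?_)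
  exact (liminf_le_liminf (Eventually.of_forall fun n ↦ hX (ns n))).trans
    (by rw [liminf_const])

variable {H κ : Type*} [NormedAddCommGroup H] [InnerProductSpace ℝ H] [CompleteSpace H]
  [MeasurableSpace H] [BorelSpace H] [SecondCountableTopology H]

lemma lintegral_centeredSum_sub_basisProj_le (b : HilbertBasis κ ℝ H) (s : Finset κ)
    {G : ℝ → Path → H} (hG : IsDominated τ C G) {T : ℝ} (hT : 0 < T) :
    ∫⁻ ω, ‖S.centeredSum T G ω - basisProj b s (S.centeredSum T G ω)‖ₑ ^ 2 ∂P
      ≤ ENNReal.ofReal T⁻¹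
        * ∑' j, ∫⁻ ω, ‖S.cellSum T G j ω - basisProj b s (S.cellSum T G j ω)‖ₑ ^ 2 ∂P := by
  have : Countable κ := b.countable_index
  have hGi : ∀ i, IsDominated τ (‖innerSL ℝ (b i)‖ * C) fun x w ↦ innerSL ℝ (b i) (G x w) :=
    fun i ↦ hG.clm (innerSL ℝ (b i))
  have h1 : ∀ᵐ ω ∂P, ∀ i, ⟪b i, S.centeredSum T G ω⟫
      = S.centeredSum T (fun x w ↦ innerSL ℝ (b i) (G x w)) ω := by
    rw [ae_all_iff]
    exact fun i ↦ S.ae_clm_centeredSum hG hT (innerSL ℝ (b i))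
  have hm1 : ∀ i, AEMeasurable (fun ω ↦ ENNReal.ofReal
      (S.centeredSum T (fun x w ↦ innerSL ℝ (b i) (G x w)) ω ^ 2)) P := fun i ↦
    ((S.aemeasurable_centeredSum (hGi i) hT).pow_const 2).ennreal_ofReal
  have hm2 : ∀ i j, Measurable fun ω ↦ ENNReal.ofReal
      (S.cellSum T (fun x w ↦ innerSL ℝ (b i) (G x w)) j ω ^ 2) := fun i j ↦
    ((S.measurable_cellSum (hGi i).measurable T j).pow_const 2).ennreal_ofReal
  have h2 : ∀ j ω, ‖S.cellSum T G j ω - basisProj b s (S.cellSum T G j ω)‖ₑ ^ 2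
      = ∑' i : {i // i ∉ s}, ENNReal.ofReal
        (S.cellSum T (fun x w ↦ innerSL ℝ (b i) (G x w)) j ω ^ 2) := by
    intro j ω
    rw [enorm_sub_basisProj_sq]
    refine tsum_congr fun i ↦ ?_
    rw [← S.clm_cellSum]
    rfl
  have h3 : ∫⁻ ω, ‖S.centeredSum T G ω - basisProj b s (S.centeredSum T G ω)‖ₑ ^ 2 ∂P
      = ∫⁻ ω, ∑' i : {i // i ∉ s}, ENNReal.ofReal
        (S.centeredSum T (fun x w ↦ innerSL ℝ (b i) (G x w)) ω ^ 2) ∂P := by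
    refine lintegral_congr_ae ?_
    filter_upwards [h1] with ω hω
    rw [enorm_sub_basisProj_sq]
    simp_rw [hω]
  rw [h3, lintegral_tsum fun i : {i // i ∉ s} ↦ hm1 i]
  simp_rw [h2]
  have h4 : ∀ j, ∫⁻ ω, ∑' i : {i // i ∉ s}, ENNReal.ofReal
        (S.cellSum T (fun x w ↦ innerSL ℝ (b i) (G x w)) j ω ^ 2) ∂P
      = ∑' i : {i // i ∉ s}, ∫⁻ ω, ENNReal.ofReal
        (S.cellSum T (fun x w ↦ innerSL ℝ (b i) (G x w)) j ω ^ 2) ∂P := fun j ↦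
    lintegral_tsum fun i : {i // i ∉ s} ↦ (hm2 i j).aemeasurable
  simp_rw [h4]
  rw [ENNReal.tsum_comm, ← ENNReal.tsum_mul_left]
  exact ENNReal.tsum_le_tsum fun i ↦ S.lintegral_centeredSum_sq_le (hGi i) hT

/-- The tails of the normalized fluctuations in a fixed basis are uniformly small in mean square. -/
theorem exists_tail_centeredSum_le (b : HilbertBasis κ ℝ H) {k : ℝ → H} (hk : Continuous k)
    (hC : 0 ≤ C) (hkC : ∀ x, ‖k x‖ ≤ C * decay x) (τ : ι → ℝ≥0) {ε : ℝ} (hε : 0 < ε) :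
    ∃ s₀ : Finset κ, ∀ s, s₀ ⊆ s → ∀ T : ℝ, 1 ≤ T → ∀ a,
      ∫⁻ ω, ‖S.centeredSum T (fun x w ↦ k (x + w (τ a))) ω
        - basisProj b s (S.centeredSum T (fun x w ↦ k (x + w (τ a))) ω)‖ₑ ^ 2 ∂P
        ≤ ENNReal.ofReal ε := by
  have hD0 := S.majorantConst_nonneg ι
  set D := S.majorantConst ι
  set ε' := ε / (D + 1)
  have hε' : 0 < ε' := by positivity
  obtain ⟨s₀, hs₀⟩ := exists_basisProj_uniform b hk hkC hε'
  refine ⟨s₀, fun s hs T hT a ↦ ?_⟩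
  have hT0 : 0 < T := by linarith
  have hG := isDominated_comp_position hk hC hkC τ a
  refine (S.lintegral_centeredSum_sub_basisProj_le b s hG hT0).trans ?_
  set G : ℝ → Path → H := fun x w ↦ k (x + w (τ a)) with hGdef
  have h1 : ∀ j ω, ‖S.cellSum T G j ω - basisProj b s (S.cellSum T G j ω)‖ₑ ^ 2
      ≤ ENNReal.ofReal ε' * ENNReal.ofReal (S.majorant τ T j ω) := by
    intro j ω
    have h2 : S.cellSum T G j ω - basisProj b s (S.cellSum T G j ω)
        = S.cellSum T (fun x w ↦ G x w - basisProj b s (G x w)) j ω := by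
      rw [cellSum_eq, cellSum_eq, Finset.sum_sub_distrib]
      congr 1
      simp only [basisProj, inner_sum, Finset.sum_smul]
      exact Finset.sum_comm
    rw [h2, enorm_sq_eq_ofReal_norm_sq, ← ENNReal.ofReal_mul hε'.le]
    refine ENNReal.ofReal_le_ofReal (S.norm_cellSum_sq_le hε'.le (fun x w ↦ ?_) T j ω)
    exact (hs₀ s hs _).trans (mul_le_mul_of_nonneg_left (decay_le_decaySum τ a x w) hε'.le)
  have h3 : ∑' j, ∫⁻ ω, ‖S.cellSum T G j ω - basisProj b s (S.cellSum T G j ω)‖ₑ ^ 2 ∂P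
      ≤ ENNReal.ofReal ε' * ENNReal.ofReal (T * D) := by
    refine (ENNReal.tsum_le_tsum fun j ↦ lintegral_mono (h1 j)).trans ?_
    simp_rw [lintegral_const_mul _ (S.measurable_majorant τ T _).ennreal_ofReal,
      ← S.ofReal_integral_majorant]
    rw [ENNReal.tsum_mul_left, ← ENNReal.ofReal_tsum_of_nonneg (S.integral_majorant_nonneg τ T)
      (S.summable_integral_majorant τ hT0)]
    gcongr
    exact S.tsum_integral_majorant_le τ hT
  calc ENNReal.ofReal T⁻¹
        * ∑' j, ∫⁻ ω, ‖S.cellSum T G j ω - basisProj b s (S.cellSum T G j ω)‖ₑ ^ 2 ∂P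
      ≤ ENNReal.ofReal T⁻¹ * (ENNReal.ofReal ε' * ENNReal.ofReal (T * D)) := by gcongr
    _ = ENNReal.ofReal (ε' * D) := by
        rw [← ENNReal.ofReal_mul hε'.le, ← ENNReal.ofReal_mul (by positivity)]
        congr 1
        field_simp
    _ ≤ ENNReal.ofReal ε := by
        refine ENNReal.ofReal_le_ofReal ?_
        rw [div_mul_eq_mul_div, div_le_iff₀ (by positivity)]
        nlinarith

end SecondMoment

end ParticleSystem

/-! ### The Hilbert space and the operators behind the limit -/

section Mix

/-- The function `a G(x, w) + c ∫ G(x, w') μ(dw')` on the product of space and path space: the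
part `a` carries the fluctuations of the displacements, and `a + c` those of the initial
configuration. -/
noncomputable def mix {E : Type*} [NormedAddCommGroup E] [NormedSpace ℝ E] (a c : ℝ)
    (μ : Measure Path) (G : ℝ → Path → E) (p : ℝ × Path) : E :=
  a • G p.1 p.2 + c • ∫ w, G p.1 w ∂μ

variable {ι : Type*} [Fintype ι] {τ : ι → ℝ≥0} (μ : Measure Path) [IsProbabilityMeasure μ]

lemma memLp_two_of_bounded {Ω : Type*} [MeasurableSpace Ω] {ν : Measure Ω} {f : Ω → ℝ}
    (hf : Integrable f ν) (h0 : ∀ ω, 0 ≤ f ω) {M : ℝ} (hM : ∀ ω, f ω ≤ M) : MemLp f 2 ν := by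
  refine (memLp_two_iff_integrable_sq hf.1).2 ((hf.const_mul M).mono' (hf.1.pow 2) ?_)
  refine Eventually.of_forall fun ω ↦ ?_
  rw [Real.norm_of_nonneg (sq_nonneg _), sq]
  exact mul_le_mul_of_nonneg_right (hM ω) (h0 ω)

lemma memLp_two_uncurry_decaySum (τ : ι → ℝ≥0) :
    MemLp (Function.uncurry (decaySum τ)) 2 ((volume : Measure ℝ).prod μ) :=
  memLp_two_of_bounded (integrable_uncurry_decaySum μ τ) (fun _ ↦ decaySum_nonneg τ _ _)
    fun _ ↦ decaySum_le_card τ _ _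

lemma memLp_two_integral_decaySum (τ : ι → ℝ≥0) :
    MemLp (fun x ↦ ∫ w, decaySum τ x w ∂μ) 2 (volume : Measure ℝ) := by
  refine memLp_two_of_bounded (M := Fintype.card ι)
    (integrable_uncurry_decaySum μ τ).integral_prod_left
    (fun x ↦ integral_nonneg fun w ↦ decaySum_nonneg τ x w) fun x ↦ ?_
  refine (integral_mono_of_nonneg (Eventually.of_forall fun w ↦ decaySum_nonneg τ x w)
    (integrable_const _) (Eventually.of_forall fun w ↦ decaySum_le_card τ x w)).trans ?_
  simp

section Vector

variable {E : Type*} [NormedAddCommGroup E] [MeasurableSpace E] [BorelSpace E]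
  [SecondCountableTopology E] {C : ℝ} {G : ℝ → Path → E}

lemma IsDominated.memLp_uncurry (hG : IsDominated τ C G) :
    MemLp (Function.uncurry G) 2 ((volume : Measure ℝ).prod μ) :=
  (memLp_two_uncurry_decaySum μ τ).of_le_mul (c := C) hG.measurable.aestronglyMeasurable
    (Eventually.of_forall fun p ↦ by
      rw [Function.uncurry_def, Function.uncurry_def, Real.norm_of_nonneg (decaySum_nonneg τ _ _)]
      exact hG.norm_le _ _)

variable [NormedSpace ℝ E]

lemma IsDominated.memLp_integral (hG : IsDominated τ C G) :
    MemLp (fun x ↦ ∫ w, G x w ∂μ) 2 (volume : Measure ℝ) := by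
  refine (memLp_two_integral_decaySum μ τ).of_le_mul (c := C)
    (hG.continuous_integral μ).aestronglyMeasurable (Eventually.of_forall fun x ↦ ?_)
  rw [Real.norm_of_nonneg (integral_nonneg fun w ↦ decaySum_nonneg τ x w), ← integral_const_mul]
  refine norm_integral_le_of_norm_le ?_ (Eventually.of_forall (hG.norm_le x))
  have hd : Measurable fun w ↦ decaySum τ x w :=
    (measurable_decaySum τ).comp (measurable_const.prodMk measurable_id)
  exact (Integrable.of_bound hd.aestronglyMeasurable (Fintype.card ι : ℝ)
    (Eventually.of_forall fun w ↦ by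
      rw [Real.norm_of_nonneg (decaySum_nonneg τ x w)]; exact decaySum_le_card τ x w)).const_mul C

lemma IsDominated.memLp_mix (hG : IsDominated τ C G) (a c : ℝ) :
    MemLp (mix a c μ G) 2 ((volume : Measure ℝ).prod μ) :=
  ((hG.memLp_uncurry μ).const_smul a).add
    (((hG.memLp_integral μ).comp_fst μ).const_smul c)

end Vector

/-- The inner product of two mixtures in `L²`. -/
lemma IsDominated.integral_mix_mul {C D : ℝ} {F G : ℝ → Path → ℝ} (hF : IsDominated τ C F)
    (hG : IsDominated τ D G) (a c : ℝ) :
    ∫ p, mix a c μ F p * mix a c μ G p ∂((volume : Measure ℝ).prod μ)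
      = a ^ 2 * (∫ x : ℝ, ∫ w, F x w * G x w ∂μ)
        + (2 * a * c + c ^ 2) * ∫ x : ℝ, (∫ w, F x w ∂μ) * ∫ w, G x w ∂μ := by
  have hFG : Integrable (fun p : ℝ × Path ↦ F p.1 p.2 * G p.1 p.2)
      ((volume : Measure ℝ).prod μ) := (hF.memLp_uncurry μ).integrable_mul (hG.memLp_uncurry μ)
  have hFG' := (hF.memLp_integral μ).integrable_mul (hG.memLp_integral μ)
  rw [integral_prod (fun p ↦ mix a c μ F p * mix a c μ G p)
      ((hF.memLp_mix μ a c).integrable_mul (hG.memLp_mix μ a c)),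
    ← integral_const_mul, ← integral_const_mul, ← integral_add]
  rotate_left
  · exact hFG.integral_prod_left.const_mul _
  · exact hFG'.const_mul _
  refine integral_congr_ae (Eventually.of_forall fun x ↦ ?_)
  have h1 : Integrable (fun w ↦ F x w * G x w) μ := (hF.memLp μ 2 x).integrable_mul (hG.memLp μ 2 x)
  have hf := hF.integrable μ x
  have hg := hG.integrable μ x
  set f := ∫ w, F x w ∂μ with hfd
  set g := ∫ w, G x w ∂μ with hgd
  have h2 : ∀ w, mix a c μ F (x, w) * mix a c μ G (x, w)
      = a ^ 2 * (F x w * G x w) + (a * c * g * F x w + (a * c * f * G x w + c ^ 2 * (f * g))) := by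
    intro w
    simp only [mix, smul_eq_mul, ← hfd, ← hgd]
    ring
  simp_rw [h2]
  have hi3 : Integrable (fun w ↦ a * c * f * G x w + c ^ 2 * (f * g)) μ :=
    (hg.const_mul _).add (integrable_const _)
  have hi2 : Integrable (fun w ↦ a * c * g * F x w + (a * c * f * G x w + c ^ 2 * (f * g))) μ :=
    (hf.const_mul _).add hi3
  rw [integral_add (h1.const_mul _) hi2, integral_add (hf.const_mul _) hi3,
    integral_add (hg.const_mul _) (integrable_const _),
    integral_const_mul, integral_const_mul, integral_const_mul, integral_const, ← hfd, ← hgd]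
  simp only [probReal_univ, smul_eq_mul]
  ring

end Mix

section Operator

variable {Ω H κ : Type*} [MeasurableSpace Ω] {ν : Measure Ω} [NormedAddCommGroup H]
  [InnerProductSpace ℝ H]

/-- The operator `h ↦ ⟪h, K ·⟫` defined by a square integrable vector-valued kernel `K`. -/
noncomputable def kernelOp (K : Lp H 2 ν) : H →L[ℝ] Lp ℝ 2 ν :=
  LinearMap.mkContinuous
    { toFun := fun h ↦ (innerSL ℝ h).compLp K
      map_add' := fun h g ↦ by rw [map_add, ContinuousLinearMap.add_compLp]
      map_smul' := fun r h ↦ by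
        rw [map_smulₛₗ, ContinuousLinearMap.smul_compLp]; rfl } ‖K‖ fun h ↦ by
    refine (ContinuousLinearMap.norm_compLp_le _ _).trans ?_
    rw [innerSL_apply_norm, mul_comm]

lemma kernelOp_ae (K : Lp H 2 ν) (h : H) : kernelOp K h =ᵐ[ν] fun ω ↦ ⟪h, K ω⟫ :=
  ContinuousLinearMap.coeFn_compLp' (innerSL ℝ h) K

/-- A square integrable kernel defines a Hilbert-Schmidt operator. -/
lemma summable_norm_kernelOp_sq (b : HilbertBasis κ ℝ H) (K : Lp H 2 ν) :
    Summable fun i ↦ ‖kernelOp K (b i)‖ ^ 2 := by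
  have hK : Integrable (fun ω ↦ ‖K ω‖ ^ 2) ν := (Lp.memLp K).integrable_norm_pow (by norm_num)
  refine summable_of_sum_le (c := ∫ ω, ‖K ω‖ ^ 2 ∂ν) (fun _ ↦ by positivity) fun s ↦ ?_
  have h1 : ∀ i, ‖kernelOp K (b i)‖ ^ 2 = ∫ ω, ⟪b i, K ω⟫ ^ 2 ∂ν := by
    intro i
    rw [← real_inner_self_eq_norm_sq, L2.inner_def]
    refine integral_congr_ae ?_
    filter_upwards [kernelOp_ae K (b i)] with ω hω
    simp [hω, sq]
  have h2 : ∀ i, Integrable (fun ω ↦ ⟪b i, K ω⟫ ^ 2) ν := fun i ↦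
    ((Lp.memLp (kernelOp K (b i))).integrable_sq).congr (by
      filter_upwards [kernelOp_ae K (b i)] with ω hω; rw [hω])
  simp_rw [h1]
  rw [← integral_finsetSum _ fun i _ ↦ h2 i]
  exact integral_mono (integrable_finsetSum _ fun i _ ↦ h2 i) hK fun ω ↦
    sum_le_hasSum s (fun _ _ ↦ sq_nonneg _) (hasSum_inner_sq b (K ω))

end Operator

namespace ParticleSystem

variable {Ω : Type*} [MeasurableSpace Ω] {α : ℝ} {P : Measure Ω} (S : ParticleSystem α P)

/-- The weight of the displacement part of the limit. -/
noncomputable def mixA : ℝ := √(∫ ω, (S.θ 0 ω : ℝ) ∂P)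

/-- The weight of the averaged part of the limit; together, the weights satisfy
`mixA² = E θ` and `2 mixA mixC + mixC² = Var θ - E θ`. -/
noncomputable def mixC : ℝ := √(Var[fun ω ↦ (S.θ 0 ω : ℝ); P]) - √(∫ ω, (S.θ 0 ω : ℝ) ∂P)

lemma mixA_sq : S.mixA ^ 2 = ∫ ω, (S.θ 0 ω : ℝ) ∂P :=
  Real.sq_sqrt (integral_nonneg fun _ ↦ Nat.cast_nonneg _)

lemma mixC_identity : 2 * S.mixA * S.mixC + S.mixC ^ 2
    = Var[fun ω ↦ (S.θ 0 ω : ℝ); P] - ∫ ω, (S.θ 0 ω : ℝ) ∂P := by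
  have h1 : √(∫ ω, (S.θ 0 ω : ℝ) ∂P) ^ 2 = ∫ ω, (S.θ 0 ω : ℝ) ∂P :=
    Real.sq_sqrt (integral_nonneg fun _ ↦ Nat.cast_nonneg _)
  have h2 := Real.sq_sqrt (variance_nonneg (fun ω ↦ (S.θ 0 ω : ℝ)) P)
  rw [mixA, mixC]
  linear_combination h2 - h1

variable [IsProbabilityMeasure P] {ι : Type*} [Fintype ι] {τ : ι → ℝ≥0}

lemma integral_limitVariance {C : ℝ} {G : ℝ → Path → ℝ} (hG : IsDominated τ C G) :
    ∫ x, S.limitVariance G x = ∫ p, mix S.mixA S.mixC S.pathLaw G p ^ 2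
      ∂((volume : Measure ℝ).prod S.pathLaw) := by
  have h := hG.integral_mix_mul S.pathLaw hG S.mixA S.mixC
  simp_rw [sq]
  rw [h, S.mixA_sq, S.mixC_identity, ← integral_const_mul, ← integral_const_mul, ← integral_add]
  · refine integral_congr_ae (Eventually.of_forall fun x ↦ ?_)
    simp only [limitVariance]
    rw [hG.variance_eq S.pathLaw]
    simp_rw [sq]
    ring
  · have : Integrable (fun p : ℝ × Path ↦ G p.1 p.2 * G p.1 p.2)
      ((volume : Measure ℝ).prod S.pathLaw) :=
      (hG.memLp_uncurry S.pathLaw).integrable_mul (hG.memLp_uncurry S.pathLaw)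
    exact this.integral_prod_left.const_mul _
  · exact ((hG.memLp_integral S.pathLaw).integrable_mul
      (hG.memLp_integral S.pathLaw)).const_mul _

/-- The Hilbert space over which the limit process is built. -/
abbrev LimitSpace : Type := Lp ℝ 2 ((volume : Measure ℝ).prod S.pathLaw)

lemma isDominated_feature (t : ℝ≥0) : IsDominated (fun _ : Unit ↦ t)
    (exists_isDominated_feature fun _ : Unit ↦ t).choose fun x w ↦ feature (x + w t) :=
  (exists_isDominated_feature fun _ : Unit ↦ t).choose_spec.2 ()

/-- The kernel of the limit at time `t`. -/
noncomputable def limitKernel (t : ℝ≥0) :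
    Lp FeatureSpace 2 ((volume : Measure ℝ).prod S.pathLaw) :=
  ((isDominated_feature t).memLp_mix S.pathLaw S.mixA S.mixC).toLp _

/-- The operator `V_t` such that the limit at time `t` has the Gaussian coordinates `W (V_t h)`. -/
noncomputable def limitOp (t : ℝ≥0) : FeatureSpace →L[ℝ] S.LimitSpace := kernelOp (S.limitKernel t)

lemma limitOp_ae (t : ℝ≥0) (h : FeatureSpace) :
    S.limitOp t h =ᵐ[(volume : Measure ℝ).prod S.pathLaw]
      mix S.mixA S.mixC S.pathLaw fun x w ↦ ⟪h, feature (x + w t)⟫ := by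
  filter_upwards [kernelOp_ae (S.limitKernel t) h,
    ((isDominated_feature t).memLp_mix S.pathLaw S.mixA S.mixC).coeFn_toLp] with p h1 h2
  rw [limitOp, h1, limitKernel, h2]
  simp only [mix]
  rw [inner_add_right, real_inner_smul_right, real_inner_smul_right, smul_eq_mul, smul_eq_mul,
    ← integral_inner ((isDominated_feature t).integrable S.pathLaw p.1)]

/-- The linear functional `z ↦ ∑ a, ⟪h a, z a⟫`. -/
noncomputable def pairing (h : ι → FeatureSpace) : (ι → FeatureSpace) →L[ℝ] ℝ :=
  ∑ a, (innerSL ℝ (h a)).comp (ContinuousLinearMap.proj a)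

lemma pairing_apply (h z : ι → FeatureSpace) : pairing h z = ∑ a, ⟪h a, z a⟫ := by
  simp [pairing]

lemma norm_sum_limitOp_sq (τ : ι → ℝ≥0) (h : ι → FeatureSpace) :
    ‖∑ a, S.limitOp (τ a) (h a)‖ ^ 2
      = ∫ x, S.limitVariance (fun x w ↦ pairing h (featureVector τ x w)) x := by
  obtain ⟨C, hC, hCa⟩ := exists_isDominated_feature τ
  rw [S.integral_limitVariance (hC.clm (pairing h)), ← real_inner_self_eq_norm_sq, L2.inner_def]
  refine integral_congr_ae ?_
  have h1 : ∀ᵐ p ∂((volume : Measure ℝ).prod S.pathLaw), ∀ a, S.limitOp (τ a) (h a) p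
      = mix S.mixA S.mixC S.pathLaw (fun x w ↦ ⟪h a, feature (x + w (τ a))⟫) p :=
    ae_all_iff.2 fun a ↦ S.limitOp_ae (τ a) (h a)
  filter_upwards [h1, Lp.coeFn_finsetSum Finset.univ fun a ↦ S.limitOp (τ a) (h a)] with p h2 h3
  have h4 : mix S.mixA S.mixC S.pathLaw (fun x w ↦ pairing h (featureVector τ x w)) p
      = ∑ a, mix S.mixA S.mixC S.pathLaw (fun x w ↦ ⟪h a, feature (x + w (τ a))⟫) p := by
    simp only [mix, pairing_apply, featureVector, Finset.sum_add_distrib, Finset.smul_sum]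
    have h5 : ∀ a, Integrable (fun w : Path ↦ ⟪h a, feature (p.1 + w (τ a))⟫) S.pathLaw := fun a ↦
      ((hCa a).clm (innerSL ℝ (h a))).integrable S.pathLaw p.1
    rw [integral_finsetSum _ fun a _ ↦ h5 a, Finset.smul_sum]
  rw [h3, h4, Finset.sum_apply]
  simp only [h2]
  simp [sq]

end ParticleSystem

namespace ParticleSystem

/-! ### The covariance in terms of the stable semigroup -/

variable {Ω : Type*} [MeasurableSpace Ω] {α : ℝ} {P : Measure Ω} (S : ParticleSystem α P)

lemma map_pathLaw {f : Path → ℝ} (hf : Measurable f) :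
    S.pathLaw.map f = P.map fun ω ↦ f (S.path 0 0 ω) :=
  Measure.map_map hf (S.measurable_path 0 0)

/-- The increments are symmetric, so their characteristic function does not depend on the order
of the times. -/
lemma charFun_path_sub (s t : ℝ≥0) (u : ℝ) :
    charFun (S.pathLaw.map fun w ↦ w t - w s) u
      = Complex.exp (-((|(t : ℝ) - s| * |u| ^ α : ℝ) : ℂ)) := by
  have hm : ∀ r q : ℝ≥0, Measurable fun w : Path ↦ w r - w q := fun r q ↦ by fun_prop
  have hle : ∀ q r : ℝ≥0, q ≤ r → ∀ u, charFun (S.pathLaw.map fun w ↦ w r - w q) u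
      = Complex.exp (-((|(r : ℝ) - q| * |u| ^ α : ℝ) : ℂ)) := by
    intro q r hqr u
    rw [S.map_pathLaw (hm r q), abs_of_nonneg (sub_nonneg.2 (NNReal.coe_le_coe.2 hqr))]
    exact (S.stable_ξ 0 0).charFun_increment q r hqr u
  rcases le_total s t with h | h
  · exact hle s t h u
  · have h1 : (S.pathLaw.map fun w ↦ w t - w s)
        = (S.pathLaw.map fun w ↦ w s - w t).map (-1 * ·) := by
      rw [Measure.map_map (by fun_prop) (hm s t)]
      congr 1
      ext w
      simp
    rw [h1, charFun_map_mul, hle t s h, abs_sub_comm]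
    simp

lemma charFun_path (t : ℝ≥0) (u : ℝ) : charFun (S.pathLaw.map fun w ↦ w t) u
    = Complex.exp (-(((t : ℝ) * |u| ^ α : ℝ) : ℂ)) := by
  have h := S.charFun_path_sub 0 t u
  have h1 : (S.pathLaw.map fun w ↦ w t) = S.pathLaw.map fun w ↦ w t - w 0 := by
    rw [S.map_pathLaw (by fun_prop), S.map_pathLaw (by fun_prop)]
    refine Measure.map_congr ?_
    filter_upwards [(S.stable_ξ 0 0).start_zero] with ω hω
    have h2 : S.path 0 0 ω 0 = 0 := hω
    rw [h2, sub_zero]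
  rw [h1, h]
  simp

variable [IsProbabilityMeasure P]

lemma integral_path_eq_stableSemigroup (hα : 0 < α) (ψ : 𝓢(ℝ, ℝ)) (t : ℝ≥0) (x : ℝ) :
    ∫ w, ψ (x + w t) ∂S.pathLaw = stableSemigroup α t ψ x := by
  have hm : Measurable fun w : Path ↦ w t := by fun_prop
  have := Measure.isProbabilityMeasure_map (μ := S.pathLaw) hm.aemeasurable
  have hψ := ψ.continuous
  rw [← integral_comp_add_eq_stableSemigroup hα t.coe_nonneg (S.charFun_path t) ψ x,
    integral_map hm.aemeasurable (by fun_prop)]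

lemma integral_path_sub_eq_stableSemigroup (hα : 0 < α) (ψ : 𝓢(ℝ, ℝ)) (s t : ℝ≥0) (x : ℝ) :
    ∫ w, ψ (x + (w t - w s)) ∂S.pathLaw = stableSemigroup α |(t : ℝ) - s| ψ x := by
  have hm : Measurable fun w : Path ↦ w t - w s := by fun_prop
  have := Measure.isProbabilityMeasure_map (μ := S.pathLaw) hm.aemeasurable
  have hψ := ψ.continuous
  rw [← integral_comp_add_eq_stableSemigroup hα (abs_nonneg _) (S.charFun_path_sub s t) ψ x,
    integral_map hm.aemeasurable (by fun_prop)]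

lemma exists_schwartz_le_decay (φ : 𝓢(ℝ, ℝ)) : ∃ C, 0 ≤ C ∧ ∀ x, ‖φ x‖ ≤ C * decay x := by
  obtain ⟨C, hC, hCx⟩ := norm_feature_le
  refine ⟨‖analysisMap φ‖ * C, by positivity, fun x ↦ ?_⟩
  rw [← inner_analysisMap_feature φ x, mul_assoc]
  exact (norm_inner_le_norm _ _).trans (mul_le_mul_of_nonneg_left (hCx x) (norm_nonneg _))

/-- By translation invariance of Lebesgue measure, only the increment between the two times
matters for the displacement part of the covariance. -/
lemma integral_integral_path_mul (hα : 0 < α) (φ ψ : 𝓢(ℝ, ℝ)) (s t : ℝ≥0) :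
    ∫ x : ℝ, ∫ w, φ (x + w s) * ψ (x + w t) ∂S.pathLaw
      = ∫ x : ℝ, φ x * stableSemigroup α |(t : ℝ) - s| ψ x := by
  obtain ⟨C, hC, hφ⟩ := exists_schwartz_le_decay φ
  obtain ⟨D, hD, hψ⟩ := exists_schwartz_le_decay ψ
  have hd1 := isDominated_comp_position φ.continuous hC hφ ![s, t] 0
  have hd2 := isDominated_comp_position ψ.continuous hD hψ ![s, t] 1
  have hi1 : Integrable (Function.uncurry fun (x : ℝ) (w : Path) ↦ φ (x + w s) * ψ (x + w t))
      ((volume : Measure ℝ).prod S.pathLaw) :=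
    (hd1.memLp_uncurry S.pathLaw).integrable_mul (hd2.memLp_uncurry S.pathLaw)
  have hcφ := φ.continuous
  have hcψ := ψ.continuous
  have hi2 : Integrable (Function.uncurry fun (x : ℝ) (w : Path) ↦ φ x * ψ (x + (w t - w s)))
      ((volume : Measure ℝ).prod S.pathLaw) := by
    have hm : Measurable fun p : ℝ × Path ↦ φ p.1 * ψ (p.1 + (p.2 t - p.2 s)) := by
      have h1 : Measurable fun p : ℝ × Path ↦ p.1 + (p.2 t - p.2 s) := by fun_prop
      exact (hcφ.measurable.comp measurable_fst).mul (hcψ.measurable.comp h1)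
    refine ((φ.integrable (μ := volume)).norm.comp_fst S.pathLaw).mul_const D |>.mono'
      hm.aestronglyMeasurable (Eventually.of_forall fun p ↦ ?_)
    rw [Function.uncurry_def, norm_mul]
    refine mul_le_mul_of_nonneg_left ((hψ _).trans ?_) (norm_nonneg _)
    exact mul_le_of_le_one_right hD (decay_le_one _)
  rw [integral_integral_swap hi1]
  have h1 : ∀ w : Path, ∫ x : ℝ, φ (x + w s) * ψ (x + w t)
      = ∫ x : ℝ, φ x * ψ (x + (w t - w s)) := by
    intro w
    rw [← integral_add_right_eq_self (fun x ↦ φ x * ψ (x + (w t - w s))) (w s)]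
    refine integral_congr_ae (Eventually.of_forall fun x ↦ ?_)
    simp only
    congr 2
    ring
  simp_rw [h1]
  rw [← integral_integral_swap hi2]
  refine integral_congr_ae (Eventually.of_forall fun x ↦ ?_)
  simp only
  rw [integral_const_mul, S.integral_path_sub_eq_stableSemigroup hα]

/-- The covariance of the limit process: the squared weights of `mix` and the stable semigroup
reproduce the prescribed covariance functional. -/
lemma inner_limitOp_analysisMap (hα : 0 < α) (φ ψ : 𝓢(ℝ, ℝ)) (s t : ℝ≥0) :
    ⟪S.limitOp s (analysisMap φ), S.limitOp t (analysisMap ψ)⟫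
      = (∫ ω, (S.θ 0 ω : ℝ) ∂P) * (∫ x : ℝ, φ x * stableSemigroup α |(t : ℝ) - s| ψ x)
        + (Var[fun ω ↦ (S.θ 0 ω : ℝ); P] - ∫ ω, (S.θ 0 ω : ℝ) ∂P)
          * ∫ x : ℝ, stableSemigroup α s φ x * stableSemigroup α t ψ x := by
  obtain ⟨C, hC, hφ⟩ := exists_schwartz_le_decay φ
  obtain ⟨D, hD, hψ⟩ := exists_schwartz_le_decay ψ
  have hd1 : IsDominated ![s, t] C fun x w ↦ φ (x + w s) :=
    isDominated_comp_position φ.continuous hC hφ ![s, t] 0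
  have hd2 : IsDominated ![s, t] D fun x w ↦ ψ (x + w t) :=
    isDominated_comp_position ψ.continuous hD hψ ![s, t] 1
  have h := hd1.integral_mix_mul S.pathLaw hd2 S.mixA S.mixC
  rw [S.mixA_sq, S.mixC_identity, S.integral_integral_path_mul hα] at h
  simp_rw [S.integral_path_eq_stableSemigroup hα] at h
  rw [← h, L2.inner_def]
  refine integral_congr_ae ?_
  filter_upwards [S.limitOp_ae s (analysisMap φ), S.limitOp_ae t (analysisMap ψ)] with p h1 h2
  rw [h1, h2]
  simp only [inner_analysisMap_feature]
  exact mul_comm _ _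

end ParticleSystem

/-! ### The empirical measures as tempered distributions -/

section Tempered

lemma hasTemperateGrowth_of_integrable_decay {μ : Measure ℝ} (h : Integrable decay μ) :
    μ.HasTemperateGrowth := by
  refine ⟨2, h.mono' ?_ (Eventually.of_forall fun x ↦ ?_)⟩
  · exact Measurable.aestronglyMeasurable (by fun_prop)
  · rw [Real.norm_of_nonneg (by positivity), Real.rpow_neg (by positivity), decay]
    refine inv_anti₀ (by positivity) ?_
    rw [Nat.cast_ofNat, Real.rpow_two, Real.norm_eq_abs, ← sq_abs x]
    nlinarith [abs_nonneg x]

lemma toTempered_apply {μ : Measure ℝ} (h : μ.HasTemperateGrowth) (φ : 𝓢(ℝ, ℝ)) :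
    toTempered μ φ = ∫ x, φ x ∂μ := by
  rw [toTempered, dif_pos h]
  rfl

lemma integrable_schwartz_of_integrable_decay {μ : Measure ℝ} (h : Integrable decay μ)
    (φ : 𝓢(ℝ, ℝ)) : Integrable φ μ := by
  obtain ⟨C, -, hφ⟩ := ParticleSystem.exists_schwartz_le_decay φ
  exact (h.const_mul C).mono' φ.continuous.measurable.aestronglyMeasurable
    (Eventually.of_forall hφ)

/-- The continuous linear map from the feature space to `S'` dual to `analysisMap`. -/
noncomputable def toDual (z : FeatureSpace) : TemperedDual := (innerSL ℝ z).comp analysisMap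

lemma toDual_apply (z : FeatureSpace) (φ : 𝓢(ℝ, ℝ)) : toDual z φ = ⟪z, analysisMap φ⟫ := rfl

lemma continuous_toDual : Continuous toDual :=
  (ContinuousLinearMap.precomp ℝ analysisMap).continuous.comp (innerSL ℝ).continuous

end Tempered

namespace ParticleSystem

variable {Ω : Type*} [MeasurableSpace Ω] {α : ℝ} {P : Measure Ω} (S : ParticleSystem α P)

lemma lintegral_empirical (T : ℝ) (t : ℝ≥0) (ω : Ω) {f : ℝ → ENNReal} (hf : Measurable f) :
    ∫⁻ x, f x ∂S.empirical T t ω = ∑' j, S.cellSum T (fun x w ↦ f (x + w t)) j ω := by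
  rw [empirical, lintegral_sum_measure]
  refine tsum_congr fun j ↦ ?_
  rw [lintegral_finsetSum_measure, cellSum_eq]
  exact Finset.sum_congr rfl fun n _ ↦ lintegral_dirac' _ hf

lemma measurable_uncurry_position {E : Type*} [MeasurableSpace E] {f : ℝ → E} (hf : Measurable f)
    (t : ℝ≥0) : Measurable (Function.uncurry fun (x : ℝ) (w : Path) ↦ f (x + w t)) :=
  hf.comp (measurable_fst.add ((measurable_pi_apply t).comp measurable_snd))

lemma measurable_empirical (T : ℝ) (t : ℝ≥0) : Measurable (S.empirical T t) := by
  refine Measure.measurable_of_measurable_coe _ fun s hs ↦ ?_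
  have h1 : ∀ ω, S.empirical T t ω s
      = ∑' j, S.cellSum T (fun x w ↦ s.indicator (1 : ℝ → ENNReal) (x + w t)) j ω := by
    intro ω
    rw [← S.lintegral_empirical T t ω (measurable_one.indicator hs), lintegral_indicator_one hs]
  simp_rw [h1]
  exact Measurable.tsum fun j ↦ S.measurable_cellSum
    (measurable_uncurry_position (measurable_one.indicator hs) t) T j

lemma isDominated_decay (t : ℝ≥0) :
    IsDominated (fun _ : Unit ↦ t) 1 fun (x : ℝ) (w : Path) ↦ decay (x + w t) :=
  isDominated_comp_position continuous_decay zero_le_one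
    (fun x ↦ by rw [one_mul, Real.norm_of_nonneg (decay_pos x).le]) (fun _ : Unit ↦ t) ()

lemma lintegral_decay_empirical (T : ℝ) (t : ℝ≥0) (ω : Ω) :
    ∫⁻ x, ENNReal.ofReal (decay x) ∂S.empirical T t ω
      = ∑' j, ENNReal.ofReal (S.cellSum T (fun x w ↦ decay (x + w t)) j ω) := by
  rw [S.lintegral_empirical T t ω measurable_decay.ennreal_ofReal]
  refine tsum_congr fun j ↦ ?_
  rw [cellSum_eq, cellSum_eq, ENNReal.ofReal_sum_of_nonneg fun _ _ ↦ (decay_pos _).le]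

lemma cellSum_decay_nonneg (T : ℝ) (t : ℝ≥0) (j : ℤ) (ω : Ω) :
    0 ≤ S.cellSum T (fun x w ↦ decay (x + w t)) j ω := by
  rw [cellSum_eq]
  exact Finset.sum_nonneg fun _ _ ↦ (decay_pos _).le

lemma integrable_decay_of_lintegral_ne_top {μ : Measure ℝ}
    (h : ∫⁻ x, ENNReal.ofReal (decay x) ∂μ ≠ ⊤) : Integrable decay μ :=
  ⟨measurable_decay.aestronglyMeasurable, by
    rw [hasFiniteIntegral_iff_ofReal (Eventually.of_forall fun x ↦ (decay_pos x).le)]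
    exact h.lt_top⟩

lemma integral_empirical (T : ℝ) (t : ℝ≥0) (ω : Ω) {f : ℝ → ℝ} (hf : Measurable f)
    (hi : Integrable f (S.empirical T t ω)) :
    ∫ x, f x ∂S.empirical T t ω = ∑' j, S.cellSum T (fun x w ↦ f (x + w t)) j ω := by
  rw [empirical, integral_sum_measure hi]
  refine tsum_congr fun j ↦ ?_
  rw [integral_finsetSum_measure fun n _ ↦ integrable_dirac' hf.stronglyMeasurable (by simp),
    cellSum_eq]
  exact Finset.sum_congr rfl fun n _ ↦ integral_dirac' _ _ hf.stronglyMeasurable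

variable [IsProbabilityMeasure P]

lemma ae_integrable_decay_empirical {T : ℝ} (hT : 0 < T) (t : ℝ≥0) :
    ∀ᵐ ω ∂P, Integrable decay (S.empirical T t ω) := by
  filter_upwards [S.ae_summable_norm_cellSum (isDominated_decay t) hT] with ω hω
  refine integrable_decay_of_lintegral_ne_top ?_
  rw [S.lintegral_decay_empirical, ← ENNReal.ofReal_tsum_of_nonneg
    (fun j ↦ S.cellSum_decay_nonneg T t j ω) hω.of_norm]
  exact ENNReal.ofReal_ne_top

lemma integrable_decay_intensity {T : ℝ} (hT : 0 < T) (t : ℝ≥0) :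
    Integrable decay (S.intensity T t) := by
  refine integrable_decay_of_lintegral_ne_top ?_
  have hd := isDominated_decay t
  rw [intensity, Measure.lintegral_bind (S.measurable_empirical T t).aemeasurable
    measurable_decay.ennreal_ofReal.aemeasurable]
  simp_rw [S.lintegral_decay_empirical]
  rw [lintegral_tsum fun j ↦
    (S.measurable_cellSum hd.measurable T j).ennreal_ofReal.aemeasurable]
  have h1 : ∀ j, ∫⁻ ω, ENNReal.ofReal (S.cellSum T (fun x w ↦ decay (x + w t)) j ω) ∂P
      = ENNReal.ofReal (∫ ω, S.cellSum T (fun x w ↦ decay (x + w t)) j ω ∂P) := fun j ↦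
    (ofReal_integral_eq_lintegral_ofReal (S.integrable_cellSum hd T j)
      (Eventually.of_forall (S.cellSum_decay_nonneg T t j))).symm
  simp_rw [h1]
  rw [← ENNReal.ofReal_tsum_of_nonneg
    (fun j ↦ integral_nonneg (S.cellSum_decay_nonneg T t j)) (S.summable_integral_cellSum hd hT)]
  exact ENNReal.ofReal_ne_top

/-- **Campbell's formula** for the particle system. -/
lemma integral_intensity {T : ℝ} (hT : 0 < T) (t : ℝ≥0) (φ : 𝓢(ℝ, ℝ)) :
    ∫ x, φ x ∂S.intensity T t
      = ∑' j, ∫ ω, S.cellSum T (fun x w ↦ φ (x + w t)) j ω ∂P := by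
  obtain ⟨C, hC, hφ⟩ := exists_schwartz_le_decay φ
  have hd := isDominated_comp_position φ.continuous hC hφ (fun _ : Unit ↦ t) ()
  have hi := integrable_schwartz_of_integrable_decay (S.integrable_decay_intensity hT t) φ
  -- the intensity is the mixture of the kernel `ω ↦ N_ω` by `P`
  let κ : Kernel Ω ℝ := ⟨S.empirical T t, S.measurable_empirical T t⟩
  have h1 : S.intensity T t = (κ ∘ₖ Kernel.const Unit P) () := by
    rw [← Measure.comp_eq_comp_const_apply]; rfl
  rw [integral_tsum_of_summable_integral_norm (S.integrable_cellSum hd T)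
    (S.summable_integral_norm_cellSum hd hT)]
  rw [h1] at hi ⊢
  rw [Kernel.integral_comp hi, Kernel.const_apply]
  refine integral_congr_ae ?_
  filter_upwards [S.ae_integrable_decay_empirical hT t] with ω hω
  exact S.integral_empirical T t ω φ.continuous.measurable
    (integrable_schwartz_of_integrable_decay hω φ)

/-- The fluctuation, as an element of `S'`, is the image of a vector of the feature space. -/
theorem fluctuation_ae_eq {T : ℝ} (hT : 0 < T) (t : ℝ≥0) : ∀ᵐ ω ∂P, S.fluctuation T t ω
    = toDual (S.centeredSum T (fun x w ↦ feature (x + w t)) ω) := by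
  filter_upwards [S.ae_summable_norm_cellSum (isDominated_feature t) hT,
    S.ae_integrable_decay_empirical hT t] with ω h1 h2
  ext φ
  have h3 := S.clm_centeredSum (isDominated_feature t) hT (innerSL ℝ (analysisMap φ)) h1
  have h4 : (fun (x : ℝ) (w : Path) ↦ innerSL ℝ (analysisMap φ) (feature (x + w t)))
      = fun x w ↦ φ (x + w t) := by
    ext x w
    exact inner_analysisMap_feature φ _
  rw [h4] at h3
  have h5 : toDual (S.centeredSum T (fun x w ↦ feature (x + w t)) ω) φ
      = S.centeredSum T (fun x w ↦ φ (x + w t)) ω := by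
    rw [toDual_apply, real_inner_comm]
    exact h3
  have h6 := S.integrable_decay_intensity hT t
  rw [h5, fluctuation, smul_apply, sub_apply,
    toTempered_apply (hasTemperateGrowth_of_integrable_decay h2),
    toTempered_apply (hasTemperateGrowth_of_integrable_decay h6),
    S.integral_empirical T t ω φ.continuous.measurable
      (integrable_schwartz_of_integrable_decay h2 φ), S.integral_intensity hT, centeredSum]

end ParticleSystem

/-! ### Convergence to the Gaussian limit -/

namespace ParticleSystem

variable {Ω : Type*} [MeasurableSpace Ω] {α : ℝ} {P : Measure Ω} [IsProbabilityMeasure P]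
  (S : ParticleSystem α P)

/-- Convergence of the finite-dimensional distributions in the feature space. -/
theorem tendstoInDistribution_centeredSum {Ω' κ ι : Type*} [MeasurableSpace Ω'] [Fintype ι]
    {P' : Measure Ω'} [IsProbabilityMeasure P'] (b : HilbertBasis κ ℝ FeatureSpace)
    {W : S.LimitSpace →ₗᵢ[ℝ] Lp ℝ 2 P'} (hW : IsIsonormal W) {Z : ℝ≥0 → Ω' → FeatureSpace}
    (hZm : ∀ t, AEMeasurable (Z t) P')
    (hZ : ∀ t h, (fun ω ↦ ⟪h, Z t ω⟫) =ᵐ[P'] W (S.limitOp t h))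
    (hZt : ∀ t (s : Finset κ), ∫⁻ ω, ‖Z t ω - basisProj b s (Z t ω)‖ₑ ^ 2 ∂P'
        = ∑' i : {i // i ∉ s}, ENNReal.ofReal (‖S.limitOp t (b i)‖ ^ 2)) (τ : ι → ℝ≥0) :
    TendstoInDistribution (fun (T : Set.Ioi (0 : ℝ)) ↦ S.centeredSum T (featureVector τ)) atTop
      (fun ω a ↦ Z (τ a) ω) (fun _ ↦ P) P' := by
  obtain ⟨C, hG, hGa⟩ := exists_isDominated_feature τ
  have hm : ∀ T : Set.Ioi (0 : ℝ), AEMeasurable (S.centeredSum T (featureVector τ)) P := fun T ↦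
    S.aemeasurable_centeredSum hG T.2
  have hm' : AEMeasurable (fun ω a ↦ Z (τ a) ω) P' := aemeasurable_pi_lambda _ fun a ↦ hZm (τ a)
  refine ⟨hm, hm', ?_⟩
  have hco : Tendsto ((↑) : Set.Ioi (0 : ℝ) → ℝ) atTop atTop := by
    rw [Tendsto, map_val_Ioi_atTop]
  refine tendsto_of_seq_tendsto fun u hu ↦ tendsto_of_tendsto_charFun_of_tail b (fun h ↦ ?_) ?_
  · have hp : ∀ z : ι → FeatureSpace, ∑ a, ⟪h a, z a⟫ = pairing h z := fun z ↦
      (pairing_apply h z).symm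
    simp_rw [hp]
    have hlim := (S.tendsto_integral_cexp_centeredSum (hG.clm (pairing h))).comp (hco.comp hu)
    have h1 : ∫ z, Complex.exp ((pairing h z : ℝ) * Complex.I) ∂(P'.map fun ω a ↦ Z (τ a) ω)
        = Complex.exp (-((∫ x, S.limitVariance (fun x w ↦ pairing h (featureVector τ x w)) x) / 2
          : ℝ)) := by
      rw [integral_map hm' (by fun_prop), ← S.norm_sum_limitOp_sq, ← hW]
      refine integral_congr_ae ?_
      have h2 := sum_smul_isonormal_ae (W := W) Finset.univ (fun _ ↦ (1 : ℝ))
        (fun a ↦ S.limitOp (τ a) (h a)) fun a ↦ hZ (τ a) (h a)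
      simp only [one_mul, one_smul] at h2
      filter_upwards [h2] with ω hω
      rw [← hω, pairing_apply]
    have h3 : ∀ n, ∫ z, Complex.exp ((pairing h z : ℝ) * Complex.I)
          ∂(P.map (S.centeredSum (u n) (featureVector τ)))
        = ∫ ω, Complex.exp (S.centeredSum (u n) (fun x w ↦ pairing h (featureVector τ x w)) ω
          * Complex.I) ∂P := by
      intro n
      rw [integral_map (hm (u n)) (by fun_prop)]
      refine integral_congr_ae ?_
      filter_upwards [S.ae_clm_centeredSum hG (u n).2 (pairing h)] with ω hω
      rw [hω]
    change Tendsto (fun n ↦ ∫ z, Complex.exp ((pairing h z : ℝ) * Complex.I)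
      ∂(P.map (S.centeredSum (u n) (featureVector τ)))) atTop
      (𝓝 (∫ z, Complex.exp ((pairing h z : ℝ) * Complex.I) ∂(P'.map fun ω a ↦ Z (τ a) ω)))
    rw [h1]
    simp_rw [h3]
    exact hlim
  · intro ε hε
    have hmz : ∀ (s : Finset κ) (a : ι), Measurable fun z : ι → FeatureSpace ↦
        ‖z a - basisProj b s (z a)‖ₑ ^ 2 := fun s a ↦
      ((continuous_apply a).sub
        ((continuous_basisProj b s).comp (continuous_apply a))).measurable.enorm.pow_const 2
    obtain ⟨C', hC', hCx⟩ := norm_feature_le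
    obtain ⟨s₀, hs₀⟩ := S.exists_tail_centeredSum_le b continuous_feature hC' hCx τ hε
    have h1 : ∀ᶠ s : Finset κ in atTop, ∀ a,
        ∑' i : {i // i ∉ s}, ENNReal.ofReal (‖S.limitOp (τ a) (b i)‖ ^ 2) ≤ ENNReal.ofReal ε := by
      refine eventually_all.2 fun a ↦ ?_
      have hsum : ∑' i, ENNReal.ofReal (‖S.limitOp (τ a) (b i)‖ ^ 2) ≠ ⊤ := by
        have hs : Summable fun i ↦ ‖S.limitOp (τ a) (b i)‖ ^ 2 :=
          summable_norm_kernelOp_sq b (S.limitKernel (τ a))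
        rw [← ENNReal.ofReal_tsum_of_nonneg (fun _ ↦ by positivity) hs]
        exact ENNReal.ofReal_ne_top
      exact (ENNReal.tendsto_tsum_compl_atTop_zero hsum).eventually_le_const
        (ENNReal.ofReal_pos.2 hε)
    obtain ⟨s, hs1, hs2⟩ := ((eventually_ge_atTop s₀).and h1).exists
    refine ⟨s, ?_, fun a ↦ ?_⟩
    · filter_upwards [(hco.comp hu).eventually_ge_atTop 1] with n hn a
      have h3 : ∫⁻ ω, ‖S.centeredSum (u n) (featureVector τ) ω a
          - basisProj b s (S.centeredSum (u n) (featureVector τ) ω a)‖ₑ ^ 2 ∂P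
            ≤ ENNReal.ofReal ε := by
        refine le_trans (lintegral_mono_ae ?_) (hs₀ s hs1 (u n) hn a)
        filter_upwards [S.ae_clm_centeredSum hG (u n).2 (ContinuousLinearMap.proj (R := ℝ) a)]
          with ω hω
        have h2 : S.centeredSum (u n) (featureVector τ) ω a
          = S.centeredSum (u n) (fun x w ↦ feature (x + w (τ a))) ω := hω
        rw [h2]
      exact (lintegral_map' (hmz s a).aemeasurable (hm (u n))).trans_le h3
    · refine (lintegral_map' (hmz s a).aemeasurable hm').trans_le ?_
      exact (hZt (τ a) s).trans_le (hs2 a)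

end ParticleSystem

end DensityProcess

/-- The fluctuations of the high-density system of independent symmetric `α`-stable particles
converge in finite-dimensional distributions in `S'` to the density process. -/
theorem theorem2p1 {Ω : Type*} [MeasurableSpace Ω] (P : Measure Ω) [IsProbabilityMeasure P]
    (α : ℝ) (hα0 : 0 < α) (hα2 : α ≤ 2) (S : DensityProcess.ParticleSystem α P) :
    (∀ T : ℝ, 0 < T → ∀ t : ℝ≥0, (S.intensity T t).HasTemperateGrowth ∧
      ∀ᵐ ω ∂P, (S.empirical T t ω).HasTemperateGrowth) ∧
    ∃ (Ω' : Type) (_ : MeasurableSpace Ω') (P' : Measure Ω') (_ : IsProbabilityMeasure P')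
      (X : ℝ≥0 → Ω' → DensityProcess.TemperedDual),
      DensityProcess.IsCenteredGaussian X P' (fun s φ t ψ ↦
        (∫ ω, (S.θ 0 ω : ℝ) ∂P) *
            (∫ x : ℝ, φ x * DensityProcess.stableSemigroup α |(t : ℝ) - s| ψ x)
          + (Var[fun ω ↦ (S.θ 0 ω : ℝ); P] - ∫ ω, (S.θ 0 ω : ℝ) ∂P) *
            (∫ x : ℝ, DensityProcess.stableSemigroup α s φ x *
              DensityProcess.stableSemigroup α t ψ x)) ∧
      DensityProcess.TendstoInFDD S.fluctuation P X P' := by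
  open DensityProcess in
  refine ⟨fun T hT t ↦ ⟨hasTemperateGrowth_of_integrable_decay (S.integrable_decay_intensity hT t),
    (S.ae_integrable_decay_empirical hT t).mono fun ω hω ↦
      hasTemperateGrowth_of_integrable_decay hω⟩, ?_⟩
  open DensityProcess in
  obtain ⟨_, b, -⟩ := exists_hilbertBasis ℝ FeatureSpace
  open DensityProcess in
  obtain ⟨Ω', _, P', _, W, hW⟩ := exists_isonormal S.LimitSpace
  choose Z hZm hZ hZt using fun t ↦ DensityProcess.exists_vector_of_isonormal b W (S.limitOp t)
    (DensityProcess.summable_norm_kernelOp_sq b (S.limitKernel t))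
  have hX : ∀ p : ℝ≥0 × 𝓢(ℝ, ℝ), (fun ω ↦ DensityProcess.toDual (Z p.1 ω) p.2)
      =ᵐ[P'] W (S.limitOp p.1 (DensityProcess.analysisMap p.2)) := by
    intro p
    filter_upwards [hZ p.1 (DensityProcess.analysisMap p.2)] with ω hω
    rw [← hω, DensityProcess.toDual_apply, real_inner_comm]
  refine ⟨Ω', inferInstance, P', inferInstance, fun t ω ↦ DensityProcess.toDual (Z t ω),
    ⟨?_, fun t φ ↦ ?_, fun s φ t ψ ↦ ?_⟩, fun m t ↦ ?_⟩
  · exact DensityProcess.isGaussianProcess_of_ae_eq_isonormal hW _ hX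
  · exact DensityProcess.integral_isonormal hW (hX (t, φ))
  · rw [DensityProcess.integral_isonormal_mul (hX (s, φ)) (hX (t, ψ)),
      S.inner_limitOp_analysisMap hα0]
  · let _ : MeasurableSpace (Fin m → DensityProcess.TemperedDual) := borel _
    have : BorelSpace (Fin m → DensityProcess.TemperedDual) := ⟨rfl⟩
    have h1 := S.tendstoInDistribution_centeredSum b hW hZm hZ hZt t
    have h2 : Continuous fun (z : Fin m → DensityProcess.FeatureSpace) i ↦
        DensityProcess.toDual (z i) :=
      continuous_pi fun i ↦ DensityProcess.continuous_toDual.comp (continuous_apply i)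
    refine (h1.continuous_comp h2).congr (fun T ↦ ?_) EventuallyEq.rfl
    obtain ⟨C, hG, -⟩ := DensityProcess.exists_isDominated_feature t
    have h3 : ∀ᵐ ω ∂P, ∀ i, S.fluctuation T (t i) ω = DensityProcess.toDual
        (S.centeredSum T (fun x w ↦ DensityProcess.feature (x + w (t i))) ω) :=
      ae_all_iff.2 fun i ↦ S.fluctuation_ae_eq T.2 (t i)
    have h4 : ∀ᵐ ω ∂P, ∀ i, S.centeredSum T (DensityProcess.featureVector t) ω i
        = S.centeredSum T (fun x w ↦ DensityProcess.feature (x + w (t i))) ω :=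
      ae_all_iff.2 fun i ↦ S.ae_clm_centeredSum hG T.2 (ContinuousLinearMap.proj (R := ℝ) i)
    filter_upwards [h3, h4] with ω h5 h6
    ext1 i
    rw [h5 i, ← h6 i]
    rfl
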